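/- Let $I=[0,1]$ with Lebesgue measure. A simple bigraph is a finite simple bipartite graph $F=(V,E)$ with a fixed bipartition into a first and a second class; for $e\in E$ let $a(e)$ and $b(e)$ be its endpoints in the first and in the second class, respectively. For a bounded measurable function $W:I^2\to\mathbb{R}$ (not necessarily symmetric) put \[ t(F,W)=\int_{I^{V}}\ \prod_{e\in E} W(x_{a(e)},x_{b(e)})\ \prod_{i\in V}dx_i , \] so that in particular \[ t(C_4,W)=\int_{I^4} W(x_1,y_1)\,W(x_1,y_2)\,W(x_2,y_1)\,W(x_2,y_2)\,dx_1\,dx_2\,dy_1\,dy_2 . \] Theorem. Let $F$ be a simple bigraph with $m$ edges, and let $W:I^2\to\mathbb{R}$ be a measurable function with $\int_{I^2}W=1$, $0\le W\le 2$ and $t(C_4,W-1)\le 2^{-4m}$. Then $t(F,W)\ge 1$. -/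

import Mathlib

open MeasureTheory unitInterval

/-- The edges of a bigraph `F` on the node set `V`, each written as the ordered pair
`(a(e), b(e))` of its endpoint `a(e)` in the first class and its endpoint `b(e)` in the second.
The fixed bipartition is the colouring `c`: the first class consists of the nodes coloured
`false`, the second class of those coloured `true`. -/
noncomputable def bigraphEdges {V : Type*} [Fintype V] (F : SimpleGraph V)
    (c : F.Coloring Bool) : Finset (V × V) :=
  open Classical in
  Finset.univ.filter fun e => F.Adj e.1 e.2 ∧ c e.1 = false ∧ c e.2 = true

/-- The density `t(F, W) = ∫_{I^V} ∏_{e ∈ E(F)} W(x_{a(e)}, x_{b(e)}) dx` of a simple bigraph `F`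
(with bipartition `c`) in a function `W : I × I → ℝ`, where `I = [0, 1]` carries the Lebesgue
measure. The function `W` need not be symmetric. -/
noncomputable def bigraphDensity {V : Type*} [Fintype V] (F : SimpleGraph V)
    (c : F.Coloring Bool) (W : I → I → ℝ) : ℝ :=
  ∫ x : V → I, ∏ e ∈ bigraphEdges F c, W (x e.1) (x e.2)

/-- The density `t(C_4, W)` of the 4-cycle, with its nodes coloured alternately. -/
noncomputable def fourCycleDensity (W : I → I → ℝ) : ℝ :=
  bigraphDensity (SimpleGraph.cycleGraph 4)
    (SimpleGraph.cycleGraph.bicoloring_of_even 4 (by decide)) W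

/-! Write `W = 1 + U`, so that `|U| ≤ 1` and `∫ U = 0`, and expand the product over the edges: `t(F,
W)` is the sum of `t(S, U)` over all edge sets `S` of `F`. The empty set contributes 1, and the
other terms must be shown to have nonnegative sum. Some of them are collectively nonnegative with
sum `P`; every other term is at least `-ε P`, where `ε = t(C_4, U)^(1/4) ≤ 2^(-m)`. As there are at
most `2^m` terms, the total is at least `1 + P - P` (`one_le_sum_of_dominates`).

The good terms are the complete bipartite graphs with more than one edge, stars included. Fix the
first class `A` and let `B` run through the subsets with at least two elements of the common
neighbourhood of `A`, of size `n`. Integrating out `B` turns this part of the sum into `∫ ((1 + τ)^n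
- 1 - n τ)`, where `τ ∈ [-1, 1]` is the average over `s` of `∏_{a ∈ A} U(x_a, s)`. By a sharpened
Bernoulli inequality it is nonnegative, and at least `∫ τ²` when `n ≥ 2`. Stars centred in the
second class are treated alike (`bicliqueSum_eq`). Hence the biclique sum dominates the squared
norms of the marginals of `U` at nodes of degree at least two, and `t(C_4, U)` if `F` contains a
4-cycle. If the shortest cycle of `F` is longer, its own nonnegative term is added to `P`. Since
cycle densities decrease with the length, `P` then dominates all of them.

For the remaining terms (`isBiclique_or_lower_bound`): an isolated edge makes the integral vanish.
Otherwise `S` has two leaves or a cycle. Two leaves produce two marginals. A shortest cycle splits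
into two arcs, and integrating out their interiors leaves two functions whose squared norms are at
most the cycle density, whatever other edges hang on the arcs (`hsSq_pathKer_le`). In both cases
Cauchy-Schwarz gives `P`, and a further edge acting between the two factors gains the operator norm
of `U`, which is at most `ε`. A cycle with a leaf attached is handled with one marginal and one arc,
the factor `ε` coming from the other arc. Where no suitable further edge exists, `S` is complete
bipartite or a chordless cycle, with nonnegative integral in the latter case. -/

/-! ### Bounded measurable functions -/

/-- Bounded measurable real functions. -/
def BddMeas {α : Type*} [MeasurableSpace α] (f : α → ℝ) : Prop :=
  Measurable f ∧ ∃ C, ∀ x, |f x| ≤ C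

namespace BddMeas

variable {α β γ : Type*} [MeasurableSpace α] [MeasurableSpace β] [MeasurableSpace γ]

theorem const (r : ℝ) : BddMeas (fun _ : α => r) := ⟨measurable_const, |r|, fun _ => le_rfl⟩

theorem mul {f g : α → ℝ} (hf : BddMeas f) (hg : BddMeas g) : BddMeas (fun x => f x * g x) := by
  obtain ⟨hf, C, hC⟩ := hf
  obtain ⟨hg, D, hD⟩ := hg
  refine ⟨hf.mul hg, C * D, fun x => ?_⟩
  rw [abs_mul]
  exact mul_le_mul (hC x) (hD x) (abs_nonneg _) ((abs_nonneg _).trans (hC x))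

theorem add {f g : α → ℝ} (hf : BddMeas f) (hg : BddMeas g) : BddMeas (fun x => f x + g x) := by
  obtain ⟨hf, C, hC⟩ := hf
  obtain ⟨hg, D, hD⟩ := hg
  exact ⟨hf.add hg, C + D, fun x => (abs_add_le _ _).trans (add_le_add (hC x) (hD x))⟩

theorem abs {f : α → ℝ} (hf : BddMeas f) : BddMeas (fun x => |f x|) := by
  obtain ⟨hf, C, hC⟩ := hf
  exact ⟨hf.abs, C, fun x => by rw [abs_abs]; exact hC x⟩

theorem sq {f : α → ℝ} (hf : BddMeas f) : BddMeas (fun x => f x ^ 2) := by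
  simpa [pow_two] using hf.mul hf

theorem pow {f : α → ℝ} (hf : BddMeas f) (n : ℕ) : BddMeas (fun x => f x ^ n) := by
  induction n with
  | zero => simpa using const 1
  | succ n ih => simpa [pow_succ] using ih.mul hf

theorem sqrt {f : α → ℝ} (hf : BddMeas f) : BddMeas (fun x => √(f x)) := by
  obtain ⟨hf, C, hC⟩ := hf
  refine ⟨hf.sqrt, √C, fun x => ?_⟩
  rw [abs_of_nonneg (Real.sqrt_nonneg _)]
  exact Real.sqrt_le_sqrt ((le_abs_self _).trans (hC x))

theorem prod {ι : Type*} (s : Finset ι) {f : ι → α → ℝ} (hf : ∀ i ∈ s, BddMeas (f i)) :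
    BddMeas (fun x => ∏ i ∈ s, f i x) := by
  classical
  induction s using Finset.induction_on with
  | empty => simpa using const 1
  | insert i s hi ih =>
    simp only [Finset.prod_insert hi]
    exact (hf i (Finset.mem_insert_self i s)).mul
      (ih fun j hj => hf j (Finset.mem_insert_of_mem hj))

theorem comp {f : α → ℝ} (hf : BddMeas f) {g : β → α} (hg : Measurable g) :
    BddMeas (fun x => f (g x)) := by
  obtain ⟨hf, C, hC⟩ := hf
  exact ⟨hf.comp hg, C, fun x => hC _⟩

theorem comp₂ {F : α → β → ℝ} (hF : BddMeas (fun p : α × β => F p.1 p.2)) {f : γ → α} {g : γ → β}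
    (hf : Measurable f) (hg : Measurable g) : BddMeas (fun x => F (f x) (g x)) :=
  hF.comp (hf.prodMk hg)

theorem integrable {f : α → ℝ} (hf : BddMeas f) (μ : Measure α) [IsFiniteMeasure μ] :
    Integrable f μ := by
  obtain ⟨hf, C, hC⟩ := hf
  exact Integrable.of_bound hf.aestronglyMeasurable C (Filter.Eventually.of_forall hC)

theorem integral {F : α → β → ℝ} (hF : BddMeas (fun p : α × β => F p.1 p.2)) (μ : Measure β)
    [IsProbabilityMeasure μ] : BddMeas (fun a => ∫ b, F a b ∂μ) := by
  obtain ⟨hF, C, hC⟩ := hF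
  refine ⟨?_, C, fun a => ?_⟩
  · exact (StronglyMeasurable.integral_prod_right (ν := μ) (f := F)
      hF.stronglyMeasurable).measurable
  · have := norm_integral_le_of_norm_le_const (μ := μ) (f := F a) (C := C)
      (Filter.Eventually.of_forall fun b => hC (a, b))
    simpa using this

theorem integral_swap {F : α → β → ℝ} (hF : BddMeas (fun p : α × β => F p.1 p.2))
    (μ : Measure α) (ν : Measure β) [IsProbabilityMeasure μ] [IsProbabilityMeasure ν] :
    ∫ a, ∫ b, F a b ∂ν ∂μ = ∫ b, ∫ a, F a b ∂μ ∂ν :=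
  integral_integral_swap (hF.integrable _)

theorem integral_prod_eq {F : α → β → ℝ} (hF : BddMeas (fun p : α × β => F p.1 p.2))
    (μ : Measure α) (ν : Measure β) [IsProbabilityMeasure μ] [IsProbabilityMeasure ν] :
    ∫ p, F p.1 p.2 ∂(μ.prod ν) = ∫ a, ∫ b, F a b ∂ν ∂μ :=
  integral_prod (fun p : α × β => F p.1 p.2) (hF.integrable _)

/-- Cauchy-Schwarz for bounded measurable functions. -/
theorem sq_integral_mul_le {f g : α → ℝ} (hf : BddMeas f) (hg : BddMeas g) (μ : Measure α)
    [IsProbabilityMeasure μ] :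
    (∫ x, f x * g x ∂μ) ^ 2 ≤ (∫ x, f x ^ 2 ∂μ) * ∫ x, g x ^ 2 ∂μ := by
  have key : ∀ t : ℝ, 0 ≤ (∫ x, f x ^ 2 ∂μ) * (t * t) + (2 * ∫ x, f x * g x ∂μ) * t
      + ∫ x, g x ^ 2 ∂μ := by
    intro t
    have h : ∫ x, (t * f x + g x) ^ 2 ∂μ = (∫ x, f x ^ 2 ∂μ) * (t * t)
        + (2 * ∫ x, f x * g x ∂μ) * t + ∫ x, g x ^ 2 ∂μ := by
      have e : ∀ x, (t * f x + g x) ^ 2 = (t * t) * f x ^ 2 + (2 * t) * (f x * g x) + g x ^ 2 :=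
        fun x => by ring
      simp only [e]
      rw [integral_add, integral_add, integral_const_mul, integral_const_mul]
      · ring
      · exact ((const _).mul hf.sq).integrable μ
      · exact ((const _).mul (hf.mul hg)).integrable μ
      · exact (((const _).mul hf.sq).add ((const _).mul (hf.mul hg))).integrable μ
      · exact hg.sq.integrable μ
    rw [← h]
    exact integral_nonneg fun x => sq_nonneg _
  have := discrim_le_zero key
  unfold discrim at this
  nlinarith

theorem abs_integral_mul_le {f g : α → ℝ} (hf : BddMeas f) (hg : BddMeas g) (μ : Measure α)
    [IsProbabilityMeasure μ] :
    |∫ x, f x * g x ∂μ| ≤ √(∫ x, f x ^ 2 ∂μ) * √(∫ x, g x ^ 2 ∂μ) := by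
  rw [← Real.sqrt_mul (integral_nonneg fun x => sq_nonneg _)]
  exact Real.abs_le_sqrt (sq_integral_mul_le hf hg μ)

theorem integral_mono {f g : α → ℝ} (hf : BddMeas f) (hg : BddMeas g) (μ : Measure α)
    [IsProbabilityMeasure μ] (h : ∀ x, f x ≤ g x) : ∫ x, f x ∂μ ≤ ∫ x, g x ∂μ :=
  MeasureTheory.integral_mono (hf.integrable μ) (hg.integrable μ) h

end BddMeas

/-! ### Kernels on the unit interval -/

/-- The kernel `U` (for `false`) or its transpose (for `true`). -/
def orient (U : I → I → ℝ) (β : Bool) : I → I → ℝ := fun s t => if β then U t s else U s t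

theorem orient_not (U : I → I → ℝ) (β : Bool) (s t : I) : orient U (!β) s t = orient U β t s := by
  cases β <;> rfl

/-- Bounded measurable kernels. -/
abbrev BddKer (K : I → I → ℝ) : Prop := BddMeas (fun p : I × I => K p.1 p.2)

theorem BddKer.swap {K : I → I → ℝ} (hK : BddKer K) : BddKer (fun s t => K t s) :=
  hK.comp₂ measurable_snd measurable_fst

theorem BddKer.orient {U : I → I → ℝ} (hU : BddKer U) (β : Bool) : BddKer (orient U β) := by
  cases β
  · exact hU
  · exact hU.swap

/-- Squared Hilbert-Schmidt norm. -/
noncomputable def hsSq (K : I → I → ℝ) : ℝ := ∫ p : I × I, K p.1 p.2 ^ 2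

/-- The operator with kernel `K` has squared norm at most `δ`. -/
def OpLe (K : I → I → ℝ) (δ : ℝ) : Prop :=
  ∀ φ : I → ℝ, BddMeas φ → ∫ s, (∫ t, K s t * φ t) ^ 2 ≤ δ * ∫ t, φ t ^ 2

theorem hsSq_nonneg (K : I → I → ℝ) : 0 ≤ hsSq K := integral_nonneg fun _ => sq_nonneg _

theorem hsSq_eq {K : I → I → ℝ} (hK : BddKer K) : hsSq K = ∫ s, ∫ t, K s t ^ 2 :=
  BddMeas.integral_prod_eq (F := fun s t => K s t ^ 2) hK.sq volume volume

theorem hsSq_swap {K : I → I → ℝ} (hK : BddKer K) : hsSq (fun s t => K t s) = hsSq K := by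
  rw [hsSq_eq hK, hsSq_eq hK.swap]
  exact BddMeas.integral_swap (F := fun s t => K t s ^ 2) hK.swap.sq volume volume

theorem BddKer.apply {K : I → I → ℝ} (hK : BddKer K) {φ : I → ℝ} (hφ : BddMeas φ) :
    BddMeas (fun s => ∫ t, K s t * φ t) :=
  BddMeas.integral (F := fun s t => K s t * φ t) (hK.mul (hφ.comp measurable_snd)) volume

theorem BddKer.comp {K L : I → I → ℝ} (hK : BddKer K) (hL : BddKer L) :
    BddKer (fun s t => ∫ r, K s r * L r t) :=
  BddMeas.integral (F := fun (p : I × I) r => K p.1 r * L r p.2)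
    ((hK.comp₂ (measurable_fst.comp measurable_fst) measurable_snd).mul
      (hL.comp₂ measurable_snd (measurable_snd.comp measurable_fst))) volume

/-- With `g` the image of `φ` under the transpose, `‖g‖² = ⟨φ, K g⟩`. Cauchy-Schwarz and the bound
for `K` give `‖g‖⁴ ≤ δ ‖φ‖² ‖g‖²`, and one factor cancels. -/
theorem OpLe.swap {K : I → I → ℝ} {δ : ℝ} (hδ : 0 ≤ δ) (hK : BddKer K) (h : OpLe K δ) :
    OpLe (fun s t => K t s) δ := by
  intro φ hφ
  set g : I → ℝ := fun s => ∫ t, K t s * φ t with hg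
  have hgm : BddMeas g := hK.swap.apply hφ
  have h1 : ∫ s, g s ^ 2 = ∫ t, φ t * ∫ s, K t s * g s := by
    have : ∀ s, g s ^ 2 = ∫ t, φ t * (K t s * g s) := by
      intro s
      rw [pow_two]
      nth_rw 1 [hg]
      rw [← integral_mul_const]
      congr 1; ext t; ring
    simp only [this]
    rw [BddMeas.integral_swap (F := fun s t => φ t * (K t s * g s))]
    · simp only [integral_const_mul]
    · exact (hφ.comp measurable_snd).mul (hK.swap.mul (hgm.comp measurable_fst))
  have h2 : (∫ s, g s ^ 2) ^ 2 ≤ (∫ t, φ t ^ 2) * (δ * ∫ s, g s ^ 2) := by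
    calc (∫ s, g s ^ 2) ^ 2 ≤ (∫ t, φ t ^ 2) * ∫ t, (∫ s, K t s * g s) ^ 2 := by
          rw [h1]; exact BddMeas.sq_integral_mul_le hφ (hK.apply hgm) volume
      _ ≤ _ := mul_le_mul_of_nonneg_left (h g hgm) (integral_nonneg fun _ => sq_nonneg _)
  have h3 : 0 ≤ ∫ s, g s ^ 2 := integral_nonneg fun _ => sq_nonneg _
  have h4 : 0 ≤ ∫ s, φ s ^ 2 := integral_nonneg fun _ => sq_nonneg _
  rcases h3.eq_or_lt with h5 | h5
  · rw [← h5]; positivity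
  · refine le_of_mul_le_mul_right ?_ h5
    nlinarith

/-- Exchange identity `⟨AB, CE⟩ = ⟨AᵀC, BEᵀ⟩` for the Hilbert-Schmidt inner product. -/
theorem hs_inner_exchange {A B C E : I → I → ℝ} (hA : BddKer A) (hB : BddKer B) (hC : BddKer C)
    (hE : BddKer E) :
    ∫ p : I × I, (∫ s, A p.1 s * B s p.2) * (∫ t, C p.1 t * E t p.2) =
      ∫ q : I × I, (∫ a, A a q.1 * C a q.2) * (∫ b, B q.1 b * E q.2 b) := by
  have e1 : ∀ p : I × I, (∫ s, A p.1 s * B s p.2) * (∫ t, C p.1 t * E t p.2) =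
      ∫ q : I × I, (A p.1 q.1 * B q.1 p.2) * (C p.1 q.2 * E q.2 p.2) := fun p =>
    (integral_prod_mul (μ := (volume : Measure I)) (ν := (volume : Measure I))
      (fun s => A p.1 s * B s p.2) (fun t => C p.1 t * E t p.2)).symm
  have e2 : ∀ q : I × I, (∫ a, A a q.1 * C a q.2) * (∫ b, B q.1 b * E q.2 b) =
      ∫ p : I × I, (A p.1 q.1 * B q.1 p.2) * (C p.1 q.2 * E q.2 p.2) := fun q => by
    rw [← integral_prod_mul (μ := (volume : Measure I)) (ν := (volume : Measure I))
      (fun a => A a q.1 * C a q.2) (fun b => B q.1 b * E q.2 b)]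
    refine integral_congr_ae (Filter.Eventually.of_forall fun p => ?_)
    simp only; ring
  simp only [e1, e2]
  refine BddMeas.integral_swap
    (F := fun p q : I × I => (A p.1 q.1 * B q.1 p.2) * (C p.1 q.2 * E q.2 p.2)) ?_ volume volume
  refine BddMeas.mul (BddMeas.mul ?_ ?_) (BddMeas.mul ?_ ?_)
  · exact hA.comp₂ (by fun_prop) (by fun_prop)
  · exact hB.comp₂ (by fun_prop) (by fun_prop)
  · exact hC.comp₂ (by fun_prop) (by fun_prop)
  · exact hE.comp₂ (by fun_prop) (by fun_prop)

/-- The left side is a 4-cycle of kernels; it is cut along its other diagonal before applying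
Cauchy-Schwarz. -/
theorem sq_hs_inner_le {A B C E : I → I → ℝ} (hA : BddKer A) (hB : BddKer B) (hC : BddKer C)
    (hE : BddKer E) :
    (∫ p : I × I, (∫ s, A p.1 s * B s p.2) * (∫ t, C p.1 t * E t p.2)) ^ 2 ≤
      hsSq (fun s t => ∫ a, A a s * C a t) * hsSq (fun s t => ∫ b, B s b * E t b) := by
  rw [hs_inner_exchange hA hB hC hE]
  exact BddMeas.sq_integral_mul_le (hA.swap.comp hC) (hB.comp hE.swap) volume

/-! ### Weighted path kernels -/

/-- The kernel of a path with `n` interior nodes carrying the weights `w 0, …, w (n - 1)`, whose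
edges carry `U` and its transpose alternately. -/
noncomputable def pathKer (U : I → I → ℝ) : Bool → ℕ → (ℕ → I → ℝ) → I → I → ℝ
  | β, 0, _ => orient U β
  | β, n + 1, w => fun s t => ∫ r, (orient U β s r * w 0 r) * pathKer U (!β) n (fun i => w (i + 1)) r t

/-- Weights are measurable with values in `[-1, 1]`. -/
def IsWeight (w : ℕ → I → ℝ) : Prop := ∀ i, Measurable (w i) ∧ ∀ s, |w i s| ≤ 1

theorem IsWeight.bdd {w : ℕ → I → ℝ} (hw : IsWeight w) (i : ℕ) : BddMeas (w i) :=
  ⟨(hw i).1, 1, (hw i).2⟩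

theorem IsWeight.shift {w : ℕ → I → ℝ} (hw : IsWeight w) : IsWeight (fun i => w (i + 1)) :=
  fun i => hw (i + 1)

/-- The weight `1` followed by the weights `w`. -/
def consOne (w : ℕ → I → ℝ) : ℕ → I → ℝ
  | 0 => fun _ => 1
  | i + 1 => w i

theorem IsWeight.consOne {w : ℕ → I → ℝ} (hw : IsWeight w) : IsWeight (consOne w)
  | 0 => ⟨measurable_const, fun _ => by simp [_root_.consOne]⟩
  | i + 1 => hw i

theorem isWeight_one : IsWeight (fun _ _ => 1) := fun _ => ⟨measurable_const, fun _ => by simp⟩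

theorem BddKer.pathKer {U : I → I → ℝ} (hU : BddKer U) (β : Bool) (n : ℕ) {w : ℕ → I → ℝ}
    (hw : IsWeight w) : BddKer (pathKer U β n w) := by
  induction n generalizing β w with
  | zero => exact hU.orient β
  | succ n ih =>
    exact BddKer.comp (K := fun s r => _root_.orient U β s r * w 0 r)
      ((hU.orient β).mul ((hw.bdd 0).comp measurable_snd)) (ih (!β) hw.shift)

theorem pathKer_congr (U : I → I → ℝ) (β : Bool) (n : ℕ) {w w' : ℕ → I → ℝ}
    (h : ∀ i < n, w i = w' i) : pathKer U β n w = pathKer U β n w' := by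
  induction n generalizing β w w' with
  | zero => rfl
  | succ n ih =>
    ext s t
    simp only [pathKer]
    rw [h 0 (Nat.succ_pos n), ih (!β) (w := fun i => w (i + 1)) (w' := fun i => w' (i + 1))
      fun i hi => h (i + 1) (Nat.succ_lt_succ hi)]

theorem orient_abs_le {U : I → I → ℝ} (hb : ∀ s t, |U s t| ≤ 1) (β : Bool) (s t : I) :
    |orient U β s t| ≤ 1 := by
  cases β
  · exact hb s t
  · exact hb t s

theorem abs_integral_le_one {f : I → ℝ} (h : ∀ s, |f s| ≤ 1) : |∫ s, f s| ≤ 1 := by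
  have := norm_integral_le_of_norm_le_const (μ := (volume : Measure I)) (f := f) (C := 1)
    (Filter.Eventually.of_forall h)
  simpa using this

theorem abs_mul_le_one {a b : ℝ} (ha : |a| ≤ 1) (hb : |b| ≤ 1) : |a * b| ≤ 1 := by
  rw [abs_mul]
  exact mul_le_one₀ ha (abs_nonneg _) hb

theorem pathKer_abs_le {U : I → I → ℝ} (hb : ∀ s t, |U s t| ≤ 1) (β : Bool) (n : ℕ)
    {w : ℕ → I → ℝ} (hw : IsWeight w) (s t : I) : |pathKer U β n w s t| ≤ 1 := by
  induction n generalizing β w s with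
  | zero => exact orient_abs_le hb β s t
  | succ n ih =>
    exact abs_integral_le_one fun r => abs_mul_le_one
      (abs_mul_le_one (orient_abs_le hb β s r) ((hw 0).2 r)) (ih (!β) hw.shift r)

/-- The orientation after `n` alternations, starting from `β`. -/
def altern : Bool → ℕ → Bool
  | β, 0 => β
  | β, n + 1 => altern (!β) n

theorem altern_not (β : Bool) (n : ℕ) : altern (!β) n = !altern β n := by
  induction n generalizing β with
  | zero => rfl
  | succ n ih => exact ih (!β)

/-- Peeling off the last edge of a path. -/
theorem pathKer_succ_last {U : I → I → ℝ} (hU : BddKer U) (β : Bool) (n : ℕ) {w : ℕ → I → ℝ}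
    (hw : IsWeight w) (s t : I) :
    pathKer U β (n + 1) w s t =
      ∫ r, pathKer U β n w s r * (w n r * orient U (altern β (n + 1)) r t) := by
  induction n generalizing β w s with
  | zero => simp only [pathKer, altern, mul_assoc]
  | succ n ih =>
    have e : ∀ r, pathKer U (!β) (n + 1) (fun i => w (i + 1)) r t = _ :=
      fun r => ih (!β) hw.shift r
    rw [pathKer]
    simp only [e, ← integral_const_mul]
    rw [BddMeas.integral_swap (F := fun r q => (orient U β s r * w 0 r) *
      (pathKer U (!β) n (fun i => w (i + 1)) r q *
        (w (n + 1) q * orient U (altern (!β) (n + 1)) q t)))]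
    · refine integral_congr_ae (Filter.Eventually.of_forall fun q => ?_)
      simp only [pathKer, altern]
      rw [← integral_mul_const]
      congr 1; ext r; ring
    · have h1 : BddMeas (fun p : I × I => orient U β s p.1) :=
        (hU.orient β).comp₂ measurable_const measurable_fst
      have h2 : BddMeas (fun p : I × I => orient U (altern (!β) (n + 1)) p.2 t) :=
        (hU.orient _).comp₂ measurable_snd measurable_const
      exact (h1.mul ((hw.bdd 0).comp measurable_fst)).mul
        ((hU.pathKer (!β) n hw.shift).mul (((hw.bdd (n + 1)).comp measurable_snd).mul h2))

theorem hsSq_mono {K L : I → I → ℝ} (hK : BddKer K) (hL : BddKer L)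
    (h : ∀ s t, |K s t| ≤ |L s t|) : hsSq K ≤ hsSq L :=
  BddMeas.integral_mono hK.sq hL.sq volume fun p => sq_le_sq.2 (h p.1 p.2)

theorem abs_mul_le_right {a b : ℝ} (ha : |a| ≤ 1) : |a * b| ≤ |b| := by
  rw [abs_mul]
  exact mul_le_of_le_one_left (abs_nonneg _) ha

/-- Rotating the closed path obtained by reflecting a weighted path. -/
theorem sq_hsSq_pathKer_le {U : I → I → ℝ} (hU : BddKer U) (β : Bool) {n : ℕ} (hn : n ≠ 0)
    {w : ℕ → I → ℝ} (hw : IsWeight w) (hwn : w n = fun _ => 1) :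
    hsSq (pathKer U β n w) ^ 2 ≤
      hsSq (pathKer U (!β) n (consOne w)) * hsSq (pathKer U (!β) n (fun i => w (i + 1))) := by
  obtain ⟨m, rfl⟩ := Nat.exists_eq_succ_of_ne_zero hn
  have hA : BddKer (fun s r => orient U β s r * w 0 r) :=
    (hU.orient β).mul ((hw.bdd 0).comp measurable_snd)
  have hB := hU.pathKer (!β) m hw.shift
  have hC := hU.pathKer β m hw
  have hE : BddKer (fun r t => w m r * orient U (altern β (m + 1)) r t) :=
    ((hw.bdd m).comp measurable_fst).mul (hU.orient _)
  -- One copy of the kernel is split after its first edge, the other before its last edge, so that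
  -- the exchange rotates the closed walk by one edge.
  have e : hsSq (pathKer U β (m + 1) w) =
      ∫ p : I × I, (∫ s, (orient U β p.1 s * w 0 s) *
          pathKer U (!β) m (fun i => w (i + 1)) s p.2) *
        (∫ t, pathKer U β m w p.1 t * (w m t * orient U (altern β (m + 1)) t p.2)) := by
    refine integral_congr_ae (Filter.Eventually.of_forall fun p => ?_)
    simp only
    rw [pow_two]
    nth_rw 2 [pathKer_succ_last hU β m hw]
    rfl
  rw [Nat.succ_eq_add_one, e]
  refine (sq_hs_inner_le hA hB hC hE).trans (mul_le_mul ?_ ?_ (hsSq_nonneg _) (hsSq_nonneg _))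
  -- The first edge read backwards, followed by the path without its last edge: the old starting
  -- node becomes interior with weight 1. The weight `w 0` now sits at an end and is dropped.
  · refine hsSq_mono (hA.swap.comp hC) (hU.pathKer _ _ hw.consOne) fun s t => ?_
    have : ∫ a, (orient U β a s * w 0 s) * pathKer U β m w a t =
        w 0 s * pathKer U (!β) (m + 1) (consOne w) s t := by
      simp only [pathKer, consOne, Bool.not_not, orient_not, mul_one]
      rw [← integral_const_mul]
      congr 1; ext r; ring
    rw [this]
    exact abs_mul_le_right ((hw 0).2 s)
  -- Here the old last node becomes interior and takes the weight `w (m + 1)`, which `hwn` makes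
  -- equal to 1. The weight `w m` moves to an end and is dropped.
  · refine hsSq_mono (hB.comp hE.swap) (hU.pathKer _ _ hw.shift) fun s t => ?_
    have : ∫ b, pathKer U (!β) m (fun i => w (i + 1)) s b *
          (w m t * orient U (altern β (m + 1)) t b) =
        w m t * pathKer U (!β) (m + 1) (fun i => w (i + 1)) s t := by
      rw [pathKer_succ_last hU (!β) m hw.shift, ← integral_const_mul]
      have hwn' : w (m + 1) = fun _ => 1 := hwn
      simp only [hwn', altern_not, orient_not, one_mul]
      congr 1; ext r; ring
    rw [this]
    exact abs_mul_le_right ((hw m).2 t)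

/-- The density of the cycle of length `2 (n + 1)`. -/
noncomputable def cycleDens (U : I → I → ℝ) (n : ℕ) : ℝ := hsSq (pathKer U false n fun _ _ => 1)

theorem cycleDens_nonneg (U : I → I → ℝ) (n : ℕ) : 0 ≤ cycleDens U n := hsSq_nonneg _

theorem consOne_one : consOne (fun _ _ => 1) = fun _ _ => 1 := by
  ext i s
  cases i <;> rfl

/-- With unit weights, rotating the closed walk by one edge exchanges the two orientations, so each
is bounded by the other. -/
theorem hsSq_pathKer_one {U : I → I → ℝ} (hU : BddKer U) (β : Bool) {n : ℕ} (hn : n ≠ 0) :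
    hsSq (pathKer U β n fun _ _ => 1) = cycleDens U n := by
  have key : ∀ β, hsSq (pathKer U β n fun _ _ => 1) ≤ hsSq (pathKer U (!β) n fun _ _ => 1) := by
    intro β
    have := sq_hsSq_pathKer_le hU β hn isWeight_one rfl
    rw [consOne_one, ← pow_two] at this
    exact (pow_le_pow_iff_left₀ (hsSq_nonneg _) (hsSq_nonneg _) two_ne_zero).1 this
  cases β
  · rfl
  · exact le_antisymm (key true) (key false)

/-- Weights in `[-1, 1]` do not increase the Hilbert-Schmidt norm of a path kernel beyond its value
for the weights `1`. -/
theorem hsSq_pathKer_le {U : I → I → ℝ} (hU : BddKer U) (hb : ∀ s t, |U s t| ≤ 1) (β : Bool)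
    {n : ℕ} (hn : n ≠ 0) {w : ℕ → I → ℝ} (hw : IsWeight w) :
    hsSq (pathKer U β n w) ≤ cycleDens U n := by
  classical
  set s : Set ℝ := {x | ∃ (β : Bool) (w : ℕ → I → ℝ), IsWeight w ∧ x = hsSq (pathKer U β n w)}
    with hs
  have hle : ∀ (β : Bool) (w : ℕ → I → ℝ), IsWeight w → hsSq (pathKer U β n w) ≤ 1 := by
    intro β w hw
    have := BddMeas.integral_mono (hU.pathKer β n hw).sq (BddMeas.const 1) volume
      fun p => (sq_le_one_iff_abs_le_one _).2 (pathKer_abs_le hb β n hw p.1 p.2)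
    simpa [hsSq] using this
  have hbdd : BddAbove s := ⟨1, by rintro _ ⟨β, w, hw, rfl⟩; exact hle β w hw⟩
  -- The supremum is over all weights and both orientations, since a rotation changes both.
  set M := sSup s
  have hM : ∀ (β : Bool) (w : ℕ → I → ℝ), IsWeight w → hsSq (pathKer U β n w) ≤ M :=
    fun β w hw => le_csSup hbdd ⟨β, w, hw, rfl⟩
  have hM0 : 0 ≤ M := (hsSq_nonneg _).trans (hM true w hw)
  -- Each rotation shifts the weights by one and produces a second factor that is at most `M`. After
  -- `n` rotations only unit weights are left.
  have iter : ∀ (k : ℕ) (β : Bool) (w : ℕ → I → ℝ), IsWeight w → (∀ i, n ≤ i → w i = fun _ => 1) →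
      ∃ β', hsSq (pathKer U β n w) ^ 2 ^ k ≤
        M ^ (2 ^ k - 1) * hsSq (pathKer U β' n fun i => w (i + k)) := by
    intro k
    induction k with
    | zero => exact fun β w _ _ => ⟨β, by simp⟩
    | succ k ih =>
      intro β w hw h1
      obtain ⟨β', h⟩ := ih β w hw h1
      refine ⟨!β', ?_⟩
      have hw' : IsWeight fun i => w (i + k) := fun i => hw (i + k)
      have h2 := sq_hsSq_pathKer_le hU β' hn hw' (h1 (n + k) (by omega))
      have e : (fun i => w (i + 1 + k)) = fun i => w (i + (k + 1)) := by
        funext i; exact congrArg w (by omega)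
      rw [e] at h2
      have h3 := hM (!β') _ hw'.consOne
      have e2 : 2 ^ (k + 1) - 1 = (2 ^ k - 1) * 2 + 1 := by
        have := Nat.one_le_two_pow (n := k); rw [pow_succ]; omega
      calc hsSq (pathKer U β n w) ^ 2 ^ (k + 1) = (hsSq (pathKer U β n w) ^ 2 ^ k) ^ 2 := by
            rw [← pow_mul, ← pow_succ]
        _ ≤ (M ^ (2 ^ k - 1) * hsSq (pathKer U β' n fun i => w (i + k))) ^ 2 :=
            pow_le_pow_left₀ (pow_nonneg (hsSq_nonneg _) _) h 2
        _ = M ^ ((2 ^ k - 1) * 2) * hsSq (pathKer U β' n fun i => w (i + k)) ^ 2 := by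
            rw [mul_pow, ← pow_mul]
        _ ≤ M ^ ((2 ^ k - 1) * 2) *
              (M * hsSq (pathKer U (!β') n fun i => w (i + (k + 1)))) := by
            refine mul_le_mul_of_nonneg_left (h2.trans ?_) (by positivity)
            exact mul_le_mul_of_nonneg_right h3 (hsSq_nonneg _)
        _ = _ := by rw [e2, pow_succ, mul_assoc]
  have key : ∀ x ∈ s, x ^ 2 ^ n ≤ M ^ (2 ^ n - 1) * cycleDens U n := by
    rintro _ ⟨β, w, hw, rfl⟩
    -- The kernel reads only the weights with index below `n`; the others may be set to 1.
    have hw' : IsWeight fun i => if i < n then w i else fun _ => 1 := by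
      intro i
      by_cases hi : i < n
      · simpa [hi] using hw i
      · simp [hi]
    obtain ⟨β', h⟩ := iter n β _ hw' fun i hi => if_neg (not_lt.2 hi)
    rw [pathKer_congr U β n (w' := w) fun i hi => if_pos hi] at h
    have e : (fun i => if i + n < n then w (i + n) else fun _ => (1 : ℝ)) = fun _ _ => 1 := by
      ext i; simp
    rwa [e, hsSq_pathKer_one hU β' hn] at h
  have hc := cycleDens_nonneg U n
  -- The supremum over `x` in `key` gives an inequality for `M` itself, and cancelling `M ^ (2 ^ n -
  -- 1)` leaves `M ≤ cycleDens U n`.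
  have hroot : M ^ 2 ^ n ≤ M ^ (2 ^ n - 1) * cycleDens U n := by
    set y := M ^ (2 ^ n - 1) * cycleDens U n
    have hy : 0 ≤ y := by positivity
    have e : (y ^ (((2 ^ n : ℕ) : ℝ)⁻¹)) ^ 2 ^ n = y := Real.rpow_inv_natCast_pow hy (by positivity)
    have : M ≤ y ^ (((2 ^ n : ℕ) : ℝ)⁻¹) := by
      refine csSup_le ⟨_, β, w, hw, rfl⟩ fun x hx => ?_
      refine le_of_pow_le_pow_left₀ (n := 2 ^ n) (by positivity) (Real.rpow_nonneg hy _) ?_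
      rw [e]; exact key x hx
    calc M ^ 2 ^ n ≤ _ := pow_le_pow_left₀ hM0 this _
      _ = y := e
  refine (hM β w hw).trans ?_
  rcases hM0.eq_or_lt with h0 | h0
  · rw [← h0]; exact hc
  · have e2 : M ^ 2 ^ n = M ^ (2 ^ n - 1) * M := by
      rw [← pow_succ, Nat.sub_add_cancel Nat.one_le_two_pow]
    rw [e2] at hroot
    exact le_of_mul_le_mul_left hroot (by positivity)

/-! ### Operator bounds -/

/-- `‖Uᵀφ‖²` is the inner product of `φ ⊗ φ` with `UUᵀ`, whose squared Hilbert-Schmidt norm is the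
4-cycle density. Since `OpLe` bounds the squared norm, the operator norm is at most the fourth root.
-/
theorem opLe_cycleDens {U : I → I → ℝ} (hU : BddKer U) (β : Bool) :
    OpLe (orient U β) √(cycleDens U 1) := by
  have key : OpLe (fun s t => U t s) √(cycleDens U 1) := by
    intro φ hφ
    have e : ∀ s, (∫ t, U t s * φ t) ^ 2 =
        ∫ p : I × I, (φ p.1 * φ p.2) * (U p.1 s * U p.2 s) := by
      intro s
      rw [pow_two]
      refine (integral_prod_mul (μ := (volume : Measure I)) (ν := (volume : Measure I))
        (fun t => U t s * φ t) (fun t => U t s * φ t)).symm.trans ?_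
      refine integral_congr_ae (Filter.Eventually.of_forall fun p => ?_)
      simp only; ring
    have hφφ : BddMeas (fun p : I × I => φ p.1 * φ p.2) :=
      (hφ.comp measurable_fst).mul (hφ.comp measurable_snd)
    have h1 : ∫ s, (∫ t, U t s * φ t) ^ 2 =
        ∫ p : I × I, (φ p.1 * φ p.2) * ∫ s, U p.1 s * U p.2 s := by
      simp only [e]
      rw [BddMeas.integral_swap
        (F := fun (s : I) (p : I × I) => (φ p.1 * φ p.2) * (U p.1 s * U p.2 s))]
      · simp only [integral_const_mul]
      · exact (hφφ.comp measurable_snd).mul ((hU.comp₂ (by fun_prop) (by fun_prop)).mul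
          (hU.comp₂ (by fun_prop) (by fun_prop)))
    have hk : BddKer (fun a b => ∫ s, U a s * U b s) := hU.comp hU.swap
    have h2 := BddMeas.abs_integral_mul_le hφφ hk volume
    have h3 : ∫ p : I × I, (φ p.1 * φ p.2) ^ 2 = (∫ t, φ t ^ 2) ^ 2 := by
      rw [pow_two (∫ t, φ t ^ 2)]
      refine Eq.trans ?_ (integral_prod_mul (μ := (volume : Measure I)) (ν := (volume : Measure I))
        (fun t => φ t ^ 2) (fun t => φ t ^ 2))
      simp only [mul_pow]; rfl
    have h4 : ∫ p : I × I, (∫ s, U p.1 s * U p.2 s) ^ 2 = cycleDens U 1 := by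
      simp only [cycleDens, hsSq, pathKer, orient, mul_one]; rfl
    rw [h1, mul_comm]
    rw [h3, h4, Real.sqrt_sq (integral_nonneg fun _ => sq_nonneg _)] at h2
    exact (le_abs_self _).trans h2
  cases β
  · exact OpLe.swap (Real.sqrt_nonneg _) hU.swap key
  · exact key

theorem cycleDens_le_one {U : I → I → ℝ} (hU : BddKer U) (hb : ∀ s t, |U s t| ≤ 1) (n : ℕ) :
    cycleDens U n ≤ 1 := by
  have := BddMeas.integral_mono (hU.pathKer false n isWeight_one).sq (BddMeas.const 1) volume
    fun p => (sq_le_one_iff_abs_le_one _).2 (pathKer_abs_le hb false n isWeight_one p.1 p.2)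
  simpa [cycleDens, hsSq] using this

/-- The transpose of a weighted path kernel is bounded like one edge. -/
theorem opLe_pathKer_swap {U : I → I → ℝ} (hU : BddKer U) (hb : ∀ s t, |U s t| ≤ 1) (β : Bool)
    (n : ℕ) {w : ℕ → I → ℝ} (hw : IsWeight w) :
    OpLe (fun t s => pathKer U β n w s t) √(cycleDens U 1) := by
  have hle : √(cycleDens U 1) ≤ 1 := Real.sqrt_le_one.2 (cycleDens_le_one hU hb 1)
  induction n generalizing β w with
  | zero =>
    have := opLe_cycleDens hU (!β)
    exact fun φ hφ => by simpa [pathKer, orient_not] using this φ hφ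
  | succ n ih =>
    intro φ hφ
    -- The transposed path first applies its transposed first edge, then the weight `w 0`, then the
    -- transposed rest. All these are contractions, so the bound for a single edge can be kept.
    set g : I → ℝ := fun r => ∫ s, orient U (!β) r s * φ s with hg
    have hgm : BddMeas g := (hU.orient (!β)).apply hφ
    have hwg : BddMeas (fun r => w 0 r * g r) := (hw.bdd 0).mul hgm
    have e : ∀ t, ∫ s, pathKer U β (n + 1) w s t * φ s =
        ∫ r, pathKer U (!β) n (fun i => w (i + 1)) r t * (w 0 r * g r) := by
      intro t
      simp only [pathKer, hg, orient_not, ← integral_const_mul, ← integral_mul_const]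
      rw [BddMeas.integral_swap (F := fun s r => orient U β s r * w 0 r *
        pathKer U (!β) n (fun i => w (i + 1)) r t * φ s)]
      · congr 1; ext r; congr 1; ext s; ring
      · exact (((hU.orient β).mul ((hw.bdd 0).comp measurable_snd)).mul
          ((hU.pathKer (!β) n hw.shift).comp₂ measurable_snd measurable_const)).mul
          (hφ.comp measurable_fst)
    simp only [e]
    have h1 := ih (!β) hw.shift _ hwg
    have h2 : ∫ r, (w 0 r * g r) ^ 2 ≤ ∫ r, g r ^ 2 :=
      BddMeas.integral_mono hwg.sq hgm.sq volume
        fun r => sq_le_sq.2 (abs_mul_le_right ((hw 0).2 r))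
    have h3 := opLe_cycleDens hU (!β) φ hφ
    have h4 : 0 ≤ ∫ t, φ t ^ 2 := integral_nonneg fun _ => sq_nonneg _
    have h0 := Real.sqrt_nonneg (cycleDens U 1)
    calc _ ≤ _ := h1
      _ ≤ √(cycleDens U 1) * (√(cycleDens U 1) * ∫ t, φ t ^ 2) := by
        gcongr; exact h2.trans h3
      _ ≤ 1 * (√(cycleDens U 1) * ∫ t, φ t ^ 2) := by gcongr
      _ = _ := one_mul _

/-- Row bound for weighted path kernels with at least two edges. -/
theorem integral_sq_pathKer_le {U : I → I → ℝ} (hU : BddKer U) (hb : ∀ s t, |U s t| ≤ 1) (β : Bool)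
    {n : ℕ} (hn : n ≠ 0) {w : ℕ → I → ℝ} (hw : IsWeight w) (s : I) :
    ∫ t, pathKer U β n w s t ^ 2 ≤ √(cycleDens U 1) := by
  obtain ⟨m, rfl⟩ := Nat.exists_eq_succ_of_ne_zero hn
  -- Row `s` of the kernel is the transposed rest of the path applied to the weighted first edge, a
  -- function of norm at most 1.
  have hφ : BddMeas (fun r => orient U β s r * w 0 r) :=
    ((hU.orient β).comp₂ measurable_const measurable_id).mul (hw.bdd 0)
  have h := opLe_pathKer_swap hU hb (!β) m hw.shift _ hφ
  have h2 : ∫ r, (orient U β s r * w 0 r) ^ 2 ≤ 1 := by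
    have := BddMeas.integral_mono hφ.sq (BddMeas.const 1) volume
      fun r => (sq_le_one_iff_abs_le_one _).2
        (abs_mul_le_one (orient_abs_le hb β s r) ((hw 0).2 r))
    simpa using this
  calc _ = ∫ t, (∫ r, pathKer U (!β) m (fun i => w (i + 1)) r t *
        (orient U β s r * w 0 r)) ^ 2 := by
        simp only [pathKer, mul_comm]
    _ ≤ _ := h
    _ ≤ √(cycleDens U 1) * 1 := mul_le_mul_of_nonneg_left h2 (Real.sqrt_nonneg _)
    _ = _ := mul_one _

/-- Prepending an edge to a path applies the operator of `U` to every column of its kernel. -/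
theorem cycleDens_succ_le {U : I → I → ℝ} (hU : BddKer U) {n : ℕ} (hn : n ≠ 0) :
    cycleDens U (n + 1) ≤ √(cycleDens U 1) * cycleDens U n := by
  have hK := hU.pathKer true n isWeight_one
  have hK' := hU.pathKer false (n + 1) isWeight_one
  rw [← hsSq_pathKer_one hU true hn, cycleDens, ← hsSq_swap hK', ← hsSq_swap hK,
    hsSq_eq hK.swap, hsSq_eq hK'.swap, ← integral_const_mul]
  refine BddMeas.integral_mono (BddMeas.integral (F := fun s t => _) hK'.swap.sq volume)
    ((BddMeas.const _).mul (BddMeas.integral (F := fun s t => _) hK.swap.sq volume)) volume ?_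
  intro t
  have := opLe_cycleDens hU false (fun r => pathKer U true n (fun _ _ => 1) r t)
    (hK.comp₂ measurable_id measurable_const)
  simpa [pathKer] using this

theorem cycleDens_anti {U : I → I → ℝ} (hU : BddKer U) (hb : ∀ s t, |U s t| ≤ 1) {m n : ℕ}
    (hm : m ≠ 0) (h : m ≤ n) : cycleDens U n ≤ cycleDens U m := by
  induction n, h using Nat.le_induction with
  | base => exact le_rfl
  | succ n hmn ih =>
    refine (cycleDens_succ_le hU (by omega)).trans ((mul_le_of_le_one_left
      (cycleDens_nonneg U n) ?_).trans ih)
    exact Real.sqrt_le_one.2 (cycleDens_le_one hU hb 1)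

/-! ### Integrating out one node -/

section Averages

set_option linter.unusedSectionVars false

open Function

variable {V : Type*} [Fintype V] [DecidableEq V]

/-- `f` does not depend on the coordinate `v`. -/
def Indep (v : V) {R : Type*} (f : (V → I) → R) : Prop := ∀ x s, f (update x v s) = f x

/-- The average of `f` over the coordinate `v`. -/
noncomputable def avg (v : V) (f : (V → I) → ℝ) : (V → I) → ℝ := fun x => ∫ s, f (update x v s)

/-- Resampling one coordinate independently preserves the product measure. This lets Fubini
arguments stay on `V → I`: averages over a node remain functions of all coordinates. -/
theorem measurePreserving_update (v : V) :
    MeasurePreserving (fun q : (V → I) × I => update q.1 v q.2)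
      (volume.prod volume) (volume : Measure (V → I)) := by
  refine ⟨measurable_update', ?_⟩
  refine (Measure.pi_eq fun t ht => ?_).symm
  rw [Measure.map_apply measurable_update' (MeasurableSet.univ_pi ht)]
  have e : (fun q : (V → I) × I => update q.1 v q.2) ⁻¹' Set.univ.pi t =
      (Set.univ.pi (update t v Set.univ)) ×ˢ t v := by
    ext q
    simp only [Set.mem_preimage, Set.mem_pi, Set.mem_univ, forall_const, Set.mem_prod]
    constructor
    · intro h
      refine ⟨fun i => ?_, by simpa using h v⟩
      by_cases hi : i = v
      · subst hi; simp
      · simpa [hi] using h i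
    · rintro ⟨h1, h2⟩ i
      by_cases hi : i = v
      · subst hi; simpa using h2
      · simpa [hi] using h1 i
  rw [e, Measure.prod_prod, volume_pi, Measure.pi_pi, ← Finset.mul_prod_erase _ _ (Finset.mem_univ v),
    ← Finset.mul_prod_erase _ (fun i => volume (t i)) (Finset.mem_univ v)]
  simp only [update_self, measure_univ, one_mul]
  rw [mul_comm]
  congr 1
  refine Finset.prod_congr rfl fun i hi => ?_
  rw [update_of_ne (Finset.ne_of_mem_erase hi)]

theorem BddMeas.update {f : (V → I) → ℝ} (hf : BddMeas f) (v : V) :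
    BddMeas (fun q : (V → I) × I => f (Function.update q.1 v q.2)) :=
  hf.comp measurable_update'

theorem BddMeas.avg {f : (V → I) → ℝ} (hf : BddMeas f) (v : V) : BddMeas (avg v f) :=
  BddMeas.integral (F := fun x s => f (Function.update x v s)) (hf.update v) volume

theorem integral_avg {f : (V → I) → ℝ} (hf : BddMeas f) (v : V) : ∫ x, avg v f x = ∫ x, f x := by
  have h := measurePreserving_update (V := V) v
  have h1 := BddMeas.integral_prod_eq (F := fun x s => f (update x v s)) (hf.update v) volume volume
  refine h1.symm.trans ?_
  rw [← integral_map h.measurable.aemeasurable hf.1.aestronglyMeasurable, h.map_eq]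

theorem Indep.mul {v : V} {f g : (V → I) → ℝ} (hf : Indep v f) (hg : Indep v g) :
    Indep v (fun x => f x * g x) := fun x s => by simp only [hf x s, hg x s]

theorem Indep.eval {v u : V} (h : u ≠ v) {R : Type*} (f : I → R) :
    Indep v (fun x => f (x u)) := fun x s => by simp only [update_of_ne h]

/-- The fourth root of the density of the 4-cycle, which bounds the operator norm. -/
noncomputable def fourRoot (U : I → I → ℝ) : ℝ := √√(cycleDens U 1)

theorem fourRoot_nonneg (U : I → I → ℝ) : 0 ≤ fourRoot U := Real.sqrt_nonneg _

theorem abs_bilinear_le {U : I → I → ℝ} (hU : BddKer U) (β : Bool) {φ ψ : I → ℝ} (hφ : BddMeas φ)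
    (hψ : BddMeas ψ) :
    |∫ s, φ s * ∫ t, orient U β s t * ψ t| ≤ fourRoot U * (√(∫ s, φ s ^ 2) * √(∫ t, ψ t ^ 2)) := by
  refine (BddMeas.abs_integral_mul_le hφ ((hU.orient β).apply hψ) volume).trans ?_
  have h := Real.sqrt_le_sqrt (opLe_cycleDens hU β ψ hψ)
  rw [Real.sqrt_mul (Real.sqrt_nonneg _)] at h
  calc _ ≤ √(∫ s, φ s ^ 2) * (√√(cycleDens U 1) * √(∫ t, ψ t ^ 2)) :=
        mul_le_mul_of_nonneg_left h (Real.sqrt_nonneg _)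
    _ = _ := by rw [fourRoot]; ring

/-- One edge between nodes `v` and `w` gains a factor `fourRoot U` over Cauchy-Schwarz. -/
theorem abs_integral_edge_le {U : I → I → ℝ} (hU : BddKer U) (β : Bool) {v w : V} (hvw : v ≠ w)
    {φ ψ : (V → I) → ℝ} (hφ : BddMeas φ) (hψ : BddMeas ψ) (hφw : Indep w φ) (hψv : Indep v ψ) :
    |∫ x, orient U β (x v) (x w) * φ x * ψ x| ≤
      fourRoot U * (√(∫ x, φ x ^ 2) * √(∫ x, ψ x ^ 2)) := by
  have hK : BddMeas (fun x : V → I => orient U β (x v) (x w)) :=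
    (hU.orient β).comp₂ (measurable_pi_apply v) (measurable_pi_apply w)
  have hF : BddMeas (fun x => orient U β (x v) (x w) * φ x * ψ x) := (hK.mul hφ).mul hψ
  -- With the other coordinates fixed, `φ` is a function of `x v` alone and `ψ` of `x w` alone, so
  -- the integral is a bilinear form in the operator of one edge.
  have e : ∀ x, avg v (avg w fun x => orient U β (x v) (x w) * φ x * ψ x) x =
      ∫ s, φ (update x v s) * ∫ t, orient U β s t * ψ (update x w t) := by
    intro x
    simp only [avg, ← integral_const_mul]
    congr 1; ext s; congr 1; ext t
    rw [hφw, update_comm hvw, hψv]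
    simp only [update_self, update_of_ne hvw.symm]
    ring
  have hφx : ∀ x, BddMeas fun s => φ (update x v s) := fun x => hφ.comp (measurable_update x)
  have hψx : ∀ x, BddMeas fun s => ψ (update x w s) := fun x => hψ.comp (measurable_update x)
  rw [← integral_avg hF w, ← integral_avg (hF.avg w) v]
  refine (abs_integral_le_integral_abs).trans ?_
  have ha : BddMeas (fun x => √(avg v (fun x => φ x ^ 2) x)) := (hφ.sq.avg v).sqrt
  have hb : BddMeas (fun x => √(avg w (fun x => ψ x ^ 2) x)) := (hψ.sq.avg w).sqrt
  have h1 : ∫ x, |avg v (avg w fun x => orient U β (x v) (x w) * φ x * ψ x) x| ≤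
      ∫ x, fourRoot U * (√(avg v (fun x => φ x ^ 2) x) * √(avg w (fun x => ψ x ^ 2) x)) := by
    refine BddMeas.integral_mono ((hF.avg w).avg v).abs ((BddMeas.const _).mul (ha.mul hb)) _ ?_
    intro x
    rw [e]
    exact abs_bilinear_le hU β (hφx x) (hψx x)
  refine h1.trans ?_
  rw [integral_const_mul]
  refine mul_le_mul_of_nonneg_left ?_ (fourRoot_nonneg U)
  refine (le_abs_self _).trans ((BddMeas.abs_integral_mul_le ha hb _).trans (le_of_eq ?_))
  have e1 : ∀ x, √(avg v (fun x => φ x ^ 2) x) ^ 2 = avg v (fun x => φ x ^ 2) x :=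
    fun x => Real.sq_sqrt (integral_nonneg fun _ => sq_nonneg _)
  have e2 : ∀ x, √(avg w (fun x => ψ x ^ 2) x) ^ 2 = avg w (fun x => ψ x ^ 2) x :=
    fun x => Real.sq_sqrt (integral_nonneg fun _ => sq_nonneg _)
  simp only [e1, e2]
  rw [integral_avg hφ.sq, integral_avg hψ.sq]

theorem integral_eval {f : I → ℝ} (hf : BddMeas f) (v : V) : ∫ x : V → I, f (x v) = ∫ s, f s := by
  rw [← integral_avg (hf.comp (measurable_pi_apply v)) v]
  simp [avg]

theorem integral_eval₂ {F : I → I → ℝ} (hF : BddKer F) {v w : V} (h : v ≠ w) :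
    ∫ x : V → I, F (x v) (x w) = ∫ s, ∫ t, F s t := by
  have hm : BddMeas (fun x : V → I => F (x v) (x w)) :=
    hF.comp₂ (measurable_pi_apply v) (measurable_pi_apply w)
  rw [← integral_avg hm w, ← integral_avg (hm.avg w) v]
  simp [avg, update_of_ne h]

/-! ### Integrating out the interior of a path -/

/-- The product of the edge weights and of the weights of the interior nodes `p 1, …, p n` along
the path `p 0, …, p (n + 1)`. -/
noncomputable def pathProd (U : I → I → ℝ) : Bool → ℕ → (ℕ → V) → (ℕ → (V → I) → I → ℝ) → (V → I) → ℝ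
  | β, 0, p, _ => fun x => orient U β (x (p 0)) (x (p 1))
  | β, n + 1, p, w => fun x => (orient U β (x (p 0)) (x (p 1)) * w 0 x (x (p 1))) *
      pathProd U (!β) n (fun i => p (i + 1)) (fun i => w (i + 1)) x

/-- Weights depending measurably on a parameter, with values in `[-1, 1]`. -/
def IsParamWeight {α : Type*} [MeasurableSpace α] (w : ℕ → α → I → ℝ) : Prop :=
  ∀ i, Measurable (fun q : α × I => w i q.1 q.2) ∧ ∀ x s, |w i x s| ≤ 1

theorem IsParamWeight.bdd {α : Type*} [MeasurableSpace α] {w : ℕ → α → I → ℝ}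
    (hw : IsParamWeight w) (i : ℕ) : BddMeas (fun q : α × I => w i q.1 q.2) :=
  ⟨(hw i).1, 1, fun q => (hw i).2 q.1 q.2⟩

theorem IsParamWeight.shift {α : Type*} [MeasurableSpace α] {w : ℕ → α → I → ℝ}
    (hw : IsParamWeight w) : IsParamWeight (fun i => w (i + 1)) := fun i => hw (i + 1)

theorem IsParamWeight.isWeight {α : Type*} [MeasurableSpace α] {w : ℕ → α → I → ℝ}
    (hw : IsParamWeight w) (x : α) : IsWeight (fun i => w i x) :=
  fun i => ⟨(hw i).1.comp (by fun_prop : Measurable fun s : I => (x, s)), (hw i).2 x⟩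

theorem bddMeas_pathKer {U : I → I → ℝ} (hU : BddKer U) (β : Bool) (n : ℕ) {α : Type*}
    [MeasurableSpace α] {w : ℕ → α → I → ℝ} (hw : IsParamWeight w) :
    BddMeas (fun q : α × I × I => pathKer U β n (fun i => w i q.1) q.2.1 q.2.2) := by
  induction n generalizing β w with
  | zero => exact (hU.orient β).comp₂ (by fun_prop) (by fun_prop)
  | succ n ih =>
    refine BddMeas.integral (F := fun (q : α × I × I) r => (orient U β q.2.1 r * w 0 q.1 r) *
      pathKer U (!β) n (fun i => w (i + 1) q.1) r q.2.2) (BddMeas.mul (BddMeas.mul ?_ ?_) ?_) volume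
    · exact (hU.orient β).comp₂ (by fun_prop) (by fun_prop)
    · exact (hw.bdd 0).comp₂ (F := fun x s => w 0 x s) (by fun_prop) (by fun_prop)
    · exact (ih (!β) hw.shift).comp
        (by fun_prop : Measurable fun q : (α × I × I) × I => (q.1.1, q.2, q.1.2.2))

theorem bddMeas_pathKer_eval {U : I → I → ℝ} (hU : BddKer U) (β : Bool) (n : ℕ)
    {w : ℕ → (V → I) → I → ℝ} (hw : IsParamWeight w) (a b : V) :
    BddMeas (fun x : V → I => pathKer U β n (fun i => w i x) (x a) (x b)) :=
  (bddMeas_pathKer hU β n hw).comp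
    (by fun_prop : Measurable fun x : V → I => (x, x a, x b))

theorem IsParamWeight.bdd_eval {w : ℕ → (V → I) → I → ℝ} (hw : IsParamWeight w) (i : ℕ) (v : V) :
    BddMeas (fun x : V → I => w i x (x v)) :=
  (hw.bdd i).comp (by fun_prop : Measurable fun x : V → I => (x, x v))

/-- The interior coordinates occur only in the path product. In the induction the first edge and its
weight join `G`, the rest of the path is replaced by its kernel, and `p 1` is integrated out last.
-/
theorem integral_pathProd {U : I → I → ℝ} (hU : BddKer U) (β : Bool) (n : ℕ) {p : ℕ → V}
    (hp : Set.InjOn p (Set.Iic (n + 1))) {w : ℕ → (V → I) → I → ℝ} (hw : IsParamWeight w)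
    (hwp : ∀ i < n, ∀ j < n, Indep (p (j + 1)) (w i)) {G : (V → I) → ℝ} (hG : BddMeas G)
    (hGp : ∀ j < n, Indep (p (j + 1)) G) :
    ∫ x, pathProd U β n p w x * G x =
      ∫ x, pathKer U β n (fun i => w i x) (x (p 0)) (x (p (n + 1))) * G x := by
  induction n generalizing β w p G with
  | zero => rfl
  | succ n ih =>
    have hne : ∀ i j, i ≤ n + 2 → j ≤ n + 2 → i ≠ j → p i ≠ p j :=
      fun i j hi hj hij h => hij (hp hi hj h)
    have hK : BddMeas (fun x : V → I => orient U β (x (p 0)) (x (p 1))) :=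
      (hU.orient β).comp₂ (measurable_pi_apply _) (measurable_pi_apply _)
    have hG' : BddMeas (fun x => (orient U β (x (p 0)) (x (p 1)) * w 0 x (x (p 1))) * G x) :=
      (hK.mul (hw.bdd_eval 0 _)).mul hG
    have h1 := ih (!β) (p := fun i => p (i + 1)) (w := fun i => w (i + 1))
      (fun i hi j hj h => by
        have := hp (Set.mem_Iic.2 (Nat.succ_le_succ hi)) (Set.mem_Iic.2 (Nat.succ_le_succ hj)) h
        omega) hw.shift
      (fun i hi j hj => hwp (i + 1) (by omega) (j + 1) (by omega)) hG'
      (by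
        intro j hj x s
        have n0 := hne 0 (j + 2) (by omega) (by omega) (by omega)
        have n1 := hne 1 (j + 2) (by omega) (by omega) (by omega)
        simp only [update_of_ne n0, update_of_ne n1]
        rw [hwp 0 (by omega) (j + 1) (by omega), hGp (j + 1) (by omega)])
    have h2 : ∫ x, pathProd U β (n + 1) p w x * G x =
        ∫ x, pathProd U (!β) n (fun i => p (i + 1)) (fun i => w (i + 1)) x *
          ((orient U β (x (p 0)) (x (p 1)) * w 0 x (x (p 1))) * G x) := by
      congr 1; ext x; simp only [pathProd]; ring
    have hm : BddMeas (fun x => pathKer U (!β) n (fun i => w (i + 1) x) (x (p 1)) (x (p (n + 2))) *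
        ((orient U β (x (p 0)) (x (p 1)) * w 0 x (x (p 1))) * G x)) :=
      (bddMeas_pathKer_eval hU (!β) n hw.shift _ _).mul hG'
    rw [h2, h1, ← integral_avg hm (p 1)]
    congr 1; ext x
    simp only [avg, pathKer]
    rw [← integral_mul_const]
    congr 1; ext s
    have n0 := hne 0 1 (by omega) (by omega) (by omega)
    have n1 := hne (n + 2) 1 (by omega) (by omega) (by omega)
    rw [update_of_ne n0, update_of_ne n1, update_self, hwp 0 (by omega) 0 (by omega),
      hGp 0 (by omega)]
    rw [pathKer_congr U (!β) n (w := fun i => w (i + 1) (update x (p 1) s))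
      (w' := fun i => w (i + 1) x) fun i hi => hwp (i + 1) (by omega) 0 (by omega) x s]
    ring

end Averages

/-! ### Edge products of bipartite edge sets -/

section EdgeProducts

open Function

set_option linter.unusedSectionVars false

variable {V : Type*} [Fintype V] [DecidableEq V]

/-- The product of `U` over the edges in `S`. -/
def edgeProd (U : I → I → ℝ) (S : Finset (V × V)) (x : V → I) : ℝ := ∏ e ∈ S, U (x e.1) (x e.2)

/-- All pairs in `S` lead from the first to the second colour class. -/
def IsBip (c : V → Bool) (S : Finset (V × V)) : Prop := ∀ e ∈ S, c e.1 = false ∧ c e.2 = true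

/-- Adjacency in the graph with edge set `S`. -/
def SAdj (S : Finset (V × V)) (v w : V) : Prop := (v, w) ∈ S ∨ (w, v) ∈ S

/-- The pair representing the edge between `v` and `w`. -/
def pairOf (c : V → Bool) (v w : V) : V × V := if c v then (w, v) else (v, w)

theorem SAdj.symm {S : Finset (V × V)} {v w : V} (h : SAdj S v w) : SAdj S w v := Or.symm h

theorem SAdj.mono {S T : Finset (V × V)} (hST : S ⊆ T) {v w : V} (h : SAdj S v w) : SAdj T v w :=
  h.imp (@hST _) (@hST _)

theorem IsBip.mono {c : V → Bool} {S T : Finset (V × V)} (hST : S ⊆ T) (h : IsBip c T) :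
    IsBip c S := fun e he => h e (hST he)

theorem IsBip.color {c : V → Bool} {S : Finset (V × V)} (h : IsBip c S) {v w : V}
    (hvw : SAdj S v w) : c w = !c v := by
  rcases hvw with hvw | hvw
  · have := h _ hvw; simp_all
  · have := h _ hvw; simp_all

theorem IsBip.ne {c : V → Bool} {S : Finset (V × V)} (h : IsBip c S) {v w : V}
    (hvw : SAdj S v w) : v ≠ w := by
  rintro rfl
  have := h.color hvw
  simp at this

theorem IsBip.pairOf_mem {c : V → Bool} {S : Finset (V × V)} (h : IsBip c S) {v w : V}
    (hvw : SAdj S v w) : pairOf c v w ∈ S := by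
  unfold pairOf
  rcases hvw with hvw | hvw
  · have := h _ hvw; simp_all
  · have := h _ hvw; simp_all

theorem pairOf_eq_or (c : V → Bool) (v w : V) : pairOf c v w = (v, w) ∨ pairOf c v w = (w, v) := by
  unfold pairOf
  split_ifs <;> simp

theorem IsBip.eq_pairOf {c : V → Bool} {S : Finset (V × V)} (h : IsBip c S) {e : V × V}
    (he : e ∈ S) {v w : V} (hvw : (e.1 = v ∧ e.2 = w) ∨ (e.1 = w ∧ e.2 = v)) :
    e = pairOf c v w := by
  have := h e he
  unfold pairOf
  rcases hvw with ⟨rfl, rfl⟩ | ⟨rfl, rfl⟩ <;> simp_all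

theorem kernel_pairOf (U : I → I → ℝ) (c : V → Bool) (v w : V) (x : V → I) :
    U (x (pairOf c v w).1) (x (pairOf c v w).2) = orient U (c v) (x v) (x w) := by
  unfold pairOf orient
  split_ifs <;> rfl

theorem sAdj_of_mem {S : Finset (V × V)} {e : V × V} (he : e ∈ S) : SAdj S e.1 e.2 := Or.inl he

theorem bddMeas_edgeProd {U : I → I → ℝ} (hU : BddKer U) (S : Finset (V × V)) :
    BddMeas (edgeProd U S) :=
  BddMeas.prod S fun e _ => hU.comp₂ (measurable_pi_apply e.1) (measurable_pi_apply e.2)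

theorem abs_edgeProd_le {U : I → I → ℝ} (hb : ∀ s t, |U s t| ≤ 1) (S : Finset (V × V))
    (x : V → I) : |edgeProd U S x| ≤ 1 := by
  unfold edgeProd
  rw [Finset.abs_prod]
  exact Finset.prod_le_one (fun _ _ => abs_nonneg _) fun _ _ => hb _ _

theorem indep_edgeProd (U : I → I → ℝ) {S : Finset (V × V)} {v : V} (h : ∀ w, ¬ SAdj S v w) :
    Indep v (edgeProd U S) := by
  intro x s
  refine Finset.prod_congr rfl fun e he => ?_
  have h1 : e.1 ≠ v := by rintro rfl; exact h _ (sAdj_of_mem he)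
  have h2 : e.2 ≠ v := by rintro rfl; exact h _ (sAdj_of_mem he).symm
  rw [update_of_ne h1, update_of_ne h2]

theorem edgeProd_filter (U : I → I → ℝ) (S : Finset (V × V)) (P : V × V → Prop) [DecidablePred P]
    (x : V → I) : edgeProd U (S.filter P) x * edgeProd U (S.filter fun e => ¬ P e) x =
      edgeProd U S x := Finset.prod_filter_mul_prod_filter_not S P _

theorem edgeProd_erase (U : I → I → ℝ) {S : Finset (V × V)} {c : V → Bool} (hS : IsBip c S) {v w : V}
    (h : SAdj S v w) (x : V → I) :
    orient U (c v) (x v) (x w) * edgeProd U (S.erase (pairOf c v w)) x = edgeProd U S x := by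
  rw [← kernel_pairOf]
  exact Finset.mul_prod_erase S (fun e => U (x e.1) (x e.2)) (hS.pairOf_mem h)

/-- Bounding the integral over an edge set that contains the edge `vw`. -/
theorem abs_integral_edgeProd_mul_le {U : I → I → ℝ} (hU : BddKer U) (hb : ∀ s t, |U s t| ≤ 1)
    {S : Finset (V × V)} {c : V → Bool} (hS : IsBip c S) {v w : V} (hvw : SAdj S v w)
    {φ ψ : (V → I) → ℝ} (hφ : BddMeas φ) (hψ : BddMeas ψ) (hφw : Indep w φ) (hψv : Indep v ψ) :
    |∫ x, edgeProd U S x * (φ x * ψ x)| ≤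
      fourRoot U * (√(∫ x, φ x ^ 2) * √(∫ x, ψ x ^ 2)) := by
  set S' := S.erase (pairOf c v w) with hS'
  -- The remaining edges at `v` are grouped with `φ`, all others with `ψ`. No edge of `T` meets `w`:
  -- the only edge between `v` and `w` has been erased.
  set T := S'.filter fun e => e.1 = v ∨ e.2 = v with hT
  set R := S'.filter fun e => ¬ (e.1 = v ∨ e.2 = v) with hR
  have hbip : IsBip c S' := hS.mono (Finset.erase_subset _ _)
  have hTφ : BddMeas (fun x => edgeProd U T x * φ x) := (bddMeas_edgeProd hU T).mul hφ
  have hRψ : BddMeas (fun x => edgeProd U R x * ψ x) := (bddMeas_edgeProd hU R).mul hψ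
  have hTw : ∀ u, ¬ SAdj T w u := by
    have key : ∀ e ∈ T, e.1 ≠ w ∧ e.2 ≠ w := by
      intro e he
      obtain ⟨he', hev⟩ := Finset.mem_filter.1 he
      have hne : e ≠ pairOf c v w := Finset.ne_of_mem_erase he'
      have hwv := hS.ne hvw
      constructor
      · rintro rfl
        rcases hev with hev | hev
        · exact hwv hev.symm
        · exact hne (hbip.eq_pairOf he' (Or.inr ⟨rfl, hev⟩))
      · rintro rfl
        rcases hev with hev | hev
        · exact hne (hbip.eq_pairOf he' (Or.inl ⟨hev, rfl⟩))
        · exact hwv hev.symm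
    rintro u (h | h)
    · exact (key _ h).1 rfl
    · exact (key _ h).2 rfl
  have hRv : ∀ u, ¬ SAdj R v u := by
    rintro u (h | h) <;> simp [hR] at h
  have e : ∀ x, edgeProd U S x * (φ x * ψ x) =
      orient U (c v) (x v) (x w) * (edgeProd U T x * φ x) * (edgeProd U R x * ψ x) := by
    intro x
    rw [← edgeProd_erase U hS hvw, ← edgeProd_filter U S' fun e => e.1 = v ∨ e.2 = v]
    ring
  simp only [e]
  refine (abs_integral_edge_le hU (c v) (hS.ne hvw) hTφ hRψ ((indep_edgeProd U hTw).mul hφw)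
    ((indep_edgeProd U hRv).mul hψv)).trans ?_
  refine mul_le_mul_of_nonneg_left ?_ (fourRoot_nonneg U)
  have h1 : ∫ x, (edgeProd U T x * φ x) ^ 2 ≤ ∫ x, φ x ^ 2 := BddMeas.integral_mono hTφ.sq hφ.sq _
    fun x => sq_le_sq.2 (abs_mul_le_right (abs_edgeProd_le hb T x))
  have h2 : ∫ x, (edgeProd U R x * ψ x) ^ 2 ≤ ∫ x, ψ x ^ 2 := BddMeas.integral_mono hRψ.sq hψ.sq _
    fun x => sq_le_sq.2 (abs_mul_le_right (abs_edgeProd_le hb R x))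
  exact mul_le_mul (Real.sqrt_le_sqrt h1) (Real.sqrt_le_sqrt h2) (Real.sqrt_nonneg _)
    (Real.sqrt_nonneg _)

/-! ### Leaves -/

/-- The marginal of `U` in the given orientation. -/
noncomputable def marg (U : I → I → ℝ) (β : Bool) (s : I) : ℝ := ∫ t, orient U β s t

/-- The squared norm of the marginal. -/
noncomputable def margSq (U : I → I → ℝ) (β : Bool) : ℝ := ∫ s, marg U β s ^ 2

theorem margSq_nonneg (U : I → I → ℝ) (β : Bool) : 0 ≤ margSq U β :=
  integral_nonneg fun _ => sq_nonneg _

theorem bddMeas_marg {U : I → I → ℝ} (hU : BddKer U) (β : Bool) : BddMeas (marg U β) :=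
  BddMeas.integral (F := fun s t => orient U β s t) (hU.orient β) volume

/-- `v` is a leaf with neighbour `u`. -/
def IsLeaf (S : Finset (V × V)) (v u : V) : Prop := SAdj S v u ∧ ∀ w, SAdj S v w → w = u

/-- The coordinate of the leaf occurs in one edge only; integrating it out turns that edge into a
marginal at the neighbour. -/
theorem integral_leaf {U : I → I → ℝ} (hU : BddKer U) {S : Finset (V × V)} {c : V → Bool}
    (hS : IsBip c S) {v u : V} (h : IsLeaf S v u) {G : (V → I) → ℝ} (hG : BddMeas G)
    (hGv : Indep v G) :
    ∫ x, edgeProd U S x * G x =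
      ∫ x, edgeProd U (S.erase (pairOf c u v)) x * (marg U (c u) (x u) * G x) := by
  have hm : BddMeas (fun x => edgeProd U S x * G x) := (bddMeas_edgeProd hU S).mul hG
  rw [← integral_avg hm v]
  congr 1; ext x
  have hS'v : ∀ w, ¬ SAdj (S.erase (pairOf c u v)) v w := by
    intro w hw
    have h1 : SAdj S v w := hw.mono (Finset.erase_subset _ _)
    have h2 := h.2 w h1
    subst h2
    have h3 := (hS.mono (Finset.erase_subset _ _)).pairOf_mem hw.symm
    simp at h3
  have hne : u ≠ v := (hS.ne h.1).symm
  simp only [avg, ← edgeProd_erase U hS h.1.symm, hGv x]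
  simp only [indep_edgeProd U hS'v x, update_self, update_of_ne hne, integral_mul_const, marg]
  ring

theorem bddMeas_marg_eval {U : I → I → ℝ} (hU : BddKer U) (β : Bool) (u : V) :
    BddMeas (fun x : V → I => marg U β (x u)) := (bddMeas_marg hU β).comp (measurable_pi_apply u)

theorem integral_marg_eval_sq {U : I → I → ℝ} (hU : BddKer U) (β : Bool) (u : V) :
    ∫ x : V → I, marg U β (x u) ^ 2 = margSq U β := integral_eval (bddMeas_marg hU β).sq u

theorem integral_marg (U : I → I → ℝ) (hU : BddKer U) (h0 : ∫ p : I × I, U p.1 p.2 = 0) (β : Bool) :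
    ∫ s, marg U β s = 0 := by
  have h1 : ∫ s, ∫ t, U s t = 0 := by
    rw [← h0]; exact (BddMeas.integral_prod_eq (F := U) hU volume volume).symm
  cases β
  · exact h1
  · exact (BddMeas.integral_swap (F := fun s t => U t s) hU.swap volume volume).trans h1

/-- An isolated edge kills the integral. -/
theorem integral_edgeProd_of_isolated {U : I → I → ℝ} (hU : BddKer U)
    (h0 : ∫ p : I × I, U p.1 p.2 = 0) {S : Finset (V × V)} {c : V → Bool} (hS : IsBip c S) {v u : V}
    (h : IsLeaf S v u) (h' : IsLeaf S u v) : ∫ x, edgeProd U S x = 0 := by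
  have h1 := integral_leaf hU hS h (BddMeas.const 1) fun _ _ => rfl
  simp only [mul_one] at h1
  have hm : BddMeas fun x => edgeProd U (S.erase (pairOf c u v)) x * marg U (c u) (x u) :=
    (bddMeas_edgeProd hU _).mul (bddMeas_marg_eval hU _ _)
  rw [h1, ← integral_avg hm u]
  have hSu : ∀ w, ¬ SAdj (S.erase (pairOf c u v)) u w := by
    intro w hw
    have h2 := h'.2 w (hw.mono (Finset.erase_subset _ _))
    subst h2
    have h3 := (hS.mono (Finset.erase_subset _ _)).pairOf_mem hw
    simp at h3
  have : ∀ x, avg u (fun x => edgeProd U (S.erase (pairOf c u v)) x * marg U (c u) (x u)) x = 0 := by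
    intro x
    simp only [avg, indep_edgeProd U hSu x, update_self, integral_const_mul,
      integral_marg U hU h0, mul_zero]
  simp [this]

theorem IsLeaf.erase {S : Finset (V × V)} {v u : V} (h : IsLeaf S v u) {e : V × V}
    (he : e ≠ (v, u) ∧ e ≠ (u, v)) : IsLeaf (S.erase e) v u :=
  ⟨h.1.imp (fun h => Finset.mem_erase.2 ⟨he.1.symm, h⟩) fun h => Finset.mem_erase.2 ⟨he.2.symm, h⟩,
    fun w hw => h.2 w (hw.mono (Finset.erase_subset _ _))⟩

/-- Two leaves gain the norms of two marginals; a further edge `ab` gains a factor `fourRoot U`. -/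
theorem abs_integral_two_leaves_le {U : I → I → ℝ} (hU : BddKer U) (hb : ∀ s t, |U s t| ≤ 1)
    {S : Finset (V × V)} {c : V → Bool} (hS : IsBip c S) {v₁ u₁ v₂ u₂ a b : V}
    (h₁ : IsLeaf S v₁ u₁) (h₂ : IsLeaf S v₂ u₂) (hv : v₁ ≠ v₂) (hu : u₁ ≠ v₂) (hab : SAdj S a b)
    (ha₁ : a ≠ v₁) (ha₂ : a ≠ v₂) (hb₁ : b ≠ v₁) (hb₂ : b ≠ v₂) (hbu : b ≠ u₁) (hau : a ≠ u₂) :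
    |∫ x, edgeProd U S x| ≤ fourRoot U * (√(margSq U (c u₁)) * √(margSq U (c u₂))) := by
  set S₁ := S.erase (pairOf c u₁ v₁)
  have hS₁ : IsBip c S₁ := hS.mono (Finset.erase_subset _ _)
  have h₂' : IsLeaf S₁ v₂ u₂ := by
    refine h₂.erase ⟨fun h => ?_, fun h => ?_⟩ <;>
    · rcases pairOf_eq_or c u₁ v₁ with h' | h' <;> rw [h'] at h <;> simp_all [Prod.ext_iff]
  have e1 := integral_leaf hU hS h₁ (BddMeas.const 1) fun _ _ => rfl
  have e2 := integral_leaf hU hS₁ h₂' (bddMeas_marg_eval hU (c u₁) u₁)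
    (Indep.eval hu (marg U (c u₁)))
  simp only [mul_one] at e1
  rw [e1, e2, ← integral_marg_eval_sq hU (c u₁) u₁, ← integral_marg_eval_sq hU (c u₂) u₂]
  have hab' : SAdj (S₁.erase (pairOf c u₂ v₂)) a b := by
    refine hab.imp (fun h => ?_) fun h => ?_ <;>
    · refine Finset.mem_erase.2 ⟨?_, Finset.mem_erase.2 ⟨?_, h⟩⟩
      · rcases pairOf_eq_or c u₂ v₂ with h' | h' <;> rw [h'] <;> simp_all [Prod.ext_iff]
      · rcases pairOf_eq_or c u₁ v₁ with h' | h' <;> rw [h'] <;> simp_all [Prod.ext_iff]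
  -- The conditions `b ≠ u₁` and `a ≠ u₂` make each marginal independent of one end of the edge. The
  -- case `u₁ = u₂` is allowed.
  have := abs_integral_edgeProd_mul_le hU hb (hS₁.mono (Finset.erase_subset _ _)) hab'
    (bddMeas_marg_eval hU (c u₁) u₁) (bddMeas_marg_eval hU (c u₂) u₂)
    (Indep.eval hbu.symm _) (Indep.eval hau.symm _)
  simpa only [mul_comm] using this

end EdgeProducts

/-! ### Induced paths -/

section InducedPaths

open Function

set_option linter.unusedSectionVars false

variable {V : Type*} [Fintype V] [DecidableEq V]

/-- `p 0, …, p (n + 1)` is a path in `S` with no further edge between an interior node and a node of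
the path. -/
structure InducedPath (S : Finset (V × V)) (n : ℕ) (p : ℕ → V) : Prop where
  inj : Set.InjOn p (Set.Iic (n + 1))
  adj : ∀ i ≤ n, SAdj S (p i) (p (i + 1))
  chordless : ∀ i < n, ∀ j ≤ n + 1, SAdj S (p (i + 1)) (p j) → j = i + 2 ∨ j = i

/-- The nodes of a path. -/
def pathNodes (n : ℕ) (p : ℕ → V) : Finset V := (Finset.range (n + 2)).image p

/-- The edges in `S` leaving the node set `Z` from `v`. -/
def extEdges (S : Finset (V × V)) (Z : Finset V) (v : V) : Finset (V × V) :=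
  S.filter fun e => (e.1 = v ∧ e.2 ∉ Z) ∨ (e.2 = v ∧ e.1 ∉ Z)

/-- The weights of the interior nodes of a path, given by the edges leaving the path. -/
noncomputable def pathWeight (U : I → I → ℝ) (S : Finset (V × V)) (n : ℕ) (p : ℕ → V) (i : ℕ)
    (x : V → I) (t : I) : ℝ :=
  edgeProd U (extEdges S (pathNodes n p) (p (i + 1))) (update x (p (i + 1)) t)

/-- The edges in `S` that touch an interior node of the path. -/
def touching (S : Finset (V × V)) (n : ℕ) (p : ℕ → V) : Finset (V × V) :=
  S.filter fun e => ∃ i < n, e.1 = p (i + 1) ∨ e.2 = p (i + 1)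

/-- The result of integrating out the interior of a path. -/
noncomputable def pathAvg (U : I → I → ℝ) (c : V → Bool) (S : Finset (V × V)) (n : ℕ) (p : ℕ → V)
    (x : V → I) : ℝ :=
  pathKer U (c (p 0)) n (fun i => pathWeight U S n p i x) (x (p 0)) (x (p (n + 1)))

theorem mem_pathNodes {n : ℕ} {p : ℕ → V} {v : V} :
    v ∈ pathNodes n p ↔ ∃ i ≤ n + 1, p i = v := by
  simp [pathNodes, Nat.lt_succ_iff]

theorem isParamWeight_pathWeight {U : I → I → ℝ} (hU : BddKer U) (hb : ∀ s t, |U s t| ≤ 1)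
    (S : Finset (V × V)) (n : ℕ) (p : ℕ → V) : IsParamWeight (pathWeight U S n p) :=
  fun i => ⟨((bddMeas_edgeProd hU _).update (p (i + 1))).1, fun _ _ => abs_edgeProd_le hb _ _⟩

/-- The coordinate of `p (i + 1)` is overwritten inside the weight, and the other coordinates that
enter belong to its neighbours off the path. So no node of the path influences the weight. -/
theorem indep_pathWeight (U : I → I → ℝ) {S : Finset (V × V)} {n : ℕ} {p : ℕ → V} {i : ℕ} {u : V}
    (h : u ∉ pathNodes n p → ¬ SAdj S (p (i + 1)) u) : Indep u (pathWeight U S n p i) := by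
  intro x s
  ext t
  refine Finset.prod_congr rfl fun e he => ?_
  obtain ⟨heS, he⟩ := Finset.mem_filter.1 he
  have key : ∀ v, v = p (i + 1) ∨ v ≠ u →
      update (update x u s) (p (i + 1)) t v = update x (p (i + 1)) t v := by
    intro v hv
    by_cases hvp : v = p (i + 1)
    · subst hvp; simp
    · simp [update_of_ne hvp, update_of_ne (hv.resolve_left hvp)]
  rcases he with ⟨h1, h2⟩ | ⟨h1, h2⟩
  · rw [key _ (Or.inl h1), key e.2 (Or.inr ?_)]
    rintro rfl
    exact h h2 (h1 ▸ sAdj_of_mem heS)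
  · rw [key _ (Or.inl h1), key e.1 (Or.inr ?_)]
    rintro rfl
    exact h h2 (h1 ▸ (sAdj_of_mem heS).symm)

theorem bddMeas_pathAvg {U : I → I → ℝ} (hU : BddKer U) (hb : ∀ s t, |U s t| ≤ 1) (c : V → Bool)
    (S : Finset (V × V)) (n : ℕ) (p : ℕ → V) : BddMeas (pathAvg U c S n p) :=
  bddMeas_pathKer_eval hU _ _ (isParamWeight_pathWeight hU hb S n p) _ _

theorem indep_pathAvg (U : I → I → ℝ) (c : V → Bool) {S : Finset (V × V)} {n : ℕ} {p : ℕ → V} {u : V}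
    (h0 : u ≠ p 0) (h1 : u ≠ p (n + 1)) (h : ∀ i < n, ¬ SAdj S (p (i + 1)) u) :
    Indep u (pathAvg U c S n p) := by
  intro x s
  unfold pathAvg
  rw [update_of_ne h0.symm, update_of_ne h1.symm,
    pathKer_congr U _ n (w' := fun i => pathWeight U S n p i x)]
  exact fun i hi => indep_pathWeight U (fun _ => h i hi) x s

theorem pathProd_eq (U : I → I → ℝ) (c : V → Bool) (n : ℕ) {p : ℕ → V}
    (hc : ∀ i ≤ n, c (p (i + 1)) = !c (p i)) (w : ℕ → (V → I) → I → ℝ) (x : V → I) :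
    pathProd U (c (p 0)) n p w x =
      (∏ i ∈ Finset.range (n + 1), orient U (c (p i)) (x (p i)) (x (p (i + 1)))) *
        ∏ i ∈ Finset.range n, w i x (x (p (i + 1))) := by
  induction n generalizing p w with
  | zero => simp [pathProd]
  | succ n ih =>
    have := ih (p := fun i => p (i + 1)) (fun i hi => hc (i + 1) (by omega)) (fun i => w (i + 1))
    rw [pathProd, ← hc 0 (by omega)]
    beta_reduce
    rw [this, Finset.prod_range_succ' _ (n + 1),
      Finset.prod_range_succ' (fun i => w i x (x (p (i + 1))))]
    ring

variable {S : Finset (V × V)} {c : V → Bool} {n : ℕ} {p : ℕ → V}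

theorem InducedPath.ne (h : InducedPath S n p) {i j : ℕ} (hi : i ≤ n + 1) (hj : j ≤ n + 1)
    (hij : i ≠ j) : p i ≠ p j := fun h' => hij (h.inj hi hj h')

theorem InducedPath.edgeProd_touching (h : InducedPath S n p) (hS : IsBip c S) (hn : n ≠ 0)
    (U : I → I → ℝ) (x : V → I) :
    edgeProd U (touching S n p) x = pathProd U (c (p 0)) n p (pathWeight U S n p) x := by
  rw [pathProd_eq U c n fun i hi => hS.color (h.adj i hi)]
  set Z := pathNodes n p with hZ
  have hpZ : ∀ i ≤ n + 1, p i ∈ Z := fun i hi => mem_pathNodes.2 ⟨i, hi, rfl⟩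
  -- By chordlessness an edge at an interior node belongs to the path or leaves it. Conversely every
  -- edge of the path meets an interior node because `n ≠ 0`.
  have e : touching S n p =
      (Finset.range (n + 1)).image (fun i => pairOf c (p i) (p (i + 1))) ∪
        (Finset.range n).biUnion fun i => extEdges S Z (p (i + 1)) := by
    ext e
    simp only [touching, Finset.mem_filter, Finset.mem_union, Finset.mem_image, Finset.mem_range,
      Finset.mem_biUnion, extEdges]
    constructor
    · rintro ⟨he, i, hi, hei⟩
      have key : ∀ v, SAdj S (p (i + 1)) v → (e.1 = p (i + 1) ∧ e.2 = v) ∨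
          (e.1 = v ∧ e.2 = p (i + 1)) → v ∈ Z → ∃ a < n + 1, pairOf c (p a) (p (a + 1)) = e := by
        intro v hv hev hvZ
        obtain ⟨j, hj, rfl⟩ := mem_pathNodes.1 hvZ
        rcases h.chordless i hi j hj hv with rfl | rfl
        · exact ⟨i + 1, by omega, (hS.eq_pairOf he hev).symm⟩
        · exact ⟨j, by omega, (hS.eq_pairOf he hev.symm).symm⟩
      rcases hei with hei | hei
      · by_cases hv : e.2 ∈ Z
        · exact Or.inl (key e.2 (hei ▸ sAdj_of_mem he) (Or.inl ⟨hei, rfl⟩) hv)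
        · exact Or.inr ⟨i, hi, he, Or.inl ⟨hei, hv⟩⟩
      · by_cases hv : e.1 ∈ Z
        · exact Or.inl (key e.1 (hei ▸ (sAdj_of_mem he).symm) (Or.inr ⟨rfl, hei⟩) hv)
        · exact Or.inr ⟨i, hi, he, Or.inr ⟨hei, hv⟩⟩
    · rintro (⟨i, hi, rfl⟩ | ⟨i, hi, he, hei⟩)
      · refine ⟨hS.pairOf_mem (h.adj i (by omega)), ?_⟩
        by_cases hi0 : i = 0
        · subst hi0
          refine ⟨0, by omega, ?_⟩
          rcases pairOf_eq_or c (p 0) (p (0 + 1)) with h' | h' <;> rw [h'] <;> simp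
        · refine ⟨i - 1, by omega, ?_⟩
          rw [Nat.sub_add_cancel (by omega : 1 ≤ i)]
          rcases pairOf_eq_or c (p i) (p (i + 1)) with h' | h' <;> rw [h'] <;> simp
      · exact ⟨he, i, hi, hei.imp And.left And.left⟩
  unfold edgeProd
  rw [e, Finset.prod_union, Finset.prod_image, Finset.prod_biUnion]
  · simp only [kernel_pairOf]
    congr 1
    refine Finset.prod_congr rfl fun i _ => ?_
    simp only [pathWeight, update_eq_self]
    rfl
  · intro i hi j hj hij
    have hi := Finset.mem_range.1 hi
    have hj := Finset.mem_range.1 hj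
    refine Finset.disjoint_left.2 fun e hei hej => ?_
    obtain ⟨_, hei⟩ := Finset.mem_filter.1 hei
    obtain ⟨_, hej⟩ := Finset.mem_filter.1 hej
    have hne := h.ne (i := i + 1) (j := j + 1) (by omega) (by omega) (by omega)
    have hi' := hpZ (i + 1) (by omega)
    have hj' := hpZ (j + 1) (by omega)
    rcases hei with ⟨h1, h2⟩ | ⟨h1, h2⟩ <;> rcases hej with ⟨h3, h4⟩ | ⟨h3, h4⟩
    · exact hne (h1.symm.trans h3)
    · exact h2 (h3 ▸ hj')
    · exact h2 (h3 ▸ hj')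
    · exact hne (h1.symm.trans h3)
  · intro i hi j hj hij
    have hi := Finset.mem_range.1 hi
    have hj := Finset.mem_range.1 hj
    have : (p i = p j ∧ p (i + 1) = p (j + 1)) ∨ (p i = p (j + 1) ∧ p (i + 1) = p j) := by
      simp only at hij
      rcases pairOf_eq_or c (p i) (p (i + 1)) with h1 | h1 <;>
        rcases pairOf_eq_or c (p j) (p (j + 1)) with h2 | h2 <;> rw [h1, h2] at hij <;>
        simp only [Prod.mk.injEq] at hij <;> tauto
    rcases this with ⟨h1, _⟩ | ⟨h1, h2⟩
    · exact h.inj (Set.mem_Iic.2 (by omega)) (Set.mem_Iic.2 (by omega)) h1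
    · have e1 := h.inj (Set.mem_Iic.2 (by omega)) (Set.mem_Iic.2 (by omega)) h1
      have e2 := h.inj (Set.mem_Iic.2 (by omega)) (Set.mem_Iic.2 (by omega)) h2
      omega
  · refine Finset.disjoint_left.2 fun e he1 he2 => ?_
    simp only [Finset.mem_image, Finset.mem_range, Finset.mem_biUnion] at he1 he2
    obtain ⟨i, hi, rfl⟩ := he1
    obtain ⟨j, hj, he⟩ := he2
    obtain ⟨_, he⟩ := Finset.mem_filter.1 he
    have h1 := hpZ i (by omega)
    have h2 := hpZ (i + 1) (by omega)
    rcases pairOf_eq_or c (p i) (p (i + 1)) with h' | h' <;> rw [h'] at he <;> simp_all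

theorem InducedPath.integral_touching (h : InducedPath S n p) (hS : IsBip c S) (hn : n ≠ 0)
    {U : I → I → ℝ} (hU : BddKer U) (hb : ∀ s t, |U s t| ≤ 1) {G : (V → I) → ℝ} (hG : BddMeas G)
    (hGp : ∀ i < n, Indep (p (i + 1)) G) :
    ∫ x, edgeProd U (touching S n p) x * G x = ∫ x, pathAvg U c S n p x * G x := by
  simp only [h.edgeProd_touching hS hn U]
  refine integral_pathProd hU _ n h.inj (isParamWeight_pathWeight hU hb S n p) ?_ hG hGp
  intro i _ j hj
  exact indep_pathWeight U fun h => absurd (mem_pathNodes.2 ⟨j + 1, by omega, rfl⟩) h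

/-- The weights depend on neither end of the path, so the two end coordinates can be integrated
against an ordinary weighted path kernel with all other coordinates frozen. -/
theorem InducedPath.integral_mul_pathAvg_sq (h : InducedPath S n p) {U : I → I → ℝ} (hU : BddKer U)
    (hb : ∀ s t, |U s t| ≤ 1) {f : I → ℝ} (hf : BddMeas f) (c : V → Bool) :
    ∫ x, (f (x (p 0)) * pathAvg U c S n p x) ^ 2 =
      ∫ x : V → I, ∫ s, f s ^ 2 *
        ∫ t, pathKer U (c (p 0)) n (fun i => pathWeight U S n p i x) s t ^ 2 := by
  have hne := h.ne (i := 0) (j := n + 1) (by omega) (by omega) (by omega)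
  have hm : BddMeas fun x => (f (x (p 0)) * pathAvg U c S n p x) ^ 2 :=
    ((hf.comp (measurable_pi_apply (p 0))).mul (bddMeas_pathAvg hU hb c S n p)).sq
  rw [← integral_avg hm (p (n + 1)), ← integral_avg (hm.avg _) (p 0)]
  congr 1; ext x
  simp only [avg, ← integral_const_mul]
  congr 1; ext s; congr 1; ext t
  have hw : ∀ i < n, pathWeight U S n p i (update (update x (p 0) s) (p (n + 1)) t) =
      pathWeight U S n p i x := by
    intro i _
    rw [indep_pathWeight U (fun h => absurd (mem_pathNodes.2 ⟨n + 1, by omega, rfl⟩) h),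
      indep_pathWeight U (fun h => absurd (mem_pathNodes.2 ⟨0, by omega, rfl⟩) h)]
  simp only [pathAvg, pathKer_congr U (c (p 0)) n hw, update_self, update_of_ne hne, mul_pow]

theorem InducedPath.integral_mul_pathAvg_sq_le (h : InducedPath S n p) (hn : n ≠ 0)
    {U : I → I → ℝ} (hU : BddKer U) (hb : ∀ s t, |U s t| ≤ 1) {f : I → ℝ} (hf : BddMeas f)
    (c : V → Bool) :
    ∫ x, (f (x (p 0)) * pathAvg U c S n p x) ^ 2 ≤ √(cycleDens U 1) * ∫ s, f s ^ 2 := by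
  rw [h.integral_mul_pathAvg_sq hU hb hf c]
  have hw := isParamWeight_pathWeight hU hb S n p
  have hk : ∀ x : V → I, BddKer (pathKer U (c (p 0)) n fun i => pathWeight U S n p i x) :=
    fun x => hU.pathKer _ n (hw.isWeight x)
  have h1 : ∀ x : V → I, ∫ s, f s ^ 2 *
        ∫ t, pathKer U (c (p 0)) n (fun i => pathWeight U S n p i x) s t ^ 2 ≤
      √(cycleDens U 1) * ∫ s, f s ^ 2 := by
    intro x
    rw [← integral_const_mul]
    refine BddMeas.integral_mono (hf.sq.mul (BddMeas.integral (F := fun s t =>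
      pathKer U (c (p 0)) n (fun i => pathWeight U S n p i x) s t ^ 2) (hk x).sq volume))
      ((BddMeas.const _).mul hf.sq) _ fun s => ?_
    rw [mul_comm]
    exact mul_le_mul_of_nonneg_right (integral_sq_pathKer_le hU hb _ hn (hw.isWeight x) s)
      (sq_nonneg _)
  refine (integral_mono_of_nonneg (Filter.Eventually.of_forall fun x => ?_)
    (integrable_const (√(cycleDens U 1) * ∫ s, f s ^ 2))
    (Filter.Eventually.of_forall h1)).trans (by simp)
  exact integral_nonneg fun s => mul_nonneg (sq_nonneg _) (integral_nonneg fun t => sq_nonneg _)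

theorem InducedPath.integral_pathAvg_sq_le (h : InducedPath S n p) (hn : n ≠ 0)
    {U : I → I → ℝ} (hU : BddKer U) (hb : ∀ s t, |U s t| ≤ 1) (c : V → Bool) :
    ∫ x, pathAvg U c S n p x ^ 2 ≤ cycleDens U n := by
  have h0 := h.integral_mul_pathAvg_sq hU hb (BddMeas.const 1) c
  simp only [one_mul, one_pow] at h0
  rw [h0]
  have hw := isParamWeight_pathWeight hU hb S n p
  have h1 : ∀ x : V → I, ∫ s, ∫ t,
      pathKer U (c (p 0)) n (fun i => pathWeight U S n p i x) s t ^ 2 ≤ cycleDens U n := by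
    intro x
    rw [← hsSq_eq (hU.pathKer _ n (hw.isWeight x))]
    exact hsSq_pathKer_le hU hb _ hn (hw.isWeight x)
  refine (integral_mono_of_nonneg (Filter.Eventually.of_forall fun x => ?_)
    (integrable_const (cycleDens U n)) (Filter.Eventually.of_forall h1)).trans (by simp)
  exact integral_nonneg fun s => integral_nonneg fun t => sq_nonneg _

/-! ### Pairs of induced paths -/

/-- Two induced paths whose interiors are disjoint from each other and not joined by edges, where
the interior of each one avoids the ends of the other one. -/
structure PathPair (S : Finset (V × V)) (n : ℕ) (p q : ℕ → V) : Prop where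
  left : InducedPath S n p
  right : InducedPath S n q
  ne : ∀ i < n, ∀ j < n, p (i + 1) ≠ q (j + 1)
  not_adj : ∀ i < n, ∀ j < n, ¬ SAdj S (p (i + 1)) (q (j + 1))
  left_end : ∀ j < n, q (j + 1) ≠ p 0 ∧ q (j + 1) ≠ p (n + 1)

/-- The edges touching neither of the interiors of two paths. -/
def remaining (S : Finset (V × V)) (n : ℕ) (p q : ℕ → V) : Finset (V × V) :=
  S.filter fun e => (¬ ∃ i < n, e.1 = p (i + 1) ∨ e.2 = p (i + 1)) ∧
    ¬ ∃ i < n, e.1 = q (i + 1) ∨ e.2 = q (i + 1)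

variable {q : ℕ → V}

theorem mem_remaining_of_ne {e : V × V} (he : e ∈ S)
    (h : ∀ i < n, e.1 ≠ p (i + 1) ∧ e.2 ≠ p (i + 1) ∧ e.1 ≠ q (i + 1) ∧ e.2 ≠ q (i + 1)) :
    e ∈ remaining S n p q := by
  refine Finset.mem_filter.2 ⟨he, ?_, ?_⟩
  · rintro ⟨i, hi, h' | h'⟩
    · exact (h i hi).1 h'
    · exact (h i hi).2.1 h'
  · rintro ⟨i, hi, h' | h'⟩
    · exact (h i hi).2.2.1 h'
    · exact (h i hi).2.2.2 h'

/-- No edge touches both interiors, since these are disjoint and not adjacent. The edges therefore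
split into three groups, and the interiors can be integrated out one after the other. -/
theorem PathPair.integral_edgeProd (h : PathPair S n p q) (hS : IsBip c S) (hn : n ≠ 0)
    {U : I → I → ℝ} (hU : BddKer U) (hb : ∀ s t, |U s t| ≤ 1) :
    ∫ x, edgeProd U S x = ∫ x, edgeProd U (remaining S n p q) x *
      (pathAvg U c S n p x * pathAvg U c S n q x) := by
  set R := remaining S n p q with hR
  have hRS : R ⊆ S := Finset.filter_subset _ _
  have e1 : ∀ x, edgeProd U S x = edgeProd U (touching S n p) x *
      (edgeProd U (touching S n q) x * edgeProd U R x) := by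
    intro x
    rw [← edgeProd_filter U S fun e => ∃ i < n, e.1 = p (i + 1) ∨ e.2 = p (i + 1)]
    congr 1
    rw [← edgeProd_filter U (S.filter _) fun e => ∃ i < n, e.1 = q (i + 1) ∨ e.2 = q (i + 1)]
    congr 2
    · ext e
      simp only [touching, Finset.mem_filter]
      constructor
      · exact fun h => ⟨h.1.1, h.2⟩
      · rintro ⟨he, j, hj, hej⟩
        refine ⟨⟨he, ?_⟩, j, hj, hej⟩
        rintro ⟨i, hi, hei⟩
        have h1 := h.ne i hi j hj
        have h2 := h.not_adj i hi j hj
        have h3 := sAdj_of_mem he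
        rcases hei with hei | hei <;> rcases hej with hej | hej
        · exact h1 (hei.symm.trans hej)
        · rw [hei, hej] at h3; exact h2 h3
        · rw [hei, hej] at h3; exact h2 h3.symm
        · exact h1 (hei.symm.trans hej)
    · ext e
      simp only [hR, remaining, Finset.mem_filter, and_assoc]
  have hRadj : ∀ i < n, (∀ w, ¬ SAdj R (p (i + 1)) w) ∧ ∀ w, ¬ SAdj R (q (i + 1)) w := by
    intro i hi
    constructor
    · rintro w (hw | hw)
      · exact (Finset.mem_filter.1 hw).2.1 ⟨i, hi, Or.inl rfl⟩
      · exact (Finset.mem_filter.1 hw).2.1 ⟨i, hi, Or.inr rfl⟩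
    · rintro w (hw | hw)
      · exact (Finset.mem_filter.1 hw).2.2 ⟨i, hi, Or.inl rfl⟩
      · exact (Finset.mem_filter.1 hw).2.2 ⟨i, hi, Or.inr rfl⟩
  have hqp : ∀ i < n, ∀ w, ¬ SAdj (touching S n q) (p (i + 1)) w := by
    intro i hi w hw
    have hadj : SAdj S (p (i + 1)) w := hw.mono (Finset.filter_subset _ _)
    have : ∃ j < n, p (i + 1) = q (j + 1) ∨ w = q (j + 1) := by
      rcases hw with hw | hw
      · exact (Finset.mem_filter.1 hw).2
      · obtain ⟨j, hj, h'⟩ := (Finset.mem_filter.1 hw).2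
        exact ⟨j, hj, h'.symm⟩
    obtain ⟨j, hj, h' | h'⟩ := this
    · exact h.ne i hi j hj h'
    · exact h.not_adj i hi j hj (h' ▸ hadj)
  have hmR := bddMeas_edgeProd hU R
  simp only [e1]
  rw [h.left.integral_touching hS hn hU hb ((bddMeas_edgeProd hU _).mul hmR)
    fun i hi => (indep_edgeProd U (hqp i hi)).mul (indep_edgeProd U (hRadj i hi).1)]
  have e2 : ∀ x, pathAvg U c S n p x * (edgeProd U (touching S n q) x * edgeProd U R x) =
      edgeProd U (touching S n q) x * (pathAvg U c S n p x * edgeProd U R x) := fun x => by ring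
  simp only [e2]
  rw [h.right.integral_touching hS hn hU hb ((bddMeas_pathAvg hU hb c S n p).mul hmR)
    fun j hj => (indep_pathAvg U c (h.left_end j hj).1 (h.left_end j hj).2
      fun i hi => h.not_adj i hi j hj).mul (indep_edgeProd U (hRadj j hj).2)]
  congr 1; ext x; ring

/-- Both path averages have squared norm at most `cycleDens U n`. The first does not see `w` and the
second does not see `v`, so the edge `vw` acts as an operator between them. -/
theorem PathPair.abs_integral_le (h : PathPair S n p q) (hS : IsBip c S) (hn : n ≠ 0)
    {U : I → I → ℝ} (hU : BddKer U) (hb : ∀ s t, |U s t| ≤ 1) {v w : V} (hvw : SAdj S v w)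
    (hv : ∀ i < n, v ≠ p (i + 1) ∧ v ≠ q (i + 1)) (hw : ∀ i < n, w ≠ p (i + 1) ∧ w ≠ q (i + 1))
    (hwp : w ≠ p 0 ∧ w ≠ p (n + 1) ∧ ∀ i < n, ¬ SAdj S (p (i + 1)) w)
    (hvq : v ≠ q 0 ∧ v ≠ q (n + 1) ∧ ∀ i < n, ¬ SAdj S (q (i + 1)) v) :
    |∫ x, edgeProd U S x| ≤ fourRoot U * cycleDens U n := by
  rw [h.integral_edgeProd hS hn hU hb]
  have hvw' : SAdj (remaining S n p q) v w := by
    refine hvw.imp (fun he => ?_) fun he => ?_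
    · exact mem_remaining_of_ne he fun i hi =>
        ⟨(hv i hi).1, (hw i hi).1, (hv i hi).2, (hw i hi).2⟩
    · exact mem_remaining_of_ne he fun i hi =>
        ⟨(hw i hi).1, (hv i hi).1, (hw i hi).2, (hv i hi).2⟩
  refine (abs_integral_edgeProd_mul_le hU hb (hS.mono (Finset.filter_subset _ _)) hvw'
    (bddMeas_pathAvg hU hb c S n p) (bddMeas_pathAvg hU hb c S n q)
    (indep_pathAvg U c hwp.1 hwp.2.1 hwp.2.2) (indep_pathAvg U c hvq.1 hvq.2.1 hvq.2.2)).trans ?_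
  refine mul_le_mul_of_nonneg_left ?_ (fourRoot_nonneg U)
  rw [← Real.mul_self_sqrt (cycleDens_nonneg U n)]
  exact mul_le_mul (Real.sqrt_le_sqrt (h.left.integral_pathAvg_sq_le hn hU hb c))
    (Real.sqrt_le_sqrt (h.right.integral_pathAvg_sq_le hn hU hb c)) (Real.sqrt_nonneg _)
    (Real.sqrt_nonneg _)

/-- The factor `fourRoot U` comes from the row bound for the first path: it holds for every value of
the starting coordinate, so it survives multiplication by the marginal there. -/
theorem PathPair.abs_integral_leaf_le (h : PathPair S n p q) (hS : IsBip c S) (hn : n ≠ 0)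
    {U : I → I → ℝ} (hU : BddKer U) (hb : ∀ s t, |U s t| ≤ 1) {v : V} (hv : IsLeaf S v (p 0))
    (hvp : ∀ i ≤ n + 1, v ≠ p i) (hvq : ∀ i ≤ n + 1, v ≠ q i) (h0 : ∀ i < n, q (i + 1) ≠ p 0) :
    |∫ x, edgeProd U S x| ≤ fourRoot U * (√(margSq U (c (p 0))) * √(cycleDens U n)) := by
  rw [h.integral_edgeProd hS hn hU hb]
  set R := remaining S n p q
  have hRS : R ⊆ S := Finset.filter_subset _ _
  have h0p : ∀ i < n, p 0 ≠ p (i + 1) := fun i hi => h.left.ne (by omega) (by omega) (by omega)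
  have hleaf : IsLeaf R v (p 0) := by
    refine ⟨hv.1.imp (fun he => ?_) fun he => ?_, fun w hw => hv.2 w (hw.mono hRS)⟩
    · exact mem_remaining_of_ne he fun i hi =>
        ⟨hvp _ (by omega), h0p i hi, hvq _ (by omega), (h0 i hi).symm⟩
    · exact mem_remaining_of_ne he fun i hi =>
        ⟨h0p i hi, hvp _ (by omega), (h0 i hi).symm, hvq _ (by omega)⟩
  have hmp := bddMeas_pathAvg hU hb c S n p
  have hmq := bddMeas_pathAvg hU hb c S n q
  have hmf := bddMeas_marg_eval hU (c (p 0)) (p 0)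
  rw [integral_leaf hU (hS.mono hRS) hleaf (hmp.mul hmq)]
  · set R' := R.erase (pairOf c (p 0) v)
    have e : ∀ x, edgeProd U R' x * (marg U (c (p 0)) (x (p 0)) *
        (pathAvg U c S n p x * pathAvg U c S n q x)) =
        (edgeProd U R' x * (marg U (c (p 0)) (x (p 0)) * pathAvg U c S n p x)) *
          pathAvg U c S n q x := fun x => by ring
    simp only [e]
    have hm1 : BddMeas fun x => marg U (c (p 0)) (x (p 0)) * pathAvg U c S n p x := hmf.mul hmp
    have hm2 : BddMeas fun x => edgeProd U R' x *
        (marg U (c (p 0)) (x (p 0)) * pathAvg U c S n p x) := (bddMeas_edgeProd hU R').mul hm1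
    refine (BddMeas.abs_integral_mul_le hm2 hmq _).trans ?_
    rw [← mul_assoc]
    have h1 := BddMeas.integral_mono hm2.sq hm1.sq volume
      fun x => sq_le_sq.2 (abs_mul_le_right (abs_edgeProd_le hb R' x))
    have h2 := Real.sqrt_le_sqrt (h1.trans
      (h.left.integral_mul_pathAvg_sq_le hn hU hb (bddMeas_marg hU (c (p 0))) c))
    rw [Real.sqrt_mul (Real.sqrt_nonneg _)] at h2
    exact mul_le_mul h2 (Real.sqrt_le_sqrt (h.right.integral_pathAvg_sq_le hn hU hb c))
      (Real.sqrt_nonneg _) (mul_nonneg (Real.sqrt_nonneg _) (Real.sqrt_nonneg _))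
  · refine Indep.mul (indep_pathAvg U c (hvp 0 (by omega)) (hvp _ le_rfl) fun i hi hadj => ?_)
      (indep_pathAvg U c (hvq 0 (by omega)) (hvq _ le_rfl) fun i hi hadj => ?_)
    · exact h0p i hi (hv.2 _ hadj.symm).symm
    · exact h0 i hi (hv.2 _ hadj.symm)

/-- The integral over a cycle composed of two paths with common ends. -/
theorem PathPair.integral_eq (h : PathPair S n p q) (hS : IsBip c S) (hn : n ≠ 0)
    {U : I → I → ℝ} (hU : BddKer U) (hb : ∀ s t, |U s t| ≤ 1) (h0 : p 0 = q 0)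
    (h1 : p (n + 1) = q (n + 1)) (hR : remaining S n p q = ∅)
    (hp : ∀ i < n, ∀ v, SAdj S (p (i + 1)) v → v ∈ pathNodes n p)
    (hq : ∀ i < n, ∀ v, SAdj S (q (i + 1)) v → v ∈ pathNodes n q) :
    ∫ x, edgeProd U S x = cycleDens U n := by
  have key : ∀ p : ℕ → V, (∀ i < n, ∀ v, SAdj S (p (i + 1)) v → v ∈ pathNodes n p) →
      ∀ x, pathAvg U c S n p x = pathKer U (c (p 0)) n (fun _ _ => 1) (x (p 0)) (x (p (n + 1))) := by
    intro p hp x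
    unfold pathAvg
    rw [pathKer_congr U _ n (w' := fun _ _ => 1)]
    intro i hi
    ext t
    have : extEdges S (pathNodes n p) (p (i + 1)) = ∅ := by
      refine Finset.filter_eq_empty_iff.2 fun e he => ?_
      rintro (⟨h1, h2⟩ | ⟨h1, h2⟩)
      · exact h2 (hp i hi _ (h1 ▸ sAdj_of_mem he))
      · exact h2 (hp i hi _ (h1 ▸ (sAdj_of_mem he).symm))
    simp [pathWeight, this, edgeProd]
  have hk := hU.pathKer (c (q 0)) n isWeight_one
  rw [h.integral_edgeProd hS hn hU hb, hR]
  simp only [key p hp, key q hq, h0, h1, edgeProd, Finset.prod_empty, one_mul, ← pow_two]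
  rw [integral_eval₂ (F := fun s t => pathKer U (c (q 0)) n (fun _ _ => 1) s t ^ 2) hk.sq
    (h.right.ne (by omega) le_rfl (by omega)), ← hsSq_eq hk, hsSq_pathKer_one hU _ hn]

end InducedPaths

/-! ### Cycles -/

section Cycles

set_option linter.unusedSectionVars false

variable {V : Type*} [Fintype V] [DecidableEq V]

/-- `d` runs periodically around a cycle of length `n` in `S`. -/
structure IsCyc (S : Finset (V × V)) (n : ℕ) (d : ℕ → V) : Prop where
  three_le : 3 ≤ n
  per : ∀ i, d (i + n) = d i
  adj : ∀ i, SAdj S (d i) (d (i + 1))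
  inj : ∀ i j, d i = d j → i ≡ j [MOD n]

variable {S : Finset (V × V)} {c : V → Bool} {n : ℕ} {d : ℕ → V}

theorem isCyc_of_path {k : ℕ} (hk : 2 ≤ k) {p : ℕ → V} (hp : Set.InjOn p (Set.Iic k))
    (hadj : ∀ i < k, SAdj S (p i) (p (i + 1))) (hclose : SAdj S (p k) (p 0)) :
    IsCyc S (k + 1) fun i => p (i % (k + 1)) where
  three_le := by omega
  per i := by simp
  adj i := by
    have h : i % (k + 1) < k + 1 := Nat.mod_lt i (Nat.succ_pos k)
    rcases Nat.lt_or_ge (i % (k + 1)) k with h1 | h1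
    · have e : (i + 1) % (k + 1) = i % (k + 1) + 1 := by
        rw [Nat.add_mod, Nat.mod_eq_of_lt (by omega : 1 < k + 1), Nat.mod_eq_of_lt (by omega)]
      simp only [e]
      exact hadj _ h1
    · have e0 : i % (k + 1) = k := by omega
      have e : (i + 1) % (k + 1) = 0 := by
        rw [Nat.add_mod, e0, Nat.mod_eq_of_lt (by omega : 1 < k + 1), Nat.mod_self]
      simp only [e, e0]
      exact hclose
  inj i j h := hp (Set.mem_Iic.2 (Nat.le_of_lt_succ (Nat.mod_lt _ (Nat.succ_pos k))))
    (Set.mem_Iic.2 (Nat.le_of_lt_succ (Nat.mod_lt _ (Nat.succ_pos k)))) h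

theorem IsCyc.mono {T : Finset (V × V)} (h : IsCyc S n d) (hST : S ⊆ T) : IsCyc T n d :=
  ⟨h.three_le, h.per, fun i => (h.adj i).mono hST, h.inj⟩

theorem IsCyc.rotate (h : IsCyc S n d) (s : ℕ) : IsCyc S n fun i => d (i + s) where
  three_le := h.three_le
  per i := by
    have := h.per (i + s)
    rwa [Nat.add_right_comm] at this
  adj i := by
    have := h.adj (i + s)
    rwa [Nat.add_right_comm] at this
  inj i j hij := Nat.ModEq.add_right_cancel' s (h.inj _ _ hij)

theorem IsCyc.ne (h : IsCyc S n d) {i j : ℕ} (hij : i < j) (hj : j < i + n) : d i ≠ d j := by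
  intro h'
  have h1 := (Nat.modEq_iff_dvd' hij.le).1 (h.inj i j h')
  have := Nat.le_of_dvd (by omega) h1
  omega

theorem IsCyc.exists_lt (h : IsCyc S n d) (i : ℕ) : ∃ j < n, d j = d i := by
  have h3 := h.three_le
  refine ⟨i % n, Nat.mod_lt _ (by omega), ?_⟩
  have key : ∀ k a, d (a + n * k) = d a := by
    intro k
    induction k with
    | zero => simp
    | succ k ih => intro a; rw [Nat.mul_succ, ← Nat.add_assoc, h.per, ih]
  conv_rhs => rw [← Nat.mod_add_div i n]
  exact (key _ _).symm

theorem IsCyc.color (h : IsCyc S n d) (hS : IsBip c S) (i : ℕ) :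
    c (d i) = (c (d 0) ^^ i.bodd) := by
  induction i with
  | zero => simp
  | succ i ih => rw [hS.color (h.adj i), ih, Nat.bodd_succ]; simp

theorem IsCyc.exists_half (h : IsCyc S n d) (hS : IsBip c S) :
    ∃ m, m ≠ 0 ∧ n = 2 * (m + 1) := by
  have h1 := h.color hS n
  have h2 : d n = d 0 := by simpa using h.per 0
  rw [h2] at h1
  have h3 : n.bodd = false := by
    cases hc : c (d 0) <;> simp_all
  have h4 := Nat.bodd_add_div2 n
  have := h.three_le
  rw [h3] at h4
  simp only [Bool.toNat_false, zero_add] at h4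
  exact ⟨n.div2 - 1, by omega, by omega⟩

/-- `n` is at most the length of every cycle in `S`. -/
def CycLB (S : Finset (V × V)) (n : ℕ) : Prop := ∀ m d, IsCyc S m d → n ≤ m

/-- The arc from `d a` to `d b` together with the chord is a cycle of length `b - a + 1`, which
cannot be less than `n`. -/
theorem IsCyc.chord (h : IsCyc S n d) (hmin : CycLB S n) {a b : ℕ} (hab : a < b) (hb : b < a + n)
    (hadj : SAdj S (d a) (d b)) : b = a + 1 ∨ b + 1 = a + n := by
  by_contra hcon
  obtain ⟨l, rfl⟩ := Nat.exists_eq_add_of_lt hab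
  have := isCyc_of_path (S := S) (k := l + 1) (p := fun i => d (a + i)) (by omega)
    (fun i hi j hj hij => by
      by_contra hne
      have hi := Set.mem_Iic.1 hi
      have hj := Set.mem_Iic.1 hj
      rcases Nat.lt_or_gt_of_ne hne with hlt | hlt
      · exact h.ne (by omega) (by omega) hij
      · exact h.ne (by omega) (by omega) hij.symm)
    (fun i _ => h.adj (a + i)) (by simpa [Nat.add_assoc] using hadj.symm)
  have := hmin _ _ this
  omega

/-- The node `z` closes the arc of length `l` to a cycle of length `l + 2`. -/
theorem IsCyc.le_of_common_neighbor (h : IsCyc S n d) (hmin : CycLB S n) {z : V}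
    (hz : ∀ i, z ≠ d i) {s l : ℕ} (hl : 0 < l) (hln : l < n) (h1 : SAdj S z (d s))
    (h2 : SAdj S z (d (s + l))) : n ≤ l + 2 := by
  refine hmin _ _ (isCyc_of_path (S := S) (k := l + 1)
    (p := fun i => if i = 0 then z else d (s + (i - 1))) (by omega) ?_ ?_ ?_)
  · intro i hi j hj hij
    have hi := Set.mem_Iic.1 hi
    have hj := Set.mem_Iic.1 hj
    simp only at hij
    split_ifs at hij with hi0 hj0 hj0
    · omega
    · exact absurd hij (hz _)
    · exact absurd hij.symm (hz _)
    · by_contra hne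
      rcases Nat.lt_or_gt_of_ne hne with hlt | hlt
      · exact h.ne (by omega) (by omega) hij
      · exact h.ne (by omega) (by omega) hij.symm
  · intro i hi
    rcases Nat.eq_zero_or_pos i with rfl | hi0
    · simpa using h1
    · have := h.adj (s + (i - 1))
      rw [if_neg (by omega), if_neg (by omega)]
      convert this using 2; omega
  · simpa using h2.symm

/-- The edge `zz'` closes the arc of length `l` to a cycle of length `l + 3`. -/
theorem IsCyc.le_of_linked_neighbors (h : IsCyc S n d) (hmin : CycLB S n) {z z' : V}
    (hz : ∀ i, z ≠ d i) (hz' : ∀ i, z' ≠ d i) (hne : z ≠ z') (hzz : SAdj S z z') {s l : ℕ}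
    (hln : l < n) (h1 : SAdj S z (d s)) (h2 : SAdj S z' (d (s + l))) : n ≤ l + 3 := by
  refine hmin _ _ (isCyc_of_path (S := S) (k := l + 2)
    (p := fun i => if i = 0 then z' else if i = 1 then z else d (s + (i - 2))) (by omega) ?_ ?_ ?_)
  · intro i hi j hj hij
    have hi := Set.mem_Iic.1 hi
    have hj := Set.mem_Iic.1 hj
    simp only at hij
    split_ifs at hij with hi0 hj0 hj1 hi1 hj0 hj1 hj0 hj1
    · omega
    · exact absurd hij.symm hne
    · exact absurd hij (hz' _)
    · exact absurd hij hne
    · omega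
    · exact absurd hij (hz _)
    · exact absurd hij.symm (hz' _)
    · exact absurd hij.symm (hz _)
    · by_contra hne
      rcases Nat.lt_or_gt_of_ne hne with hlt | hlt
      · exact h.ne (by omega) (by omega) hij
      · exact h.ne (by omega) (by omega) hij.symm
  · intro i hi
    rcases Nat.eq_zero_or_pos i with rfl | hi0
    · simpa using hzz.symm
    · rcases Nat.lt_or_ge 1 i with hi1 | hi1
      · have := h.adj (s + (i - 2))
        rw [if_neg (by omega), if_neg (by omega), if_neg (by omega), if_neg (by omega)]
        convert this using 2; omega
      · obtain rfl : i = 1 := by omega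
        simpa using h1
  · simpa using h2.symm

/-- The opposite nodes `d 0` and `d (m + 1)` cut the cycle into two arcs, the second one read
backwards from `d (2 * (m + 1)) = d 0`. All the conditions hold because a shortest cycle has no
chords. -/
theorem IsCyc.pathPair {m : ℕ} (h : IsCyc S (2 * (m + 1)) d) (hS : IsBip c S)
    (hmin : CycLB S (2 * (m + 1))) :
    PathPair S m d fun i => d (2 * (m + 1) - i) where
  left :=
    { inj := fun i hi j hj hij => by
        have hi := Set.mem_Iic.1 hi
        have hj := Set.mem_Iic.1 hj
        by_contra hne
        rcases Nat.lt_or_gt_of_ne hne with hlt | hlt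
        · exact h.ne (by omega) (by omega) hij
        · exact h.ne (by omega) (by omega) hij.symm
      adj := fun i _ => h.adj i
      chordless := fun i hi j hj hadj => by
        rcases Nat.lt_trichotomy (i + 1) j with hlt | heq | hlt
        · rcases h.chord hmin hlt (by omega) hadj with h' | h' <;> omega
        · exact absurd (congrArg d heq) (hS.ne hadj)
        · rcases h.chord hmin hlt (by omega) hadj.symm with h' | h' <;> omega }
  right :=
    { inj := fun i hi j hj hij => by
        have hi := Set.mem_Iic.1 hi
        have hj := Set.mem_Iic.1 hj
        by_contra hne
        rcases Nat.lt_or_gt_of_ne hne with hlt | hlt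
        · exact h.ne (by omega) (by omega) hij.symm
        · exact h.ne (by omega) (by omega) hij
      adj := fun i hi => by
        have := (h.adj (2 * (m + 1) - (i + 1))).symm
        rwa [show 2 * (m + 1) - (i + 1) + 1 = 2 * (m + 1) - i by omega] at this
      chordless := fun i hi j hj hadj => by
        rcases Nat.lt_trichotomy (i + 1) j with hlt | heq | hlt
        · rcases h.chord hmin (by omega) (by omega) hadj.symm with h' | h' <;> omega
        · exact absurd (congrArg (fun i => d (2 * (m + 1) - i)) heq) (hS.ne hadj)
        · rcases h.chord hmin (by omega) (by omega) hadj with h' | h' <;> omega }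
  ne i hi j hj := h.ne (by omega) (by omega)
  not_adj i hi j hj hadj := by
    rcases h.chord hmin (by omega) (by omega) hadj with h' | h' <;> omega
  left_end j hj := ⟨(h.ne (by omega) (by omega)).symm, (h.ne (by omega) (by omega)).symm⟩

/-! ### Lower bounds for single terms -/

/-- `P` dominates the squared norms of the marginals at nodes of degree at least two in `S`, and the
densities of the cycles in `S`. -/
structure Dominates (U : I → I → ℝ) (c : V → Bool) (S : Finset (V × V)) (P : ℝ) : Prop where
  nonneg : 0 ≤ P
  marg : ∀ v u₁ u₂, u₁ ≠ u₂ → SAdj S v u₁ → SAdj S v u₂ → margSq U (c v) ≤ P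
  cycle : ∀ m d, m ≠ 0 → IsCyc S (2 * (m + 1)) d → cycleDens U m ≤ P

theorem Dominates.mono {U : I → I → ℝ} {T : Finset (V × V)} {P : ℝ} (h : Dominates U c T P)
    (hST : S ⊆ T) : Dominates U c S P where
  nonneg := h.nonneg
  marg v u₁ u₂ hu h₁ h₂ := h.marg v u₁ u₂ hu (h₁.mono hST) (h₂.mono hST)
  cycle m d hm hd := h.cycle m d hm (hd.mono hST)

theorem sqrt_mul_sqrt_le {x y P : ℝ} (hP : 0 ≤ P) (hx : x ≤ P) (hy : y ≤ P) : √x * √y ≤ P := by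
  rw [← Real.mul_self_sqrt hP]
  exact mul_le_mul (Real.sqrt_le_sqrt hx) (Real.sqrt_le_sqrt hy) (Real.sqrt_nonneg _)
    (Real.sqrt_nonneg _)

theorem neg_le_of_abs_le_mul {U : I → I → ℝ} {t y P : ℝ} (h : |t| ≤ fourRoot U * y) (hy : y ≤ P) :
    -(fourRoot U * P) ≤ t :=
  (abs_le.1 (h.trans (mul_le_mul_of_nonneg_left hy (fourRoot_nonneg U)))).1

/-- If `z` is a leaf, the marginal at `d 0` is used. Otherwise `z` has a neighbour `w` off the
cycle, and girth at least six keeps `zw` far enough from the arcs to serve as the further edge. -/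
theorem IsCyc.lower_bound_of_adj {m : ℕ} (h : IsCyc S (2 * (m + 1)) d) (hS : IsBip c S)
    (hm : 2 ≤ m) (hmin : CycLB S (2 * (m + 1))) {U : I → I → ℝ} (hU : BddKer U)
    (hb : ∀ s t, |U s t| ≤ 1) {P : ℝ} (hP : Dominates U c S P) {z : V} (hz : ∀ i, z ≠ d i)
    (hz0 : SAdj S z (d 0)) : -(fourRoot U * P) ≤ ∫ x, edgeProd U S x := by
  have hpp := h.pathPair hS hmin
  by_cases hleaf : IsLeaf S z (d 0)
  · refine neg_le_of_abs_le_mul (hpp.abs_integral_leaf_le hS (by omega) hU hb hleaf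
      (fun i _ => hz i) (fun i _ => hz _) fun i hi => (h.ne (by omega) (by omega)).symm)
      (sqrt_mul_sqrt_le hP.nonneg ?_ (hP.cycle m d (by omega) h))
    exact hP.marg (d 0) z (d 1) (hz 1) hz0.symm (h.adj 0)
  · have : ∃ w, SAdj S z w ∧ w ≠ d 0 := by
      by_contra hcon
      push Not at hcon
      exact hleaf ⟨hz0, hcon⟩
    obtain ⟨w, hzw, hw0⟩ := this
    -- Both arcs between `d 0` and `d l` would close through `z` to cycles of length at least `2 *
    -- (m + 1)`, forcing `m ≤ 1`.
    have hz1 : ∀ l, 0 < l → l < 2 * (m + 1) → ¬ SAdj S z (d l) := by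
      intro l hl hln hadj
      have h1 := h.le_of_common_neighbor hmin hz hl hln hz0 (by simpa using hadj)
      have h2 := h.le_of_common_neighbor hmin hz (s := l) (l := 2 * (m + 1) - l) (by omega)
        (by omega) hadj (by
          rw [show l + (2 * (m + 1) - l) = 0 + 2 * (m + 1) by omega, h.per]; exact hz0)
      omega
    have hwd : ∀ i, w ≠ d i := by
      rintro i rfl
      obtain ⟨j, hj, hji⟩ := h.exists_lt i
      rw [← hji] at hzw hw0
      rcases Nat.eq_zero_or_pos j with rfl | hj0
      · exact hw0 rfl
      · exact hz1 j hj0 hj hzw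
    -- Such an adjacency yields a cycle of length `l + 3 ≤ m + 3`, too short for `m ≥ 2`. Half of
    -- the cycle suffices, since `w` only has to be unseen by the first arc.
    have hw1 : ∀ l, 0 < l → l < m + 1 → ¬ SAdj S w (d l) := by
      intro l hl hln hadj
      have h2 := h.le_of_linked_neighbors hmin hz hwd (hS.ne hzw) hzw (s := 0) (l := l) (by omega)
        hz0 (by simpa using hadj)
      omega
    refine neg_le_of_abs_le_mul (hpp.abs_integral_le hS (by omega) hU hb hzw
      (fun i _ => ⟨hz _, hz _⟩) (fun i _ => ⟨hwd _, hwd _⟩) ⟨hwd _, hwd _, ?_⟩ ⟨hz _, hz _, ?_⟩)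
      (hP.cycle m d (by omega) h)
    · exact fun i hi hadj => hw1 (i + 1) (by omega) (by omega) hadj.symm
    · exact fun i hi hadj => hz1 (2 * (m + 1) - (i + 1)) (by omega) (by omega) hadj.symm

/-- The integral over the edges of a chordless cycle. -/
theorem IsCyc.integral_eq {m : ℕ} (h : IsCyc S (2 * (m + 1)) d) (hS : IsBip c S) (hm : m ≠ 0)
    (hmin : CycLB S (2 * (m + 1))) {U : I → I → ℝ} (hU : BddKer U) (hb : ∀ s t, |U s t| ≤ 1)
    (hd : ∀ v w, SAdj S v w → ∃ i, v = d i) : ∫ x, edgeProd U S x = cycleDens U m := by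
  have hpp := h.pathPair hS hmin
  have hd' : ∀ v w, SAdj S v w → ∃ i < 2 * (m + 1), v = d i := by
    intro v w hvw
    obtain ⟨i, rfl⟩ := hd v w hvw
    obtain ⟨j, hj, hji⟩ := h.exists_lt i
    exact ⟨j, hj, hji.symm⟩
  refine hpp.integral_eq hS hm hU hb (by simpa using (h.per 0).symm)
    (by congr 1; omega) ?_ ?_ ?_
  · refine Finset.filter_eq_empty_iff.2 fun e he => ?_
    rintro ⟨h1, h2⟩
    have key : ∀ v w, SAdj S v w → (∀ i < m, v ≠ d (i + 1)) →
        (∀ i < m, v ≠ d (2 * (m + 1) - (i + 1))) → v = d 0 ∨ v = d (m + 1) := by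
      intro v w hvw h1 h2
      obtain ⟨i, hi, rfl⟩ := hd' v w hvw
      rcases Nat.eq_zero_or_pos i with rfl | hi0
      · exact Or.inl rfl
      rcases Nat.lt_trichotomy i (m + 1) with hlt | rfl | hlt
      · refine absurd ?_ (h1 (i - 1) (by omega))
        congr 1; omega
      · exact Or.inr rfl
      · refine absurd ?_ (h2 (2 * (m + 1) - i - 1) (by omega))
        congr 1; omega
    have hadj := sAdj_of_mem he
    have hne := hS.ne hadj
    have k1 := key e.1 e.2 hadj (fun i hi h' => h1 ⟨i, hi, Or.inl h'⟩)
      (fun i hi h' => h2 ⟨i, hi, Or.inl h'⟩)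
    have k2 := key e.2 e.1 hadj.symm (fun i hi h' => h1 ⟨i, hi, Or.inr h'⟩)
      (fun i hi h' => h2 ⟨i, hi, Or.inr h'⟩)
    have h3 : ¬ SAdj S (d 0) (d (m + 1)) := by
      intro h3
      rcases h.chord hmin (by omega) (by omega) h3 with h' | h' <;> omega
    rcases k1 with k1 | k1 <;> rcases k2 with k2 | k2
    · exact hne (k1.trans k2.symm)
    · rw [k1, k2] at hadj; exact h3 hadj
    · rw [k1, k2] at hadj; exact h3 hadj.symm
    · exact hne (k1.trans k2.symm)
  · intro i hi v hv
    obtain ⟨j, hj, rfl⟩ := hd' v _ hv.symm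
    refine mem_pathNodes.2 ⟨j, ?_, rfl⟩
    rcases Nat.lt_or_ge (i + 1) j with hlt | hlt
    · rcases h.chord hmin hlt (by omega) hv with h' | h' <;> omega
    · omega
  · intro i hi v hv
    obtain ⟨j, hj, rfl⟩ := hd' v _ hv.symm
    rcases Nat.eq_zero_or_pos j with rfl | hj0
    · exact mem_pathNodes.2 ⟨0, by omega, by simpa using h.per 0⟩
    refine mem_pathNodes.2 ⟨2 * (m + 1) - j, ?_, by congr 1; omega⟩
    rcases Nat.lt_or_ge j (2 * (m + 1) - (i + 1)) with hlt | hlt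
    · rcases h.chord hmin hlt (by omega) hv.symm with h' | h' <;> omega
    · omega

/-- Edge sets with girth at least six. -/
theorem IsCyc.lower_bound {m : ℕ} (h : IsCyc S (2 * (m + 1)) d) (hS : IsBip c S)
    (hm : 2 ≤ m) (hmin : CycLB S (2 * (m + 1))) {U : I → I → ℝ} (hU : BddKer U)
    (hb : ∀ s t, |U s t| ≤ 1) {P : ℝ} (hP : Dominates U c S P) :
    -(fourRoot U * P) ≤ ∫ x, edgeProd U S x := by
  have h0 := mul_nonneg (fourRoot_nonneg U) hP.nonneg
  by_cases hd : ∀ v w, SAdj S v w → ∃ i, v = d i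
  · rw [h.integral_eq hS (by omega) hmin hU hb hd]
    linarith [cycleDens_nonneg U m]
  push Not at hd
  obtain ⟨z, w, hzw, hz⟩ := hd
  by_cases h1 : ∃ v i, (∀ i, v ≠ d i) ∧ SAdj S v (d i)
  · obtain ⟨v, i, hv, hvi⟩ := h1
    exact (h.rotate i).lower_bound_of_adj hS hm hmin hU hb hP (fun j => hv _) (by simpa using hvi)
  · push Not at h1
    have hw : ∀ i, w ≠ d i := by
      rintro i rfl
      exact h1 z i hz hzw
    exact neg_le_of_abs_le_mul ((h.pathPair hS hmin).abs_integral_le hS (by omega) hU hb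
      hzw (fun i _ => ⟨hz _, hz _⟩) (fun i _ => ⟨hw _, hw _⟩)
      ⟨hw _, hw _, fun i _ hadj => h1 w _ hw hadj.symm⟩
      ⟨hz _, hz _, fun i _ hadj => h1 z _ hz hadj.symm⟩) (hP.cycle m d (by omega) h)

end Cycles

/-! ### Bicliques versus terms bounded below -/

section Classification

set_option linter.unusedSectionVars false

variable {V : Type*} [Fintype V] [DecidableEq V] {S : Finset (V × V)} {c : V → Bool}

/-! ### Edge sets containing a 4-cycle -/

/-- The sequence `a, b, w, w, …`. -/
def three (a b w : V) : ℕ → V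
  | 0 => a
  | 1 => b
  | _ => w

theorem inducedPath_three (hS : IsBip c S) {a b w : V} (hab : SAdj S a b) (hbw : SAdj S b w)
    (haw : a ≠ w) : InducedPath S 1 (three a b w) where
  inj i hi j hj hij := by
    have hi : i ≤ 2 := hi
    have hj : j ≤ 2 := hj
    have h1 := hS.ne hab
    have h2 := hS.ne hbw
    interval_cases i <;> interval_cases j <;> simp_all [three]
  adj i hi := by
    interval_cases i
    · exact hab
    · exact hbw
  chordless i hi j hj hadj := by
    obtain rfl : i = 0 := by omega
    interval_cases j
    · exact Or.inr rfl
    · exact absurd rfl (hS.ne hadj)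
    · exact Or.inl rfl

theorem pathPair_three (hS : IsBip c S) {a b w a' b' w' : V} (hab : SAdj S a b) (hbw : SAdj S b w)
    (haw : a ≠ w) (hab' : SAdj S a' b') (hbw' : SAdj S b' w') (haw' : a' ≠ w') (hbb : b ≠ b')
    (hbb' : ¬ SAdj S b b') (hba : b' ≠ a) (hbw'' : b' ≠ w) :
    PathPair S 1 (three a b w) (three a' b' w') where
  left := inducedPath_three hS hab hbw haw
  right := inducedPath_three hS hab' hbw' haw'
  ne i hi j hj := by
    obtain rfl : i = 0 := by omega
    obtain rfl : j = 0 := by omega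
    exact hbb
  not_adj i hi j hj := by
    obtain rfl : i = 0 := by omega
    obtain rfl : j = 0 := by omega
    exact hbb'
  left_end j hj := by
    obtain rfl : j = 0 := by omega
    exact ⟨hba, hbw''⟩

theorem exists_fourCycle (hS : IsBip c S) {a₁ a₂ b₁ b₂ : V} (ha : a₁ ≠ a₂) (hb : b₁ ≠ b₂)
    (h₁₁ : SAdj S a₁ b₁) (h₁₂ : SAdj S a₁ b₂) (h₂₁ : SAdj S a₂ b₁) (h₂₂ : SAdj S a₂ b₂) :
    ∃ d, IsCyc S (2 * (1 + 1)) d := by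
  let p : ℕ → V := fun i => match i with
    | 0 => a₁
    | 1 => b₁
    | 2 => a₂
    | _ => b₂
  refine ⟨_, isCyc_of_path (S := S) (k := 3) (p := p) (by omega) ?_ ?_ h₁₂.symm⟩
  · intro i hi j hj hij
    have hi : i ≤ 3 := hi
    have hj : j ≤ 3 := hj
    have h1 := hS.ne h₁₁
    have h2 := hS.ne h₁₂
    have h3 := hS.ne h₂₁
    have h4 := hS.ne h₂₂
    interval_cases i <;> interval_cases j <;> simp_all [p]
  · intro i hi
    interval_cases i
    · exact h₁₁
    · exact h₂₁.symm
    · exact h₂₂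

theorem IsBip.not_adj (hS : IsBip c S) {v w : V} (h : c v = c w) : ¬ SAdj S v w := by
  intro hvw
  have := hS.color hvw
  rw [h] at this
  simp at this

/-- A complete bipartite subgraph together with a further node that is not completely joined to its
opposite class. -/
theorem lower_bound_of_extra_node (hS : IsBip c S) {U : I → I → ℝ} (hU : BddKer U)
    (hb : ∀ s t, |U s t| ≤ 1) {P : ℝ} (hP : Dominates U c S P) {A B : Finset V}
    (hA : 2 ≤ A.card) (hB : 2 ≤ B.card) (hAB : ∀ a ∈ A, ∀ b ∈ B, SAdj S a b) {z z' : V}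
    (hzA : z ∉ A) (hzB : z ∉ B) (hzc : ∀ b ∈ B, c z = c b) (hzz : SAdj S z z')
    (hmax : ∃ a ∈ A, ¬ SAdj S a z) : -(fourRoot U * P) ≤ ∫ x, edgeProd U S x := by
  have hcA : ∀ a ∈ A, ∀ b ∈ B, c b = !c a := fun a ha b hb => hS.color (hAB a ha b hb)
  obtain ⟨b₁, hb₁⟩ : B.Nonempty := Finset.card_pos.1 (by omega)
  obtain ⟨b₂, hb₂, hbne⟩ := Finset.exists_mem_ne (show 1 < B.card by omega) b₁
  have hcyc : ∀ a₁ ∈ A, ∀ a₂ ∈ A, a₁ ≠ a₂ → cycleDens U 1 ≤ P := by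
    intro a₁ h₁ a₂ h₂ hne
    obtain ⟨d, hd⟩ := exists_fourCycle hS hne hbne.symm (hAB _ h₁ _ hb₁) (hAB _ h₁ _ hb₂)
      (hAB _ h₂ _ hb₁) (hAB _ h₂ _ hb₂)
    exact hP.cycle 1 d one_ne_zero hd
  have hzcA : ∀ a ∈ A, c z = !c a := fun a ha => (hzc b₁ hb₁).trans (hcA a ha b₁ hb₁)
  have hAA : ∀ a ∈ A, ∀ a' ∈ A, c a = c a' := by
    intro a ha a' ha'
    have h1 := hzcA a ha
    rw [hzcA a' ha'] at h1
    simpa using h1.symm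
  have hz'c := hS.color hzz
  by_cases h1 : ∃ a ∈ A, SAdj S z a
  · obtain ⟨a₁, ha₁, hza₁⟩ := h1
    obtain ⟨a₂, ha₂, hza₂⟩ := hmax
    have hne : a₁ ≠ a₂ := by rintro rfl; exact hza₂ hza₁.symm
    by_cases hleaf : IsLeaf S z a₁
    -- A 4-cycle `a₁ b₁ a₂ b₂` with the pendant edge `a₁ z`.
    · have hpp : PathPair S 1 (three a₁ b₁ a₂) (three a₁ b₂ a₂) :=
        pathPair_three hS (hAB _ ha₁ _ hb₁) (hAB _ ha₂ _ hb₁).symm hne (hAB _ ha₁ _ hb₂)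
          (hAB _ ha₂ _ hb₂).symm hne hbne.symm
          (hS.not_adj ((hzc _ hb₁).symm.trans (hzc _ hb₂))) (hS.ne (hAB _ ha₁ _ hb₂)).symm
          (hS.ne (hAB _ ha₂ _ hb₂)).symm
      refine neg_le_of_abs_le_mul (hpp.abs_integral_leaf_le hS one_ne_zero hU hb hleaf ?_ ?_ ?_)
        (sqrt_mul_sqrt_le hP.nonneg (hP.marg a₁ b₁ b₂ hbne.symm (hAB _ ha₁ _ hb₁)
          (hAB _ ha₁ _ hb₂)) (hcyc a₁ ha₁ a₂ ha₂ hne))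
      · intro i hi
        interval_cases i
        · exact fun h => hzA (h ▸ ha₁)
        · exact fun h => hzB (h ▸ hb₁)
        · exact fun h => hzA (h ▸ ha₂)
      · intro i hi
        interval_cases i
        · exact fun h => hzA (h ▸ ha₁)
        · exact fun h => hzB (h ▸ hb₂)
        · exact fun h => hzA (h ▸ ha₂)
      · intro i hi
        obtain rfl : i = 0 := by omega
        exact (hS.ne (hAB _ ha₁ _ hb₂)).symm
    · have : ∃ w, SAdj S z w ∧ w ≠ a₁ := by
        by_contra hcon
        push Not at hcon
        exact hleaf ⟨hza₁, hcon⟩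
      obtain ⟨w, hzw, hw⟩ := this
      have hcw := hS.color hzw
      -- The two paths need not form a cycle: their middle nodes `z` and `a₂` are not adjacent by
      -- the choice of `a₂`, and `a₁ b₁` is the further edge.
      have hpp : PathPair S 1 (three w z a₁) (three b₁ a₂ b₂) :=
        pathPair_three hS hzw.symm hza₁ hw (hAB _ ha₂ _ hb₁).symm (hAB _ ha₂ _ hb₂) hbne.symm
          (fun h => hzA (h ▸ ha₂)) (fun h => hza₂ h.symm)
          (fun h => hza₂ (h ▸ hzw.symm)) hne.symm
      refine neg_le_of_abs_le_mul (hpp.abs_integral_le hS one_ne_zero hU hb (hAB _ ha₁ _ hb₁)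
        ?_ ?_ ⟨?_, ?_, ?_⟩ ⟨?_, ?_, ?_⟩) (hcyc a₁ ha₁ a₂ ha₂ hne)
      · intro i hi
        obtain rfl : i = 0 := by omega
        exact ⟨(hS.ne hza₁).symm, hne⟩
      · intro i hi
        obtain rfl : i = 0 := by omega
        exact ⟨fun h : b₁ = z => hzB (h ▸ hb₁), (hS.ne (hAB _ ha₂ _ hb₁)).symm⟩
      · rintro rfl
        exact hS.not_adj (hzc _ hb₁) hzw
      · exact (hS.ne (hAB _ ha₁ _ hb₁)).symm
      · intro i hi
        obtain rfl : i = 0 := by omega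
        exact hS.not_adj (hzc _ hb₁)
      · exact hS.ne (hAB _ ha₁ _ hb₁)
      · exact hS.ne (hAB _ ha₁ _ hb₂)
      · intro i hi
        obtain rfl : i = 0 := by omega
        exact hS.not_adj (hAA _ ha₂ _ ha₁)
  · push Not at h1
    obtain ⟨a₁, ha₁⟩ : A.Nonempty := Finset.card_pos.1 (by omega)
    obtain ⟨a₂, ha₂, hne⟩ := Finset.exists_mem_ne (show 1 < A.card by omega) a₁
    have hz'A : z' ∉ A := fun h => h1 z' h hzz
    have hcz' : ∀ a ∈ A, c a = c z' := by
      intro a ha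
      have := hzcA a ha
      rw [hz'c, this]
      simp
    have hz'B : ∀ b ∈ B, z' ≠ b := by
      rintro b hb rfl
      exact hS.not_adj (hzc _ hb) hzz
    -- The 4-cycle is split at `b₁` and `b₂`. The edge `zz'` misses it; `z` is not adjacent to `a₁`
    -- by assumption, nor `z'` to `a₂` by colour.
    have hpp : PathPair S 1 (three b₁ a₁ b₂) (three b₁ a₂ b₂) :=
      pathPair_three hS (hAB _ ha₁ _ hb₁).symm (hAB _ ha₁ _ hb₂) hbne.symm (hAB _ ha₂ _ hb₁).symm
        (hAB _ ha₂ _ hb₂) hbne.symm hne.symm (hS.not_adj (hAA _ ha₁ _ ha₂))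
        (hS.ne (hAB _ ha₂ _ hb₁)) (hS.ne (hAB _ ha₂ _ hb₂))
    refine neg_le_of_abs_le_mul (hpp.abs_integral_le hS one_ne_zero hU hb hzz.symm
      ?_ ?_ ⟨?_, ?_, ?_⟩ ⟨?_, ?_, ?_⟩) (hcyc a₁ ha₁ a₂ ha₂ hne.symm)
    · intro i hi
      obtain rfl : i = 0 := by omega
      exact ⟨fun h => hz'A (h ▸ ha₁), fun h => hz'A (h ▸ ha₂)⟩
    · intro i hi
      obtain rfl : i = 0 := by omega
      exact ⟨fun h => hzA (h ▸ ha₁), fun h => hzA (h ▸ ha₂)⟩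
    · exact fun h => hzB (h ▸ hb₁)
    · exact fun h => hzB (h ▸ hb₂)
    · intro i hi
      obtain rfl : i = 0 := by omega
      exact fun h => h1 a₁ ha₁ h.symm
    · exact hz'B _ hb₁
    · exact hz'B _ hb₂
    · intro i hi
      obtain rfl : i = 0 := by omega
      exact hS.not_adj (hcz' _ ha₂)

/-- `S` is the edge set of a complete bipartite graph with more than one edge. -/
def IsBiclique (S : Finset (V × V)) : Prop :=
  ∃ A B : Finset V, A.Nonempty ∧ B.Nonempty ∧ 3 ≤ A.card + B.card ∧ S = A ×ˢ B

theorem isBiclique_or_lower_bound_of_fourCycle (hS : IsBip c S) {U : I → I → ℝ} (hU : BddKer U)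
    (hb : ∀ s t, |U s t| ≤ 1) {P : ℝ} (hP : Dominates U c S P) {d : ℕ → V} (hd : IsCyc S 4 d) :
    IsBiclique S ∨ -(fourRoot U * P) ≤ ∫ x, edgeProd U S x := by
  classical
  let fam : Finset (Finset V × Finset V) := Finset.univ.filter fun p =>
    2 ≤ p.1.card ∧ 2 ≤ p.2.card ∧ p.1 ×ˢ p.2 ⊆ S
  have hfam : fam.Nonempty := by
    have h02 : d 0 ≠ d 2 := hd.ne (by omega) (by omega)
    have h13 : d 1 ≠ d 3 := hd.ne (by omega) (by omega)
    have e40 : d 4 = d 0 := hd.per 0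
    have h01 := hd.adj 0
    have h12 := hd.adj 1
    have h23 := hd.adj 2
    have h30 := hd.adj 3
    simp only [zero_add, Nat.reduceAdd, e40] at h01 h12 h23 h30
    have key : ∀ {v w}, SAdj S v w → c v = false → (v, w) ∈ S := by
      rintro v w (h | h) hv
      · exact h
      · have := (hS _ h).2; simp_all
    have c1 := hS.color h01
    have c2 := hS.color h12
    have c3 := hS.color h23
    cases hc0 : c (d 0)
    · refine ⟨({d 0, d 2}, {d 1, d 3}), Finset.mem_filter.2 ⟨Finset.mem_univ _, ?_, ?_, ?_⟩⟩
      · rw [Finset.card_pair h02]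
      · rw [Finset.card_pair h13]
      · rintro ⟨v, w⟩ hvw
        simp only [Finset.mem_product, Finset.mem_insert, Finset.mem_singleton] at hvw
        obtain ⟨rfl | rfl, rfl | rfl⟩ := hvw
        · exact key h01 hc0
        · exact key h30.symm hc0
        · exact key h12.symm (by simp_all)
        · exact key h23 (by simp_all)
    · refine ⟨({d 1, d 3}, {d 0, d 2}), Finset.mem_filter.2 ⟨Finset.mem_univ _, ?_, ?_, ?_⟩⟩
      · rw [Finset.card_pair h13]
      · rw [Finset.card_pair h02]
      · rintro ⟨v, w⟩ hvw
        simp only [Finset.mem_product, Finset.mem_insert, Finset.mem_singleton] at hvw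
        obtain ⟨rfl | rfl, rfl | rfl⟩ := hvw
        · exact key h01.symm (by simp_all)
        · exact key h12 (by simp_all)
        · exact key h30 (by simp_all)
        · exact key h23.symm (by simp_all)
  -- If a largest biclique is not all of `S`, an edge outside it has an end outside it, and by
  -- maximality that end is not joined to the whole opposite class.
  obtain ⟨⟨A, B⟩, hAB, hmax⟩ := fam.exists_max_image (fun p => p.1.card + p.2.card) hfam
  obtain ⟨-, hA, hB, hsub⟩ := Finset.mem_filter.1 hAB
  simp only at hA hB hsub
  have hadj : ∀ a ∈ A, ∀ b ∈ B, SAdj S a b :=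
    fun a ha b hb => Or.inl (hsub (Finset.mk_mem_product ha hb))
  obtain ⟨a₀, ha₀⟩ : A.Nonempty := Finset.card_pos.1 (by omega)
  obtain ⟨b₀, hb₀⟩ : B.Nonempty := Finset.card_pos.1 (by omega)
  have cA : ∀ a ∈ A, c a = false := fun a ha => (hS _ (hsub (Finset.mk_mem_product ha hb₀))).1
  have cB : ∀ b ∈ B, c b = true := fun b hb => (hS _ (hsub (Finset.mk_mem_product ha₀ hb))).2
  by_cases hEq : S = A ×ˢ B
  · exact Or.inl ⟨A, B, ⟨a₀, ha₀⟩, ⟨b₀, hb₀⟩, by omega, hEq⟩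
  right
  obtain ⟨e, heS, heAB⟩ : ∃ e ∈ S, e ∉ A ×ˢ B := by
    by_contra hcon
    push Not at hcon
    exact hEq (Finset.Subset.antisymm hcon hsub)
  have hce := hS e heS
  by_cases heB : e.2 ∈ B
  · have heA : e.1 ∉ A := fun h => heAB (Finset.mem_product.2 ⟨h, heB⟩)
    refine lower_bound_of_extra_node hS hU hb hP hB hA (fun b hb a ha => (hadj a ha b hb).symm)
      (z := e.1) (z' := e.2) (fun h => ?_) heA (fun a ha => hce.1.trans (cA a ha).symm)
      (sAdj_of_mem heS) ?_
    · have := cB _ h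
      rw [hce.1] at this
      simp at this
    · by_contra hcon
      push Not at hcon
      have hmem : (insert e.1 A, B) ∈ fam := by
        refine Finset.mem_filter.2 ⟨Finset.mem_univ _, ?_, hB, ?_⟩
        · simp only
          rw [Finset.card_insert_of_notMem heA]; omega
        · rintro ⟨v, w⟩ hvw
          obtain ⟨hv, hw⟩ := Finset.mem_product.1 hvw
          rcases Finset.mem_insert.1 hv with rfl | hv
          · rcases hcon w hw with h | h
            · have := (hS _ h).2; simp_all
            · exact h
          · exact hsub (Finset.mk_mem_product hv hw)
      have := hmax _ hmem
      simp only [Finset.card_insert_of_notMem heA] at this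
      omega
  · refine lower_bound_of_extra_node hS hU hb hP hA hB hadj
      (z := e.2) (z' := e.1) (fun h => ?_) heB (fun b hb => hce.2.trans (cB b hb).symm)
      (sAdj_of_mem heS).symm ?_
    · have := cA _ h
      rw [hce.2] at this
      simp at this
    · by_contra hcon
      push Not at hcon
      have hmem : (A, insert e.2 B) ∈ fam := by
        refine Finset.mem_filter.2 ⟨Finset.mem_univ _, hA, ?_, ?_⟩
        · simp only
          rw [Finset.card_insert_of_notMem heB]; omega
        · rintro ⟨v, w⟩ hvw
          obtain ⟨hv, hw⟩ := Finset.mem_product.1 hvw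
          rcases Finset.mem_insert.1 hw with rfl | hw
          · rcases hcon v hv with h | h
            · exact h
            · have := (hS _ h).1; simp_all
          · exact hsub (Finset.mk_mem_product hv hw)
      have := hmax _ hmem
      simp only [Finset.card_insert_of_notMem heB] at this
      omega

/-! ### Edge sets with two leaves -/

theorem isBiclique_or_lower_bound_of_leaves (hS : IsBip c S) {U : I → I → ℝ} (hU : BddKer U)
    (hb : ∀ s t, |U s t| ≤ 1) {P : ℝ} (hP : Dominates U c S P)
    (hiso : ∀ v u, IsLeaf S v u → ¬ IsLeaf S u v) {v₁ u₁ v₂ u₂ : V}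
    (h₁ : IsLeaf S v₁ u₁) (h₂ : IsLeaf S v₂ u₂) (hv : v₁ ≠ v₂) :
    IsBiclique S ∨ -(fourRoot U * P) ≤ ∫ x, edgeProd U S x := by
  classical
  have hdeg : ∀ v u, IsLeaf S v u → ∃ b, b ≠ v ∧ SAdj S u b := by
    intro v u h
    by_contra hcon
    push Not at hcon
    exact hiso v u h ⟨h.1.symm, fun w hw => by_contra fun hne => hcon w hne hw⟩
  have hmarg : ∀ v u, IsLeaf S v u → margSq U (c u) ≤ P := by
    intro v u h
    obtain ⟨b, hbv, hub⟩ := hdeg v u h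
    exact hP.marg u b v hbv hub h.1.symm
  have hu : u₁ ≠ v₂ := by
    rintro rfl
    have := h₂.2 v₁ h₁.1.symm
    subst this
    exact hiso _ _ h₁ h₂
  have hu' : u₂ ≠ v₁ := by
    rintro rfl
    have := h₁.2 v₂ h₂.1.symm
    subst this
    exact hiso _ _ h₁ h₂
  have hbound : ∀ a b, SAdj S a b → a ≠ v₁ → a ≠ v₂ → b ≠ v₁ → b ≠ v₂ → b ≠ u₁ → a ≠ u₂ →
      -(fourRoot U * P) ≤ ∫ x, edgeProd U S x := fun a b hab e1 e2 e3 e4 e5 e6 =>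
    neg_le_of_abs_le_mul (abs_integral_two_leaves_le hU hb hS h₁ h₂ hv hu hab e1 e2 e3 e4 e5 e6)
      (sqrt_mul_sqrt_le hP.nonneg (hmarg _ _ h₁) (hmarg _ _ h₂))
  -- If the neighbour is common, any edge avoiding it is a suitable further edge; without such an
  -- edge `S` is a star.
  by_cases huu : u₁ = u₂
  · subst huu
    by_cases hstar : ∃ a b, SAdj S a b ∧ a ≠ u₁ ∧ b ≠ u₁
    · obtain ⟨a, b, hab, ha, hb'⟩ := hstar
      refine Or.inr (hbound a b hab ?_ ?_ ?_ ?_ hb' ha)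
      · rintro rfl; exact hb' (h₁.2 _ hab)
      · rintro rfl; exact hb' (h₂.2 _ hab)
      · rintro rfl; exact ha (h₁.2 _ hab.symm)
      · rintro rfl; exact ha (h₂.2 _ hab.symm)
    · left
      push Not at hstar
      cases hc : c u₁
      · have hfst : ∀ e ∈ S, e.1 = u₁ := by
          intro e he
          by_contra hne
          have h3 := hstar _ _ (sAdj_of_mem he) hne
          have := (hS e he).2
          rw [h3, hc] at this
          simp at this
        have hmem : ∀ v, IsLeaf S v u₁ → v ∈ S.image Prod.snd := by
          rintro v ⟨h | h, -⟩
          · have := (hS _ h).2; simp_all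
          · exact Finset.mem_image.2 ⟨_, h, rfl⟩
        have hcard : 1 < (S.image Prod.snd).card :=
          Finset.one_lt_card.2 ⟨v₁, hmem _ h₁, v₂, hmem _ h₂, hv⟩
        refine ⟨{u₁}, S.image Prod.snd, Finset.singleton_nonempty _,
          Finset.card_pos.1 (by omega), by rw [Finset.card_singleton]; omega, ?_⟩
        ext ⟨v, w⟩
        simp only [Finset.mem_product, Finset.mem_singleton, Finset.mem_image]
        constructor
        · exact fun h => ⟨hfst _ h, _, h, rfl⟩
        · rintro ⟨rfl, e, he, rfl⟩
          have := hfst e he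
          rwa [← this]
      · have hsnd : ∀ e ∈ S, e.2 = u₁ := by
          intro e he
          by_contra hne
          have h3 := hstar _ _ (sAdj_of_mem he).symm hne
          have := (hS e he).1
          rw [h3, hc] at this
          simp at this
        have hmem : ∀ v, IsLeaf S v u₁ → v ∈ S.image Prod.fst := by
          rintro v ⟨h | h, -⟩
          · exact Finset.mem_image.2 ⟨_, h, rfl⟩
          · have := (hS _ h).1; simp_all
        have hcard : 1 < (S.image Prod.fst).card :=
          Finset.one_lt_card.2 ⟨v₁, hmem _ h₁, v₂, hmem _ h₂, hv⟩
        refine ⟨S.image Prod.fst, {u₁}, Finset.card_pos.1 (by omega),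
          Finset.singleton_nonempty _, by rw [Finset.card_singleton]; omega, ?_⟩
        ext ⟨v, w⟩
        simp only [Finset.mem_product, Finset.mem_singleton, Finset.mem_image]
        constructor
        · exact fun h => ⟨⟨_, h, rfl⟩, hsnd _ h⟩
        · rintro ⟨⟨e, he, rfl⟩, rfl⟩
          have := hsnd e he
          rwa [← this]
  · right
    -- Since no edge is isolated, `u₁` has a second edge, which serves as the further edge.
    obtain ⟨b, hbv, hub⟩ := hdeg _ _ h₁
    exact hbound u₁ b hub (hS.ne h₁.1).symm hu hbv (fun h => huu (h₂.2 _ (h ▸ hub.symm)))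
      (hS.ne hub).symm huu

/-! ### Long paths -/

/-- An end of a longest path is a leaf or has another neighbour on the path, which closes a cycle.
-/
theorem exists_isCyc_or_two_leaves (hS : IsBip c S) (hne : S.Nonempty) :
    (∃ n d, IsCyc S n d) ∨ ∃ v₁ u₁ v₂ u₂, IsLeaf S v₁ u₁ ∧ IsLeaf S v₂ u₂ ∧ v₁ ≠ v₂ := by
  classical
  let Q : ℕ → Prop := fun k => ∃ p : ℕ → V, Set.InjOn p (Set.Iic k) ∧
    ∀ i < k, SAdj S (p i) (p (i + 1))
  have hQ1 : Q 1 := by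
    obtain ⟨e, he⟩ := hne
    refine ⟨fun i => if i = 0 then e.1 else e.2, ?_, ?_⟩
    · intro i hi j hj hij
      have hi : i ≤ 1 := hi
      have hj : j ≤ 1 := hj
      have := hS.ne (sAdj_of_mem he)
      interval_cases i <;> interval_cases j <;> simp_all
    · intro i hi
      obtain rfl : i = 0 := by omega
      exact sAdj_of_mem he
  have hQb : ∀ k, Q k → k ≤ Fintype.card V := by
    rintro k ⟨p, hp, -⟩
    have h1 : ((Finset.Iic k).image p).card = k + 1 := by
      rw [Finset.card_image_of_injOn (by simpa using hp), Nat.card_Iic]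
    have h2 := Finset.card_le_univ ((Finset.Iic k).image p)
    omega
  set k := Nat.findGreatest Q (Fintype.card V) with hk
  have hQk : Q k := Nat.findGreatest_spec (hQb 1 hQ1) hQ1
  have hk1 : 1 ≤ k := Nat.le_findGreatest (hQb 1 hQ1) hQ1
  have hmax : ¬ Q (k + 1) := by
    intro h
    have := Nat.le_findGreatest (hQb _ h) h
    omega
  have hend : ∀ p : ℕ → V, Set.InjOn p (Set.Iic k) → (∀ i < k, SAdj S (p i) (p (i + 1))) →
      (∃ n d, IsCyc S n d) ∨ IsLeaf S (p 0) (p 1) := by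
    intro p hp hadj
    by_cases hleaf : ∀ w, SAdj S (p 0) w → w = p 1
    · exact Or.inr ⟨hadj 0 (by omega), hleaf⟩
    left
    push Not at hleaf
    obtain ⟨w, hw, hw1⟩ := hleaf
    by_cases hwp : ∃ j ≤ k, p j = w
    · obtain ⟨j, hj, rfl⟩ := hwp
      have hj0 : j ≠ 0 := by rintro rfl; exact hS.ne hw rfl
      have hj1 : j ≠ 1 := by rintro rfl; exact hw1 rfl
      exact ⟨_, _, isCyc_of_path (k := j) (by omega)
        (hp.mono (Set.Iic_subset_Iic.2 hj)) (fun i hi => hadj i (by omega)) hw.symm⟩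
    · push Not at hwp
      refine absurd ⟨fun i => if i = 0 then w else p (i - 1), ?_, ?_⟩ hmax
      · intro i hi j hj hij
        have hi := Set.mem_Iic.1 hi
        have hj := Set.mem_Iic.1 hj
        simp only at hij
        split_ifs at hij with hi0 hj0 hj0
        · omega
        · exact absurd hij.symm (hwp _ (by omega))
        · exact absurd hij (hwp _ (by omega))
        · have := hp (Set.mem_Iic.2 (by omega)) (Set.mem_Iic.2 (by omega)) hij
          omega
      · intro i hi
        rcases Nat.eq_zero_or_pos i with rfl | hi0
        · simpa using hw.symm
        · have := hadj (i - 1) (by omega)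
          simp only [if_neg hi0.ne', Nat.succ_ne_zero, if_false, Nat.add_sub_cancel]
          rwa [Nat.sub_add_cancel hi0] at this
  obtain ⟨p, hp, hadj⟩ := hQk
  rcases hend p hp hadj with h | h
  · exact Or.inl h
  rcases hend (fun i => p (k - i)) (fun i hi j hj hij => by
      have hi := Set.mem_Iic.1 hi
      have hj := Set.mem_Iic.1 hj
      have := hp (Set.mem_Iic.2 (by omega)) (Set.mem_Iic.2 (by omega)) hij
      omega) (fun i hi => by
      have := (hadj (k - (i + 1)) (by omega)).symm
      rwa [show k - (i + 1) + 1 = k - i by omega] at this) with h' | h'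
  · exact Or.inl h'
  · refine Or.inr ⟨_, _, _, _, h, h', fun h0 => ?_⟩
    have := hp (Set.mem_Iic.2 (by omega)) (Set.mem_Iic.2 (by omega)) h0
    omega

/-- Every term that does not come from a complete bipartite graph is bounded below. -/
theorem isBiclique_or_lower_bound (hS : IsBip c S) (hne : S.Nonempty) {U : I → I → ℝ}
    (hU : BddKer U) (hb : ∀ s t, |U s t| ≤ 1) (h0 : ∫ p : I × I, U p.1 p.2 = 0) {P : ℝ}
    (hP : Dominates U c S P) : IsBiclique S ∨ -(fourRoot U * P) ≤ ∫ x, edgeProd U S x := by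
  classical
  by_cases hiso : ∃ v u, IsLeaf S v u ∧ IsLeaf S u v
  · obtain ⟨v, u, h, h'⟩ := hiso
    right
    rw [integral_edgeProd_of_isolated hU h0 hS h h']
    linarith [mul_nonneg (fourRoot_nonneg U) hP.nonneg]
  push Not at hiso
  rcases exists_isCyc_or_two_leaves hS hne with h | ⟨v₁, u₁, v₂, u₂, h₁, h₂, hv⟩
  · obtain ⟨d, hd⟩ := Nat.find_spec h
    have hmin : CycLB S (Nat.find h) := fun m d' hd' => Nat.find_min' h ⟨d', hd'⟩
    obtain ⟨m, hm, hn⟩ := hd.exists_half hS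
    rw [hn] at hd hmin
    rcases Nat.lt_or_ge m 2 with h2 | h2
    · obtain rfl : m = 1 := by omega
      exact isBiclique_or_lower_bound_of_fourCycle hS hU hb hP hd
    · exact Or.inr (hd.lower_bound hS h2 hmin hU hb hP)
  · exact isBiclique_or_lower_bound_of_leaves hS hU hb hP hiso h₁ h₂ hv

end Classification

/-! ### Complete bipartite graphs -/

/-- Bernoulli's inequality with a quadratic gain; the induction step loses `m τ² (1 + τ) ≥ 0`. -/
theorem one_add_pow_ge {τ : ℝ} (h : |τ| ≤ 1) {n : ℕ} (hn : n ≠ 0) :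
    1 + n * τ + (n - 1) * τ ^ 2 ≤ (1 + τ) ^ n := by
  obtain ⟨m, rfl⟩ := Nat.exists_eq_succ_of_ne_zero hn
  have h0 : 0 ≤ 1 + τ := by linarith [(abs_le.1 h).1]
  induction m with
  | zero => simp
  | succ m ih =>
    have h1 := mul_le_mul_of_nonneg_right (ih (by omega)) h0
    rw [← pow_succ] at h1
    refine le_trans ?_ h1
    have h2 : 0 ≤ (m : ℝ) * τ ^ 2 * (1 + τ) := by positivity
    push_cast
    nlinarith

theorem sum_powerset_pow_card {V : Type*} (N : Finset V) (τ : ℝ) :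
    ∑ B ∈ N.powerset.filter (fun B => 2 ≤ B.card), τ ^ B.card = (1 + τ) ^ N.card - 1 - N.card * τ := by
  classical
  rw [Finset.sum_filter, Finset.sum_powerset_apply_card (fun k => if 2 ≤ k then τ ^ k else 0),
    add_comm 1 τ, add_pow]
  rcases h : N.card with _ | n
  · simp
  · rw [Finset.sum_range_succ', Finset.sum_range_succ', Finset.sum_range_succ' (fun k =>
      τ ^ k * 1 ^ (n + 1 - k) * ((n + 1).choose k : ℝ)), Finset.sum_range_succ' (fun k =>
      τ ^ (k + 1) * 1 ^ (n + 1 - (k + 1)) * ((n + 1).choose (k + 1) : ℝ))]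
    simp [mul_comm]

/-- Without the empty set and the singletons, the binomial expansion leaves exactly the excess in
Bernoulli's inequality. -/
theorem sum_powerset_pow_card_ge {V : Type*} (N : Finset V) {τ : ℝ} (h : |τ| ≤ 1) :
    (if 2 ≤ N.card then τ ^ 2 else 0) ≤
      ∑ B ∈ N.powerset.filter (fun B => 2 ≤ B.card), τ ^ B.card := by
  rw [sum_powerset_pow_card]
  rcases Nat.eq_zero_or_pos N.card with h0 | h0
  · simp [h0]
  have h1 := one_add_pow_ge h h0.ne'
  split_ifs with h2
  · have h3 : (2 : ℝ) ≤ N.card := by exact_mod_cast h2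
    nlinarith [sq_nonneg τ]
  · have h3 : (1 : ℝ) ≤ N.card := by exact_mod_cast h0
    nlinarith [sq_nonneg τ]

section Bicliques

open Function

set_option linter.unusedSectionVars false

variable {V : Type*} [Fintype V] [DecidableEq V]

/-- The product of the kernel values between `s` and the nodes in `D`. -/
noncomputable def starProd (U : I → I → ℝ) (γ : Bool) (D : Finset V) (x : V → I) (s : I) : ℝ :=
  ∏ a ∈ D, orient U γ (x a) s

/-- The average of `starProd` over `s`. -/
noncomputable def starAvg (U : I → I → ℝ) (γ : Bool) (D : Finset V) (x : V → I) : ℝ :=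
  ∫ s, starProd U γ D x s

theorem bddMeas_starProd {U : I → I → ℝ} (hU : BddKer U) (γ : Bool) (D : Finset V) :
    BddMeas (fun q : (V → I) × I => starProd U γ D q.1 q.2) :=
  BddMeas.prod D fun a _ => (hU.orient γ).comp₂ (by fun_prop) (by fun_prop)

theorem bddMeas_starAvg {U : I → I → ℝ} (hU : BddKer U) (γ : Bool) (D : Finset V) :
    BddMeas (starAvg U γ D : (V → I) → ℝ) :=
  BddMeas.integral (F := fun x s => starProd U γ D x s) (bddMeas_starProd hU γ D) volume

theorem abs_starAvg_le {U : I → I → ℝ} (hb : ∀ s t, |U s t| ≤ 1) (γ : Bool) (D : Finset V)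
    (x : V → I) : |starAvg U γ D x| ≤ 1 := by
  refine abs_integral_le_one fun s => ?_
  unfold starProd
  rw [Finset.abs_prod]
  exact Finset.prod_le_one (fun _ _ => abs_nonneg _) fun _ _ => orient_abs_le hb _ _ _

theorem indep_starProd (U : I → I → ℝ) (γ : Bool) {D : Finset V} {b : V} (hb : b ∉ D) :
    Indep b (starProd U γ D) := by
  intro x s
  ext t
  refine Finset.prod_congr rfl fun a ha => ?_
  rw [update_of_ne]
  rintro rfl
  exact hb ha

theorem indep_starAvg (U : I → I → ℝ) (γ : Bool) {D : Finset V} {b : V} (hb : b ∉ D) :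
    Indep b (starAvg U γ D) := by
  intro x s
  simp only [starAvg, indep_starProd U γ hb x s]

/-- Once the coordinates in `D` are fixed, the nodes of `B` integrate independently and contribute
equal factors. -/
theorem integral_prod_starProd {U : I → I → ℝ} (hU : BddKer U) (γ : Bool) {D B : Finset V}
    (hDB : Disjoint D B) {G : (V → I) → ℝ} (hG : BddMeas G) (hGB : ∀ b ∈ B, Indep b G) :
    ∫ x, (∏ b ∈ B, starProd U γ D x (x b)) * G x = ∫ x, starAvg U γ D x ^ B.card * G x := by
  induction B using Finset.induction_on generalizing G with
  | empty => simp
  | insert b B hbB ih =>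
    have hbD : b ∉ D := fun h => Finset.disjoint_left.1 hDB h (Finset.mem_insert_self b B)
    have hDB' : Disjoint D B := hDB.mono_right (Finset.subset_insert b B)
    have hprod : BddMeas fun x : V → I => ∏ b ∈ B, starProd U γ D x (x b) :=
      BddMeas.prod B fun b _ => (bddMeas_starProd hU γ D).comp
        (by fun_prop : Measurable fun x : V → I => (x, x b))
    have hm : BddMeas fun x : V → I => (∏ b ∈ insert b B, starProd U γ D x (x b)) * G x :=
      (BddMeas.prod _ fun b _ => (bddMeas_starProd hU γ D).comp
        (by fun_prop : Measurable fun x : V → I => (x, x b))).mul hG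
    have h1 : ∀ x, avg b (fun x => (∏ b ∈ insert b B, starProd U γ D x (x b)) * G x) x =
        (∏ b ∈ B, starProd U γ D x (x b)) * (starAvg U γ D x * G x) := by
      intro x
      simp only [avg, Finset.prod_insert hbB, indep_starProd U γ hbD x, update_self,
        hGB b (Finset.mem_insert_self b B) x]
      have : ∀ s, ∏ b' ∈ B, starProd U γ D x (update x b s b') =
          ∏ b' ∈ B, starProd U γ D x (x b') := fun s =>
        Finset.prod_congr rfl fun b' hb' => by
          rw [update_of_ne]
          rintro rfl
          exact hbB hb'
      simp only [this, integral_mul_const]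
      rw [starAvg]; ring
    rw [← integral_avg hm b]
    simp only [h1]
    rw [ih hDB' ((bddMeas_starAvg hU γ D).mul hG) fun b' hb' =>
      (indep_starAvg U γ fun h => Finset.disjoint_left.1 hDB' h hb').mul
        (hGB b' (Finset.mem_insert_of_mem hb'))]
    congr 1; ext x
    rw [Finset.card_insert_of_notMem hbB]; ring

/-- The sum over all complete bipartite graphs between a fixed class `D` and at least two nodes
from `N`. -/
theorem sum_integral_prod_starProd_ge {U : I → I → ℝ} (hU : BddKer U) (hb : ∀ s t, |U s t| ≤ 1)
    (γ : Bool) {D N : Finset V} (hDN : Disjoint D N) :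
    (if 2 ≤ N.card then ∫ x : V → I, starAvg U γ D x ^ 2 else 0) ≤
      ∑ B ∈ N.powerset.filter (fun B => 2 ≤ B.card),
        ∫ x : V → I, ∏ b ∈ B, starProd U γ D x (x b) := by
  have hτ := bddMeas_starAvg (V := V) hU γ D
  have e : ∀ B ∈ N.powerset.filter (fun B => 2 ≤ B.card),
      ∫ x : V → I, ∏ b ∈ B, starProd U γ D x (x b) = ∫ x : V → I, starAvg U γ D x ^ B.card := by
    intro B hB
    have hBN := Finset.mem_powerset.1 (Finset.mem_filter.1 hB).1
    simpa using integral_prod_starProd hU γ (hDN.mono_right hBN) (BddMeas.const 1) fun _ _ _ _ => rfl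
  rw [Finset.sum_congr rfl e, ← integral_finsetSum _ fun B _ => (hτ.pow _).integrable _]
  have key : (if 2 ≤ N.card then ∫ x : V → I, starAvg U γ D x ^ 2 else 0) =
      ∫ x : V → I, if 2 ≤ N.card then starAvg U γ D x ^ 2 else 0 := by
    split_ifs <;> simp
  rw [key]
  refine MeasureTheory.integral_mono ?_ (integrable_finsetSum _ fun B _ => (hτ.pow _).integrable _)
    fun x => sum_powerset_pow_card_ge N (abs_starAvg_le hb γ D x)
  split_ifs
  · exact hτ.sq.integrable _
  · exact integrable_const 0

theorem integral_starAvg_singleton_sq {U : I → I → ℝ} (hU : BddKer U) (γ : Bool) (v : V) :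
    ∫ x : V → I, starAvg U γ {v} x ^ 2 = margSq U γ := by
  simp only [starAvg, starProd, Finset.prod_singleton]
  exact integral_marg_eval_sq hU γ v

theorem integral_starAvg_pair_sq {U : I → I → ℝ} (hU : BddKer U) {v w : V} (h : v ≠ w) :
    ∫ x : V → I, starAvg U false {v, w} x ^ 2 = cycleDens U 1 := by
  have hk : BddKer fun s t => ∫ r, U s r * U t r := hU.comp hU.swap
  simp only [starAvg, starProd, Finset.prod_pair h]
  refine (integral_eval₂ (F := fun s t => (∫ r, U s r * U t r) ^ 2) hk.sq h).trans ?_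
  rw [← hsSq_eq hk]
  simp only [cycleDens, pathKer, mul_one]
  rfl

theorem edgeProd_product (U : I → I → ℝ) (A B : Finset V) (x : V → I) :
    edgeProd U (A ×ˢ B) x = ∏ b ∈ B, starProd U false A x (x b) :=
  Finset.prod_product_right A B fun e => U (x e.1) (x e.2)

theorem edgeProd_product_singleton (U : I → I → ℝ) (A : Finset V) (b : V) (x : V → I) :
    edgeProd U (A ×ˢ {b}) x = ∏ a ∈ A, starProd U true {b} x (x a) := by
  rw [edgeProd_product]
  simp [starProd, orient]

/-! ### The sum of the biclique terms and what it dominates -/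

open Classical in
/-- The sum over all complete bipartite subgraphs with more than one edge. -/
noncomputable def bicliqueSum (U : I → I → ℝ) (E : Finset (V × V)) : ℝ :=
  ∑ S ∈ E.powerset.filter IsBiclique, ∫ x, edgeProd U S x

/-- The common neighbours in the second class of the nodes in `A`. -/
def commonRight (E : Finset (V × V)) (A : Finset V) : Finset V :=
  Finset.univ.filter fun b => ∀ a ∈ A, (a, b) ∈ E

/-- The neighbours in the first class of `b`. -/
def nbrLeft (E : Finset (V × V)) (b : V) : Finset V := Finset.univ.filter fun a => (a, b) ∈ E

theorem product_subset_iff_right {E : Finset (V × V)} {A B : Finset V} :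
    A ×ˢ B ⊆ E ↔ B ⊆ commonRight E A := by
  constructor
  · intro h b hb
    exact Finset.mem_filter.2 ⟨Finset.mem_univ _, fun a ha => h (Finset.mk_mem_product ha hb)⟩
  · rintro h ⟨a, b⟩ hab
    obtain ⟨ha, hb⟩ := Finset.mem_product.1 hab
    exact (Finset.mem_filter.1 (h hb)).2 a ha

theorem product_singleton_subset_iff {E : Finset (V × V)} {A : Finset V} {b : V} :
    A ×ˢ {b} ⊆ E ↔ A ⊆ nbrLeft E b := by
  constructor
  · intro h a ha
    exact Finset.mem_filter.2 ⟨Finset.mem_univ _,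
      h (Finset.mk_mem_product ha (Finset.mem_singleton_self b))⟩
  · rintro h ⟨a, b'⟩ hab
    obtain ⟨ha, hb⟩ := Finset.mem_product.1 hab
    obtain rfl := Finset.mem_singleton.1 hb
    exact (Finset.mem_filter.1 (h ha)).2

/-- Bicliques with at least two nodes in the second class are grouped by their first class, the
remaining stars by their centre. Each inner sum then runs over all subsets of size at least two of a
fixed set, as Bernoulli's inequality requires. Both classes being nonempty, the edge set determines
them. -/
theorem bicliqueSum_eq (U : I → I → ℝ) (E : Finset (V × V)) :
    bicliqueSum U E =
      (∑ A ∈ Finset.univ.filter (fun A : Finset V => A.Nonempty),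
        ∑ B ∈ (commonRight E A).powerset.filter (fun B => 2 ≤ B.card),
          ∫ x, edgeProd U (A ×ˢ B) x) +
      ∑ b : V, ∑ A ∈ (nbrLeft E b).powerset.filter (fun A => 2 ≤ A.card),
          ∫ x, edgeProd U (A ×ˢ {b}) x := by
  classical
  let R : Finset (Finset V × Finset V) := Finset.univ.filter fun p =>
    (p.1.Nonempty ∧ p.2.Nonempty ∧ 3 ≤ p.1.card + p.2.card) ∧ p.1 ×ˢ p.2 ⊆ E
  have hR : E.powerset.filter IsBiclique = R.image fun p => p.1 ×ˢ p.2 := by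
    ext S
    simp only [Finset.mem_filter, Finset.mem_powerset, Finset.mem_image, Prod.exists, R,
      Finset.mem_univ, true_and]
    constructor
    · rintro ⟨hSE, A, B, hA, hB, hAB, rfl⟩
      exact ⟨A, B, ⟨⟨hA, hB, hAB⟩, hSE⟩, rfl⟩
    · rintro ⟨A, B, ⟨⟨hA, hB, hAB⟩, hSE⟩, rfl⟩
      exact ⟨hSE, A, B, hA, hB, hAB, rfl⟩
  have hinj : Set.InjOn (fun p : Finset V × Finset V => p.1 ×ˢ p.2) R := by
    rintro ⟨A, B⟩ h ⟨A', B'⟩ h' hEq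
    obtain ⟨-, ⟨hA, hB, -⟩, -⟩ := Finset.mem_filter.1 h
    obtain ⟨-, ⟨hA', hB', -⟩, -⟩ := Finset.mem_filter.1 h'
    simp only at hEq hA hB hA' hB'
    have h1 := Finset.product_image_fst (s := A) hB
    have h2 := Finset.product_image_snd (t := B) hA
    rw [hEq] at h1 h2
    rw [Finset.product_image_fst hB'] at h1
    rw [Finset.product_image_snd hA'] at h2
    rw [h1, h2]
  unfold bicliqueSum
  rw [hR, Finset.sum_image hinj, ← Finset.sum_filter_add_sum_filter_not R fun p => 2 ≤ p.2.card]
  congr 1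
  · rw [Finset.sum_sigma']
    refine Finset.sum_bij' (fun p _ => ⟨p.1, p.2⟩) (fun s _ => (s.1, s.2)) ?_ ?_ ?_ ?_ ?_
    · rintro ⟨A, B⟩ h
      simp only [R, Finset.mem_filter, Finset.mem_univ, true_and] at h
      simp only [Finset.mem_sigma, Finset.mem_filter, Finset.mem_univ, true_and,
        Finset.mem_powerset]
      exact ⟨h.1.1.1, product_subset_iff_right.1 h.1.2, h.2⟩
    · rintro ⟨A, B⟩ h
      simp only [Finset.mem_sigma, Finset.mem_filter, Finset.mem_univ, true_and,
        Finset.mem_powerset] at h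
      simp only [R, Finset.mem_filter, Finset.mem_univ, true_and]
      have h1 := Finset.card_pos.2 h.1
      exact ⟨⟨⟨h.1, Finset.card_pos.1 (by omega), by omega⟩,
        product_subset_iff_right.2 h.2.1⟩, h.2.2⟩
    · exact fun _ _ => rfl
    · exact fun _ _ => rfl
    · exact fun _ _ => rfl
  · rw [Finset.sum_sigma']
    refine (Finset.sum_bij (fun s _ => (s.2, {s.1})) ?_ ?_ ?_ ?_).symm
    · rintro ⟨b, A⟩ h
      simp only [Finset.mem_sigma, Finset.mem_filter, Finset.mem_univ, true_and,
        Finset.mem_powerset] at h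
      simp only [R, Finset.mem_filter, Finset.mem_univ, true_and, Finset.card_singleton]
      exact ⟨⟨⟨Finset.card_pos.1 (by omega), Finset.singleton_nonempty _, by omega⟩,
        product_singleton_subset_iff.2 h.1⟩, by omega⟩
    · rintro ⟨b, A⟩ _ ⟨b', A'⟩ _ hEq
      obtain ⟨rfl, h2⟩ := Prod.mk.inj hEq
      obtain rfl := Finset.singleton_injective h2
      rfl
    · rintro ⟨A, B⟩ h
      simp only [R, Finset.mem_filter, Finset.mem_univ, true_and] at h
      obtain ⟨⟨⟨hA, hB, hAB⟩, hE⟩, h2⟩ := h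
      have h1 := Finset.card_pos.2 hB
      obtain ⟨b, rfl⟩ := Finset.card_eq_one.1 (by omega : B.card = 1)
      refine ⟨⟨b, A⟩, ?_, rfl⟩
      simp only [Finset.mem_sigma, Finset.mem_filter, Finset.mem_univ, true_and,
        Finset.mem_powerset]
      exact ⟨product_singleton_subset_iff.1 hE, by omega⟩
    · exact fun _ _ => rfl

variable {E : Finset (V × V)} {c : V → Bool}

theorem disjoint_commonRight (hE : IsBip c E) {A : Finset V} :
    Disjoint A (commonRight E A) := by
  refine Finset.disjoint_left.2 fun a ha ha' => ?_
  have h := hE _ ((Finset.mem_filter.1 ha').2 a ha)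
  simp_all

theorem disjoint_nbrLeft (hE : IsBip c E) (b : V) : Disjoint {b} (nbrLeft E b) := by
  refine Finset.disjoint_singleton_left.2 fun h => ?_
  have h := hE _ (Finset.mem_filter.1 h).2
  simp_all

section

variable {U : I → I → ℝ}

theorem sum_commonRight_ge (hE : IsBip c E) (hU : BddKer U) (hb : ∀ s t, |U s t| ≤ 1)
    (A : Finset V) :
    (if 2 ≤ (commonRight E A).card then ∫ x : V → I, starAvg U false A x ^ 2 else 0) ≤
      ∑ B ∈ (commonRight E A).powerset.filter (fun B => 2 ≤ B.card),
        ∫ x, edgeProd U (A ×ˢ B) x := by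
  simp only [edgeProd_product]
  exact sum_integral_prod_starProd_ge hU hb false (disjoint_commonRight hE)

theorem sum_nbrLeft_ge (hE : IsBip c E) (hU : BddKer U) (hb : ∀ s t, |U s t| ≤ 1) (b : V) :
    (if 2 ≤ (nbrLeft E b).card then margSq U true else 0) ≤
      ∑ A ∈ (nbrLeft E b).powerset.filter (fun A => 2 ≤ A.card),
          ∫ x, edgeProd U (A ×ˢ {b}) x := by
  simp only [edgeProd_product_singleton]
  have := sum_integral_prod_starProd_ge hU hb true (disjoint_nbrLeft hE b)
  rwa [integral_starAvg_singleton_sq hU] at this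

theorem sum_commonRight_nonneg (hE : IsBip c E) (hU : BddKer U) (hb : ∀ s t, |U s t| ≤ 1)
    (A : Finset V) :
    0 ≤ ∑ B ∈ (commonRight E A).powerset.filter (fun B => 2 ≤ B.card),
        ∫ x, edgeProd U (A ×ˢ B) x := by
  refine le_trans ?_ (sum_commonRight_ge hE hU hb A)
  split_ifs
  · exact integral_nonneg fun _ => sq_nonneg _
  · exact le_rfl

theorem sum_nbrLeft_nonneg (hE : IsBip c E) (hU : BddKer U) (hb : ∀ s t, |U s t| ≤ 1) (b : V) :
    0 ≤ ∑ A ∈ (nbrLeft E b).powerset.filter (fun A => 2 ≤ A.card),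
          ∫ x, edgeProd U (A ×ˢ {b}) x := by
  refine le_trans ?_ (sum_nbrLeft_ge hE hU hb b)
  split_ifs
  · exact margSq_nonneg U true
  · exact le_rfl

theorem bicliqueSum_nonneg (hE : IsBip c E) (hU : BddKer U) (hb : ∀ s t, |U s t| ≤ 1) :
    0 ≤ bicliqueSum U E := by
  rw [bicliqueSum_eq]
  exact add_nonneg
    (Finset.sum_nonneg fun A _ => sum_commonRight_nonneg hE hU hb A)
    (Finset.sum_nonneg fun b _ => sum_nbrLeft_nonneg hE hU hb b)

theorem integral_starAvg_sq_le_bicliqueSum (hE : IsBip c E) (hU : BddKer U)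
    (hb : ∀ s t, |U s t| ≤ 1) {A : Finset V} (hA : A.Nonempty) (h : 2 ≤ (commonRight E A).card) :
    ∫ x : V → I, starAvg U false A x ^ 2 ≤ bicliqueSum U E := by
  have h1 := sum_commonRight_ge hE hU hb A
  rw [if_pos h] at h1
  rw [bicliqueSum_eq]
  refine (h1.trans (Finset.single_le_sum (f := fun A => ∑ B ∈ (commonRight E A).powerset.filter
    (fun B => 2 ≤ B.card), ∫ x, edgeProd U (A ×ˢ B) x) (fun A _ =>
    sum_commonRight_nonneg hE hU hb A)
    (Finset.mem_filter.2 ⟨Finset.mem_univ A, hA⟩))).trans (le_add_of_nonneg_right ?_)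
  exact Finset.sum_nonneg fun b _ => sum_nbrLeft_nonneg hE hU hb b

theorem margSq_true_le_bicliqueSum (hE : IsBip c E) (hU : BddKer U)
    (hb : ∀ s t, |U s t| ≤ 1) {b : V} (h : 2 ≤ (nbrLeft E b).card) :
    margSq U true ≤ bicliqueSum U E := by
  have h1 := sum_nbrLeft_ge hE hU hb b
  rw [if_pos h] at h1
  have h2 : ∀ b' ∈ Finset.univ, 0 ≤ ∑ A ∈ (nbrLeft E b').powerset.filter
      (fun A => 2 ≤ A.card), ∫ x, edgeProd U (A ×ˢ {b'}) x :=
    fun b' _ => sum_nbrLeft_nonneg hE hU hb b'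
  have h3 := Finset.single_le_sum h2 (Finset.mem_univ b)
  rw [bicliqueSum_eq]
  refine (h1.trans h3).trans (le_add_of_nonneg_left ?_)
  exact Finset.sum_nonneg fun A _ => sum_commonRight_nonneg hE hU hb A

theorem SAdj.mem_of_false (hE : IsBip c E) {v w : V} (h : SAdj E v w) (hv : c v = false) :
    (v, w) ∈ E := by
  rcases h with h | h
  · exact h
  · have := (hE _ h).2; simp_all

theorem margSq_le_bicliqueSum (hE : IsBip c E) (hU : BddKer U) (hb : ∀ s t, |U s t| ≤ 1)
    {v u₁ u₂ : V} (hu : u₁ ≠ u₂) (h₁ : SAdj E v u₁) (h₂ : SAdj E v u₂) :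
    margSq U (c v) ≤ bicliqueSum U E := by
  cases hc : c v
  · rw [← integral_starAvg_singleton_sq hU false v]
    refine integral_starAvg_sq_le_bicliqueSum hE hU hb (Finset.singleton_nonempty v)
      (Finset.one_lt_card.2 ⟨u₁, ?_, u₂, ?_, hu⟩)
    · simpa [commonRight] using h₁.mem_of_false hE hc
    · simpa [commonRight] using h₂.mem_of_false hE hc
  · refine margSq_true_le_bicliqueSum hE hU hb (b := v)
      (Finset.one_lt_card.2 ⟨u₁, ?_, u₂, ?_, hu⟩)
    · have := hE.color h₁
      simpa [nbrLeft] using h₁.symm.mem_of_false hE (by simp_all)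
    · have := hE.color h₂
      simpa [nbrLeft] using h₂.symm.mem_of_false hE (by simp_all)

/-- Take for `A` the two nodes of the 4-cycle in the first class: the gain `∫ τ²` is then the
4-cycle density. -/
theorem cycleDens_one_le_bicliqueSum (hE : IsBip c E) (hU : BddKer U) (hb : ∀ s t, |U s t| ≤ 1)
    {d : ℕ → V} (hd : IsCyc E 4 d) : cycleDens U 1 ≤ bicliqueSum U E := by
  have key : ∀ d : ℕ → V, IsCyc E 4 d → c (d 0) = false → cycleDens U 1 ≤ bicliqueSum U E := by
    intro d hd h0
    have e40 : d 4 = d 0 := hd.per 0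
    have h01 := hd.adj 0
    have h12 := hd.adj 1
    have h23 := hd.adj 2
    have h30 := hd.adj 3
    simp only [zero_add, Nat.reduceAdd, e40] at h01 h12 h23 h30
    have h2 : c (d 2) = false := by
      have c1 := hE.color h01
      have c2 := hE.color h12
      simp_all
    have h02 : d 0 ≠ d 2 := hd.ne (by omega) (by omega)
    rw [← integral_starAvg_pair_sq hU h02]
    refine integral_starAvg_sq_le_bicliqueSum hE hU hb (Finset.insert_nonempty _ _)
      (Finset.one_lt_card.2 ⟨d 1, ?_, d 3, ?_, hd.ne (by omega) (by omega)⟩)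
    · simpa [commonRight] using ⟨h01.mem_of_false hE h0, h12.symm.mem_of_false hE h2⟩
    · simpa [commonRight] using ⟨h30.symm.mem_of_false hE h0, h23.mem_of_false hE h2⟩
  cases h0 : c (d 0)
  · exact key d hd h0
  · refine key _ (hd.rotate 1) ?_
    have := hE.color (hd.adj 0)
    simp_all

/-! ### Summing up -/

/-- The at most `2 ^ E.card` terms outside `𝒢` lose at most `fourRoot U * P` each, in total no more
than the sum `P` over `𝒢`; the 1 of the empty set survives. -/
theorem one_le_sum_of_dominates (hE : IsBip c E) (hU : BddKer U) (hb : ∀ s t, |U s t| ≤ 1)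
    (h0 : ∫ p : I × I, U p.1 p.2 = 0) {𝒢 : Finset (Finset (V × V))} (h𝒢 : 𝒢 ⊆ E.powerset)
    (hne : ∅ ∉ 𝒢) (hbi : ∀ S ⊆ E, IsBiclique S → S ∈ 𝒢)
    (hP : Dominates U c E (∑ S ∈ 𝒢, ∫ x, edgeProd U S x))
    (hε : 2 ^ E.card * fourRoot U ≤ 1) : 1 ≤ ∑ S ∈ E.powerset, ∫ x, edgeProd U S x := by
  set P := ∑ S ∈ 𝒢, ∫ x, edgeProd U S x with hPdef
  have hsub : insert ∅ 𝒢 ⊆ E.powerset := Finset.insert_subset (Finset.empty_mem_powerset E) h𝒢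
  rw [← Finset.sum_sdiff hsub, Finset.sum_insert hne, ← hPdef]
  have h1 : ∫ x : V → I, edgeProd U ∅ x = 1 := by simp [edgeProd]
  have h2 : -P ≤ ∑ S ∈ E.powerset \ insert ∅ 𝒢, ∫ x, edgeProd U S x := by
    have h3 : ∀ S ∈ E.powerset \ insert ∅ 𝒢, -(fourRoot U * P) ≤ ∫ x, edgeProd U S x := by
      intro S hS
      obtain ⟨hSE, hS⟩ := Finset.mem_sdiff.1 hS
      rw [Finset.mem_insert, not_or] at hS
      have hSE := Finset.mem_powerset.1 hSE
      exact (isBiclique_or_lower_bound (hE.mono hSE) (Finset.nonempty_iff_ne_empty.2 hS.1) hU hb h0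
        (hP.mono hSE)).resolve_left fun h => hS.2 (hbi S hSE h)
    have h4 := Finset.card_nsmul_le_sum _ _ _ h3
    refine le_trans ?_ h4
    have h5 : ((E.powerset \ insert ∅ 𝒢).card : ℝ) ≤ 2 ^ E.card := by
      have := Finset.card_le_card (Finset.sdiff_subset (s := E.powerset) (t := insert ∅ 𝒢))
      rw [Finset.card_powerset] at this
      exact_mod_cast this
    have h6 : ((E.powerset \ insert ∅ 𝒢).card : ℝ) * (fourRoot U * P) ≤ P := by
      calc _ ≤ 2 ^ E.card * (fourRoot U * P) :=
            mul_le_mul_of_nonneg_right h5 (mul_nonneg (fourRoot_nonneg U) hP.nonneg)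
        _ = (2 ^ E.card * fourRoot U) * P := by ring
        _ ≤ 1 * P := mul_le_mul_of_nonneg_right hε hP.nonneg
        _ = P := one_mul P
    rw [nsmul_eq_mul]
    linarith
  linarith

/-- In a graph of girth at least six, a shortest cycle is not complete bipartite. -/
theorem not_isBiclique_of_isCyc {S : Finset (V × V)} (hS : IsBip c S) {m : ℕ} (hm : 2 ≤ m)
    {d : ℕ → V} (hd : IsCyc S (2 * (m + 1)) d) (hmin : CycLB S (2 * (m + 1))) :
    ¬ IsBiclique S := by
  rintro ⟨A, B, -, -, -, rfl⟩
  have h03 : ¬ SAdj (A ×ˢ B) (d 0) (d 3) := by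
    intro h
    rcases hd.chord hmin (by omega) (by omega) h with h' | h' <;> omega
  have h01 := hd.adj 0
  have h23 := hd.adj 2
  have c1 := hS.color h01
  have c2 := hS.color (hd.adj 1)
  have c3 := hS.color h23
  have memA : ∀ v w, SAdj (A ×ˢ B) v w → c v = false → v ∈ A := fun v w h hv =>
    (Finset.mem_product.1 (h.mem_of_false hS hv)).1
  have memB : ∀ v w, SAdj (A ×ˢ B) v w → c v = true → v ∈ B := fun v w h hv =>
    (Finset.mem_product.1 (h.symm.mem_of_false hS (by have := hS.color h; simp_all))).2
  cases h0 : c (d 0)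
  · exact h03 (Or.inl (Finset.mk_mem_product (memA _ _ h01 h0)
      (memB _ _ h23.symm (by simp_all))))
  · exact h03 (Or.inr (Finset.mk_mem_product (memA _ _ h23.symm (by simp_all))
      (memB _ _ h01 h0)))

theorem one_le_sum_integral_edgeProd (hE : IsBip c E) (hU : BddKer U) (hb : ∀ s t, |U s t| ≤ 1)
    (h0 : ∫ p : I × I, U p.1 p.2 = 0) (hε : 2 ^ E.card * fourRoot U ≤ 1) :
    1 ≤ ∑ S ∈ E.powerset, ∫ x, edgeProd U S x := by
  classical
  set 𝓑 := E.powerset.filter IsBiclique with h𝓑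
  have hsum : ∑ S ∈ 𝓑, ∫ x, edgeProd U S x = bicliqueSum U E := by
    unfold bicliqueSum
    exact Finset.sum_congr (Finset.filter_congr_decidable _ _ _) fun _ _ => rfl
  have hsub : 𝓑 ⊆ E.powerset := Finset.filter_subset _ _
  have hne : ∅ ∉ 𝓑 := by
    intro h
    obtain ⟨-, A, B, hA, hB, -, h⟩ := Finset.mem_filter.1 h
    exact (hA.product hB).ne_empty h.symm
  have hbi : ∀ S ⊆ E, IsBiclique S → S ∈ 𝓑 := fun S hS h =>
    Finset.mem_filter.2 ⟨Finset.mem_powerset.2 hS, h⟩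
  have hnn := bicliqueSum_nonneg hE hU hb
  by_cases hcyc : ∃ n d, IsCyc E n d
  · obtain ⟨d, hd⟩ := Nat.find_spec hcyc
    have hmin : CycLB E (Nat.find hcyc) := fun m d' hd' => Nat.find_min' hcyc ⟨d', hd'⟩
    obtain ⟨m, hm, hn⟩ := hd.exists_half hE
    rw [hn] at hd hmin
    have hanti : ∀ k d', k ≠ 0 → IsCyc E (2 * (k + 1)) d' → cycleDens U k ≤ cycleDens U m := by
      intro k d' _ hd'
      have := hmin _ _ hd'
      exact cycleDens_anti hU hb hm (by omega)
    rcases Nat.lt_or_ge m 2 with h2 | h2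
    · obtain rfl : m = 1 := by omega
      refine one_le_sum_of_dominates hE hU hb h0 hsub hne hbi ?_ hε
      rw [hsum]
      exact ⟨hnn, fun v u₁ u₂ hu h₁ h₂ => margSq_le_bicliqueSum hE hU hb hu h₁ h₂,
        fun k d' hk hd' => (hanti k d' hk hd').trans (cycleDens_one_le_bicliqueSum hE hU hb hd)⟩
    -- In the absence of 4-cycles, the term of a shortest cycle is added to make the total dominate
    -- cycle densities. Its edge set `C` is not a biclique, so it is not counted twice.
    · set C := E.filter fun e => (∃ i, e.1 = d i) ∧ ∃ i, e.2 = d i with hC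
      have hCE : C ⊆ E := Finset.filter_subset _ _
      have hCbip : IsBip c C := hE.mono hCE
      have hdC : IsCyc C (2 * (m + 1)) d :=
        ⟨hd.three_le, hd.per, fun i => (hd.adj i).imp
          (fun h => Finset.mem_filter.2 ⟨h, ⟨i, rfl⟩, ⟨i + 1, rfl⟩⟩)
          fun h => Finset.mem_filter.2 ⟨h, ⟨i + 1, rfl⟩, ⟨i, rfl⟩⟩, hd.inj⟩
      have hminC : CycLB C (2 * (m + 1)) := fun k d' hd' => hmin k d' (hd'.mono hCE)
      have hCn : C ∉ 𝓑 := fun h =>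
        not_isBiclique_of_isCyc hCbip h2 hdC hminC (Finset.mem_filter.1 h).2
      have hCint : ∫ x, edgeProd U C x = cycleDens U m := by
        refine hdC.integral_eq hCbip hm hminC hU hb ?_
        rintro v w (h | h)
        · exact (Finset.mem_filter.1 h).2.1
        · exact (Finset.mem_filter.1 h).2.2
      have hC0 : C ≠ ∅ := by
        rintro h
        rcases hdC.adj 0 with h' | h' <;> rw [h] at h' <;> simp at h'
      refine one_le_sum_of_dominates hE hU hb h0 (𝒢 := insert C 𝓑)
        (Finset.insert_subset (Finset.mem_powerset.2 hCE) hsub)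
        (fun h => (Finset.mem_insert.1 h).elim (fun h => hC0 h.symm) hne)
        (fun S hS h => Finset.mem_insert_of_mem (hbi S hS h)) ?_ hε
      rw [Finset.sum_insert hCn, hsum, hCint]
      have hc0 := cycleDens_nonneg U m
      refine ⟨by linarith, fun v u₁ u₂ hu h₁ h₂ => ?_, fun k d' hk hd' => ?_⟩
      · linarith [margSq_le_bicliqueSum hE hU hb hu h₁ h₂]
      · linarith [hanti k d' hk hd']
  · refine one_le_sum_of_dominates hE hU hb h0 hsub hne hbi ?_ hε
    rw [hsum]
    exact ⟨hnn, fun v u₁ u₂ hu h₁ h₂ => margSq_le_bicliqueSum hE hU hb hu h₁ h₂,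
      fun k d' _ hd' => absurd ⟨_, d', hd'⟩ hcyc⟩

end

end Bicliques

/-! ### Densities of bigraphs -/

theorem isBip_bigraphEdges {V : Type*} [Fintype V] (F : SimpleGraph V) (c : F.Coloring Bool) :
    IsBip c (bigraphEdges F c) := by
  intro e he
  simp only [bigraphEdges, Finset.mem_filter] at he
  exact he.2.2

theorem sAdj_bigraphEdges {V : Type*} [Fintype V] {F : SimpleGraph V} (c : F.Coloring Bool)
    {v w : V} (h : F.Adj v w) : SAdj (bigraphEdges F c) v w := by
  have hc := c.valid h
  simp only [SAdj, bigraphEdges, Finset.mem_filter, Finset.mem_univ, true_and]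
  cases hv : c v <;> cases hw : c w
  · simp_all
  · exact Or.inl ⟨h, rfl, rfl⟩
  · exact Or.inr ⟨h.symm, rfl, rfl⟩
  · simp_all

theorem card_bigraphEdges_le {V : Type*} [Fintype V] (F : SimpleGraph V) (c : F.Coloring Bool) :
    (bigraphEdges F c).card ≤ F.edgeSet.ncard := by
  classical
  rw [← Set.ncard_coe_finset]
  refine Set.ncard_le_ncard_of_injOn (fun e => s(e.1, e.2)) ?_ ?_ (Set.toFinite _)
  · intro e he
    simp only [bigraphEdges, Finset.coe_filter, Set.mem_ofPred_eq] at he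
    exact he.2.1
  · intro e he e' he' h
    have h1 := isBip_bigraphEdges F c e (Finset.mem_coe.1 he)
    have h2 := isBip_bigraphEdges F c e' (Finset.mem_coe.1 he')
    rcases Sym2.eq_iff.1 h with ⟨h3, h4⟩ | ⟨h3, h4⟩
    · exact Prod.ext h3 h4
    · rw [h3] at h1; simp_all

theorem fourCycleDensity_eq {U : I → I → ℝ} (hU : BddKer U) (hb : ∀ s t, |U s t| ≤ 1) :
    fourCycleDensity U = cycleDens U 1 := by
  set c := SimpleGraph.cycleGraph.bicoloring_of_even 4 (by decide) with hc
  have hS := isBip_bigraphEdges (SimpleGraph.cycleGraph 4) c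
  have hcyc : IsCyc (bigraphEdges (SimpleGraph.cycleGraph 4) c) (2 * (1 + 1))
      (fun i => Fin.ofNat 4 i) := by
    refine ⟨by omega, fun i => ?_, fun i => sAdj_bigraphEdges c ?_, fun i j hij => ?_⟩
    · ext; simp
    · rw [SimpleGraph.cycleGraph_adj]
      right
      ext
      simp [Fin.sub_def]
      omega
    · have h : i % 4 = j % 4 := by simpa [Fin.ext_iff] using hij
      exact h
  -- Minimality is automatic: a bipartite cycle has even length, hence at least 4.
  refine hcyc.integral_eq hS one_ne_zero (fun n d hd => ?_) hU hb fun v w _ => ⟨v, by simp⟩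
  obtain ⟨m, hm, rfl⟩ := hd.exists_half hS
  omega

theorem mainTheorem5 {V : Type*} [Fintype V] (F : SimpleGraph V) (c : F.Coloring Bool)
    (m : ℕ) (hm : F.edgeSet.ncard = m)
    (W : I → I → ℝ) (hW : Measurable (Function.uncurry W))
    (hW_int : ∫ p : I × I, W p.1 p.2 = 1)
    (hW_bd : ∀ x y, 0 ≤ W x y ∧ W x y ≤ 2)
    (hW_C4 : fourCycleDensity (fun x y => W x y - 1) ≤ 1 / 2 ^ (4 * m)) :
    1 ≤ bigraphDensity F c W := by
  classical
  set U : I → I → ℝ := fun x y => W x y - 1 with hUdef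
  have hb : ∀ s t, |U s t| ≤ 1 := fun s t => by
    have := hW_bd s t
    exact abs_le.2 ⟨by simp only [hUdef]; linarith, by simp only [hUdef]; linarith⟩
  have hU : BddKer U := ⟨hW.sub_const 1, 1, fun p => hb p.1 p.2⟩
  have hWb : BddKer W := ⟨hW, 2, fun p => abs_le.2
    ⟨by linarith [(hW_bd p.1 p.2).1], (hW_bd p.1 p.2).2⟩⟩
  have h0 : ∫ p : I × I, U p.1 p.2 = 0 := by
    simp only [hUdef]
    rw [integral_sub (hWb.integrable _) (integrable_const 1), hW_int]
    simp
  set E := bigraphEdges F c with hEdef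
  have hcard : E.card ≤ m := hm ▸ card_bigraphEdges_le F c
  have hε : 2 ^ E.card * fourRoot U ≤ 1 := by
    rw [fourCycleDensity_eq hU hb] at hW_C4
    -- Two nested square roots turn `2^(-4m)` into `2^(-m)`.
    have h1 : fourRoot U ≤ 1 / 2 ^ m := by
      refine Real.sqrt_le_iff.2 ⟨by positivity, Real.sqrt_le_iff.2 ⟨by positivity, ?_⟩⟩
      refine hW_C4.trans (le_of_eq ?_)
      rw [div_pow, div_pow, one_pow, one_pow, ← pow_mul, ← pow_mul]
      congr 2; omega
    calc (2 : ℝ) ^ E.card * fourRoot U ≤ 2 ^ m * (1 / 2 ^ m) :=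
          mul_le_mul (pow_le_pow_right₀ one_le_two hcard) h1 (fourRoot_nonneg U) (by positivity)
      _ = 1 := by field_simp
  refine (one_le_sum_integral_edgeProd (isBip_bigraphEdges F c) hU hb h0 hε).trans (le_of_eq ?_)
  rw [← integral_finsetSum _ fun S _ => (bddMeas_edgeProd hU S).integrable _]
  unfold bigraphDensity
  congr 1; ext x
  have : ∀ e ∈ E, W (x e.1) (x e.2) = 1 + U (x e.1) (x e.2) := fun e _ => by simp [hUdef]
  rw [← hEdef, Finset.prod_congr rfl this, Finset.prod_one_add]
  rfl
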